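/- Let $\lambda>0$ and $P\in\mathbb R$. A function $\psi\in H^1(\mathbb T)$, $\mathbb T=\mathbb R/2\pi\mathbb Z$ (continuous representative), is called a \emph{solution} with pressure $P$ if $$2(\lambda-1)P=-(2\lambda-1)(\psi')^2+\lambda^2\psi^2-\lambda\,\psi\psi'\,\partial_\theta$$ in the sense of distributions on $\mathbb T$, i.e. $$2(\lambda-1)P\int_{\mathbb T}\varphi\,d\theta=\int_{\mathbb T}\bigl[(-(2\lambda-1)(\psi')^2+\lambda^2\psi^2)\varphi-\lambda\psi\psi'\varphi'\bigr]d\theta\qquad\text{for all }\varphi\in C^\infty(\mathbb T).$$ (This is the equation for the $(\lambda-1)$-homogeneous stationary Euler flow with stream function $\Psi=r^\lambda\psi(\theta)$ and pressure $p=r^{2\lambda-2}P$.) A solution is \emph{hyperbolic} if it vanishes at two or more points of $\mathbb T$ and is not a parallel shear flow, i.e. not, up to rotation, of the form $|\cos\theta|^\lambda(A\,1_{\cos\theta>0}+C\,1_{\cos\theta\le0})$ with $A,C\in\mathbb R$; it is \emph{parabolic} if it vanishes at exactly one point of $\mathbb T$. A \emph{local solution} is a pair $(\psi,(a,b))$ with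 $a<b$ real and $\psi\in H^1(a,b)$ solving the same equation in the sense of distributions on $(a,b)$, with $\psi\neq0$ on $(a,b)$ and $\psi(a)=\psi(b)=0$; its \emph{life-span} is $T=b-a$. Hyperbolic solutions: \begin{itemize} \item If $\frac12<\lambda<1$, then for every $P>0$ there are infinitely many hyperbolic solutions with pressure $P$, no two of which are related by rotation, reflection and multiplication by nonzero constants; for $P<0$ there are none. \item If $0<\lambda\le\frac12$, there are no hyperbolic solutions, for any $P\in\mathbb R$. \item If $\lambda>1$, then for every $P<0$ there are infinitely many hyperbolic solutions with pressure $P$, no two of which are related by these symmetries; for $P>0$ there are none. \end{itemize} Life-spans: every local solution is differentiable on $(a,b)$ and has a Bernoulli constant, i.e. $(2P+\lambda^2\psi^2+(\psi')^2)\,|\psi|^{\frac2\lambda-2}$ equals a constant $B$ on $(a,b)$. \begin{itemize} \item If $\lambda>1$ and $P<0$, then for every $B\in\mathbb R$ local solutions with pressure $P$ and Bernoulli constant $B$ exist and all have the same life-span $T(B)$. The range of $T$ over $B>0$ is exactly $(\frac\pi\lambda,\pi)$, $T(0)=\frac\pi\lambda$, and the range over $B<0$ is exactly $(0,\frac\pi\lambda)$.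 \item If $\frac12<\lambda<1$ and $P>0$, then every local solution has $B>0$; for every $B>0$ local solutions exist and all have the same life-span $T(B)$, and the range of $T$ over $B>0$ is exactly $(0,\pi)$. \item If $\frac12<\lambda<1$, $P<0$ and $B>0$, every local solution has life-span in $(\pi,\frac\pi\lambda)$. \item If $0<\lambda\le\frac12$, there is no local solution with $B>0$, for any $P\in\mathbb R$. \end{itemize} Parabolic solutions: for $\lambda>0$ and $P\in\mathbb R$, $\psi$ is a parabolic solution with pressure $P$ if and only if $\lambda=\frac12$ and, for some $\gamma>0$ and $\theta_0\in\mathbb R$, $P=-\frac\gamma4$ and $\psi(\theta)=\sqrt{\gamma+\gamma\cos(\theta-\theta_0)}$ for all $\theta$ or $\psi(\theta)=-\sqrt{\gamma+\gamma\cos(\theta-\theta_0)}$ for all $\theta$. -/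

import Mathlib

open Real Set MeasureTheory
open scoped ContDiff

namespace HomEuler

/-- `ψ` is (the continuous representative of) an element of `H¹(a,b)` with weak derivative `g`:
`g ∈ L²(a,b)` and `ψ` is a primitive of `g` on `[a,b]`. -/
def IsH1On (ψ g : ℝ → ℝ) (a b : ℝ) : Prop :=
  MemLp g 2 (volume.restrict (Ioo a b)) ∧
    ∀ x ∈ Icc a b, ∀ y ∈ Icc a b, ψ y - ψ x = ∫ t in x..y, g t

/-- The identity `2(λ-1)P = -(2λ-1)(ψ')² + λ²ψ² - λψψ'∂_θ`, with `ψ' = g`, tested against `φ`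
on `(a,b)`. -/
def WeakIdentity (lam P : ℝ) (ψ g φ : ℝ → ℝ) (a b : ℝ) : Prop :=
  ∫ θ in a..b, 2 * (lam - 1) * P * φ θ =
    ∫ θ in a..b, ((-(2 * lam - 1) * g θ ^ 2 + lam ^ 2 * ψ θ ^ 2) * φ θ
      - lam * ψ θ * g θ * deriv φ θ)

/-- `ψ ∈ H¹(𝕋)`, viewed as a `2π`-periodic function on `ℝ`, is a distributional solution on the
whole circle with pressure `P`, so that `Ψ = r^λ ψ(θ)` is the stream function. -/
def IsSolution (lam P : ℝ) (ψ : ℝ → ℝ) : Prop :=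
  Function.Periodic ψ (2 * π) ∧
    ∃ g : ℝ → ℝ, IsH1On ψ g 0 (2 * π) ∧
      ∀ φ : ℝ → ℝ, ContDiff ℝ ∞ φ → Function.Periodic φ (2 * π) →
        WeakIdentity lam P ψ g φ 0 (2 * π)

/-- `(ψ, (a,b))` is a local solution with pressure `P`: `ψ ∈ H¹(a,b)` solves the equation on
`(a,b)` in the sense of distributions and `(a,b)` is a life-time of `ψ`. Its life-span is
`b - a`. -/
def IsLocalSolution (lam P : ℝ) (ψ : ℝ → ℝ) (a b : ℝ) : Prop :=
  a < b ∧ ψ a = 0 ∧ ψ b = 0 ∧ (∀ θ ∈ Ioo a b, ψ θ ≠ 0) ∧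
    ∃ g : ℝ → ℝ, IsH1On ψ g a b ∧
      ∀ φ : ℝ → ℝ, ContDiff ℝ ∞ φ → HasCompactSupport φ → tsupport φ ⊆ Ioo a b →
        WeakIdentity lam P ψ g φ a b

/-- `ψ` is differentiable on `(a,b)` and its Bernoulli function
`(2P + λ²ψ² + (ψ')²)|ψ|^(2/λ-2)` is constant there, equal to `B`. -/
def HasBernoulli (lam P B : ℝ) (ψ : ℝ → ℝ) (a b : ℝ) : Prop :=
  ∀ θ ∈ Ioo a b, DifferentiableAt ℝ ψ θ ∧
    (2 * P + lam ^ 2 * ψ θ ^ 2 + deriv ψ θ ^ 2) * |ψ θ| ^ (2 / lam - 2) = B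

/-- For every `B ∈ S` there are local solutions with pressure `P` and Bernoulli constant `B`,
and all of them have life-span `T B`. -/
def IsLifeSpanFunction (lam P : ℝ) (S : Set ℝ) (T : ℝ → ℝ) : Prop :=
  ∀ B ∈ S,
    (∃ (ψ : ℝ → ℝ) (a b : ℝ), IsLocalSolution lam P ψ a b ∧ HasBernoulli lam P B ψ a b) ∧
    ∀ (ψ : ℝ → ℝ) (a b : ℝ), IsLocalSolution lam P ψ a b → HasBernoulli lam P B ψ a b →
      b - a = T B

/-- Parallel shear flow: up to rotation `Ψ = |x|^λ (A 1_{x>0} + C 1_{x≤0})`. -/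
def IsParallelShear (lam : ℝ) (ψ : ℝ → ℝ) : Prop :=
  ∃ A C θ₀ : ℝ, ∀ θ : ℝ,
    ψ θ = |cos (θ - θ₀)| ^ lam * (if 0 < cos (θ - θ₀) then A else C)

/-- A hyperbolic solution: it vanishes at two or more points of the circle and is not a parallel
shear flow. -/
def IsHyperbolic (lam P : ℝ) (ψ : ℝ → ℝ) : Prop :=
  IsSolution lam P ψ ∧
    (∃ θ₁ ∈ Ico 0 (2 * π), ∃ θ₂ ∈ Ico 0 (2 * π), θ₁ ≠ θ₂ ∧ ψ θ₁ = 0 ∧ ψ θ₂ = 0) ∧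
    ¬ IsParallelShear lam ψ

/-- A (proper) parabolic solution: it vanishes at exactly one point of the circle. -/
def IsParabolic (lam P : ℝ) (ψ : ℝ → ℝ) : Prop :=
  IsSolution lam P ψ ∧ ∃! θ : ℝ, θ ∈ Ico 0 (2 * π) ∧ ψ θ = 0

/-- Equivalence under the symmetries rotation, scaling and reflection. -/
def SymEquiv (ψ₁ ψ₂ : ℝ → ℝ) : Prop :=
  ∃ α σ θ₀ : ℝ, α ≠ 0 ∧ (σ = 1 ∨ σ = -1) ∧ ∀ θ : ℝ, ψ₂ θ = α * ψ₁ (σ * θ + θ₀)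

/-- There are infinitely many hyperbolic solutions with pressure `P`, no two of which are
related by the symmetries. -/
def InfinitelyManyHyperbolic (lam P : ℝ) : Prop :=
  ∃ ψ : ℕ → ℝ → ℝ, (∀ n, IsHyperbolic lam P (ψ n)) ∧
    ∀ m n, m ≠ n → ¬ SymEquiv (ψ m) (ψ n)

end HomEuler

/-!
On an arc between consecutive zeros, the flux `λψψ'` of a weak solution is absolutely continuous and
vanishes at both ends, since otherwise `(ψ')²` would behave like `1/(x-a)` there. Hence `ψ` is a
classical solution inside the arc, and its Bernoulli constant `B` is a first integral.

With `M` the maximum of `|ψ|` and `κ = 2P/(λM)²`, the function `v = (|ψ|/M)^(1/λ)` satisfies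
`(v')² = 1 - v² + κ (1 - v^(2-2λ))`. If `κ (1-λ) ≥ 0`, put `v = sin p`: then `(p')² = 1 + |κ| e(p)`
with `e(p) = |1 - (sin p)^(2-2λ)| / cos² p`, and the arc has length `∫₀^π dp / √(1 + |κ| e(p))`.
For `λ ≠ 1` this decreases continuously from `π` to `0` as `|κ|` grows, and for `λ > 1` it is `π/λ`
at `|κ| = 1`, that is, at `B = 0`. Arcs of length `2π/N` with `N ≥ 3` glue to hyperbolic solutions,
one for each `N`.

If `0 < λ < 1` and `P < 0`, all arcs are longer than `π`, so two zeros do not fit on the circle. If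
`λ > 1` and `P > 0`, or `λ ≤ 1/2` and `P ≥ 0`, the behaviour at a zero excludes arcs altogether.
For `B = 0`, the only case left when `λ ≤ 1/2`, an arc is `ψ = ± M cos(λ(θ - c))` of length `π/λ`,
which fills the circle exactly when `λ = 1/2`: these are the parabolic solutions.
-/

namespace HomEuler

open Filter Topology intervalIntegral

/-- A test function on `(a,b)`, as in the definition of a local solution. -/
structure IsTestFunction (φ : ℝ → ℝ) (a b : ℝ) : Prop where
  contDiff : ContDiff ℝ ∞ φ
  hasCompactSupport : HasCompactSupport φ
  tsupport_subset : tsupport φ ⊆ Ioo a b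

lemma exists_Icc_between_of_isCompact_of_subset_Ioo {K : Set ℝ} {a b : ℝ} (hK : IsCompact K)
    (hsub : K ⊆ Ioo a b) : ∃ a' b', a < a' ∧ b' < b ∧ K ⊆ Icc a' b' := by
  rcases K.eq_empty_or_nonempty with rfl | hne
  · exact ⟨a + 1, b - 1, by linarith, by linarith, empty_subset _⟩
  obtain ⟨a', ha'⟩ := hK.exists_isLeast hne
  obtain ⟨b', hb'⟩ := hK.exists_isGreatest hne
  exact ⟨a', b', (hsub ha'.1).1, (hsub hb'.1).2, fun x hx => ⟨ha'.2 hx, hb'.2 hx⟩⟩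

lemma deriv_primitive {θ : ℝ → ℝ} (hθ : Continuous θ) (a : ℝ) :
    deriv (fun x => ∫ t in a..x, θ t) = θ :=
  funext fun x => (hθ.integral_hasStrictDerivAt a x).hasDerivAt.deriv

lemma contDiff_infty_primitive {θ : ℝ → ℝ} (hθ : ContDiff ℝ ∞ θ) (a : ℝ) :
    ContDiff ℝ ∞ (fun x => ∫ t in a..x, θ t) := by
  refine contDiff_infty_iff_deriv.2 ⟨fun x => ?_, ?_⟩
  · exact (hθ.continuous.integral_hasStrictDerivAt a x).hasDerivAt.differentiableAt
  · rwa [deriv_primitive hθ.continuous]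

namespace IsTestFunction

variable {φ η : ℝ → ℝ} {a b : ℝ}

lemma continuous_deriv (h : IsTestFunction φ a b) : Continuous (deriv φ) :=
  h.contDiff.continuous_deriv (by simp)

lemma support_subset (h : IsTestFunction φ a b) : Function.support φ ⊆ Ioo a b :=
  (subset_tsupport φ).trans h.tsupport_subset

lemma eq_zero_of_notMem (h : IsTestFunction φ a b) {x : ℝ} (hx : x ∉ Ioo a b) : φ x = 0 :=
  Function.notMem_support.1 fun hx' => hx (h.support_subset hx')

lemma of_support_subset_Icc {a' b' : ℝ} (h : ContDiff ℝ ∞ φ) (ha : a < a') (hb : b' < b)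
    (hs : Function.support φ ⊆ Icc a' b') : IsTestFunction φ a b where
  contDiff := h
  hasCompactSupport := .of_support_subset_isCompact isCompact_Icc hs
  tsupport_subset := (closure_minimal hs isClosed_Icc).trans
    fun _ hx => ⟨ha.trans_le hx.1, hx.2.trans_lt hb⟩

lemma sub_const_mul (hφ : IsTestFunction φ a b) (hη : IsTestFunction η a b) (c : ℝ) :
    IsTestFunction (fun x => φ x - c * η x) a b := by
  have hs : Function.support (fun x => φ x - c * η x) ⊆ tsupport φ ∪ tsupport η := fun x hx => by
    by_contra h
    rw [mem_union, not_or] at h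
    simp [image_eq_zero_of_notMem_tsupport h.1, image_eq_zero_of_notMem_tsupport h.2] at hx
  refine ⟨hφ.contDiff.sub (contDiff_const.mul hη.contDiff), ?_, ?_⟩
  · exact .of_support_subset_isCompact
      (hφ.hasCompactSupport.isCompact.union hη.hasCompactSupport.isCompact) hs
  · exact (closure_minimal hs ((isClosed_tsupport _).union (isClosed_tsupport _))).trans
      (union_subset hφ.tsupport_subset hη.tsupport_subset)

lemma exists_deriv_eq (h : IsTestFunction φ a b) (h0 : ∫ x in a..b, φ x = 0) :
    ∃ Φ, IsTestFunction Φ a b ∧ deriv Φ = φ := by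
  have hcont := h.contDiff.continuous
  obtain ⟨a', b', ha, hb, hsub⟩ :=
    exists_Icc_between_of_isCompact_of_subset_Ioo h.hasCompactSupport.isCompact h.tsupport_subset
  have hzero : ∀ t ∉ Icc a' b', φ t = 0 := fun t ht =>
    image_eq_zero_of_notMem_tsupport fun h' => ht (hsub h')
  refine ⟨fun x => ∫ t in a..x, φ t, .of_support_subset_Icc
    (contDiff_infty_primitive h.contDiff a) ha hb fun x hx => ?_, deriv_primitive hcont a⟩
  contrapose! hx
  rw [Function.notMem_support]
  rcases lt_or_ge x a' with hxa | hxa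
  · refine integral_zero_ae (ae_of_all _ fun t ht => hzero t fun ht' => ?_)
    exact (ht.2.trans_lt (max_lt ha hxa)).not_ge ht'.1
  · have hxb : b' < x := not_le.1 fun hxb => hx ⟨hxa, hxb⟩
    have htail : ∫ t in b..x, φ t = 0 :=
      integral_zero_ae (ae_of_all _ fun t ht => hzero t fun ht' =>
        ((lt_min hb hxb).trans ht.1).not_ge ht'.2)
    rw [← integral_add_adjacent_intervals (hcont.intervalIntegrable a b)
      (hcont.intervalIntegrable b x), h0, htail, add_zero]

lemma integral_smul_eq {E : Type*} [NormedAddCommGroup E] [NormedSpace ℝ E]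
    (h : IsTestFunction φ a b) (f : ℝ → E) :
    ∫ x in a..b, φ x • f x = ∫ x, φ x • f x :=
  integral_eq_integral_of_support_subset fun _ hx =>
    Ioo_subset_Ioc_self (h.support_subset (Function.support_smul_subset_left φ f hx))

end IsTestFunction

lemma exists_isTestFunction_integral_eq_one {a b : ℝ} (hab : a < b) :
    ∃ η, IsTestFunction η a b ∧ ∫ x in a..b, η x = 1 := by
  let B : ContDiffBump ((a + b) / 2) := ⟨(b - a) / 8, (b - a) / 4, by linarith, by linarith⟩
  have hsub : tsupport (B.normed volume) ⊆ Ioo a b := by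
    rw [B.tsupport_normed_eq, Real.closedBall_eq_Icc]
    rintro x ⟨hx1, hx2⟩
    change (a + b) / 2 - (b - a) / 4 ≤ x at hx1
    change x ≤ (a + b) / 2 + (b - a) / 4 at hx2
    exact ⟨by linarith, by linarith⟩
  refine ⟨B.normed volume, ⟨B.contDiff_normed, B.hasCompactSupport_normed, hsub⟩, ?_⟩
  rw [integral_eq_integral_of_support_subset, B.integral_normed]
  exact (subset_tsupport _).trans (hsub.trans Ioo_subset_Ioc_self)

section DuBoisReymond

variable {E : Type*} [NormedAddCommGroup E] [NormedSpace ℝ E] {f : ℝ → E} {a b : ℝ}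

/-- Subtracting a multiple of a fixed bump makes a test function mean-free, hence a derivative. -/
lemma integral_smul_eq_integral_smul_of_integral_deriv_smul_eq_zero
    (hf : IntervalIntegrable f volume a b)
    (h : ∀ φ, IsTestFunction φ a b → ∫ x in a..b, deriv φ x • f x = 0)
    {η η₀ : ℝ → ℝ} (hη : IsTestFunction η a b) (hη₀ : IsTestFunction η₀ a b)
    (hη₀_one : ∫ x in a..b, η₀ x = 1) :
    ∫ x in a..b, η x • f x = (∫ x in a..b, η x) • ∫ x in a..b, η₀ x • f x := by
  set I := ∫ x in a..b, η x
  have hη_cont := hη.contDiff.continuous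
  have hη₀_cont := hη₀.contDiff.continuous
  have hmean_zero : ∫ x in a..b, (η x - I * η₀ x) = 0 := by
    rw [integral_sub (hη_cont.intervalIntegrable _ _)
      ((hη₀_cont.intervalIntegrable _ _).const_mul I), intervalIntegral.integral_const_mul,
      hη₀_one, mul_one, sub_self]
  obtain ⟨Φ, hΦ, hΦ_deriv⟩ := (hη.sub_const_mul hη₀ I).exists_deriv_eq hmean_zero
  have hΦ_int := h Φ hΦ
  have hη₀f : IntervalIntegrable (fun x => (I * η₀ x) • f x) volume a b :=
    hf.continuousOn_smul (hη₀_cont.const_smul I).continuousOn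
  simp only [hΦ_deriv, sub_smul] at hΦ_int
  rw [integral_sub (hf.continuousOn_smul hη_cont.continuousOn) hη₀f, sub_eq_zero] at hΦ_int
  simp only [hΦ_int, mul_smul, intervalIntegral.integral_smul]

theorem ae_eq_const_of_integral_deriv_smul_eq_zero [CompleteSpace E] (hab : a < b)
    (hf : IntervalIntegrable f volume a b)
    (h : ∀ φ, IsTestFunction φ a b → ∫ x in a..b, deriv φ x • f x = 0) :
    ∃ c, ∀ᵐ x, x ∈ Ioo a b → f x = c := by
  obtain ⟨η₀, hη₀, hη₀_one⟩ := exists_isTestFunction_integral_eq_one hab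
  set c := ∫ x in a..b, η₀ x • f x
  have hloc : LocallyIntegrableOn (fun x => f x - c) (Ioo a b) volume :=
    (((intervalIntegrable_iff_integrableOn_Ioo_of_le hab.le).1 hf).sub
      (by simp : IntegrableOn (fun _ => c) (Ioo a b))).locallyIntegrableOn
  have hzero := isOpen_Ioo.ae_eq_zero_of_integral_contDiff_smul_eq_zero hloc
    fun η hη hηc hηs => ?_
  · refine ⟨c, ?_⟩
    filter_upwards [hzero] with x hx hx' using sub_eq_zero.1 (hx hx')
  · have hη_test : IsTestFunction η a b := ⟨hη, hηc, hηs⟩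
    have hηf : IntervalIntegrable (fun x => η x • f x) volume a b :=
      hf.continuousOn_smul hη.continuous.continuousOn
    have hηc : IntervalIntegrable (fun x => η x • c) volume a b :=
      (hη.continuous.smul continuous_const).intervalIntegrable _ _
    rw [← hη_test.integral_smul_eq]
    simp only [smul_sub]
    rw [integral_sub hηf hηc, intervalIntegral.integral_smul_const,
      integral_smul_eq_integral_smul_of_integral_deriv_smul_eq_zero hf h hη_test hη₀ hη₀_one,
      sub_self]

end DuBoisReymond

theorem ae_eq_primitive_of_integral_eq_zero {f h : ℝ → ℝ} {a b : ℝ} (hab : a < b)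
    (hf : IntervalIntegrable f volume a b) (hh : IntervalIntegrable h volume a b)
    (H : ∀ φ, IsTestFunction φ a b → ∫ x in a..b, (h x * φ x + f x * deriv φ x) = 0) :
    ∃ c, ∀ᵐ x, x ∈ Ioo a b → f x = c + ∫ t in a..x, h t := by
  set K : ℝ → ℝ := fun x => ∫ t in a..x, h t
  have hac : AbsolutelyContinuousOnInterval K a b :=
    hh.absolutelyContinuousOnInterval_intervalIntegral (c := a) (by simp)
  have hKi : IntervalIntegrable K volume a b := hac.continuousOn.intervalIntegrable
  have hortho : ∀ φ, IsTestFunction φ a b → ∫ x in a..b, deriv φ x • (f x - K x) = 0 := by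
    intro φ hφ
    have hφ_ac : AbsolutelyContinuousOnInterval φ a b :=
      (hφ.contDiff.of_le (by simp)).contDiffOn.absolutelyContinuousOnInterval
    have hφ' : ContinuousOn (deriv φ) (uIcc a b) := hφ.continuous_deriv.continuousOn
    have hparts : ∫ x in a..b, K x * deriv φ x = -∫ x in a..b, h x * φ x := by
      rw [hac.integral_mul_deriv_eq_deriv_mul hφ_ac, hφ.eq_zero_of_notMem (x := a) (by simp),
        hφ.eq_zero_of_notMem (x := b) (by simp), mul_zero, mul_zero, sub_zero, zero_sub, neg_inj]
      refine intervalIntegral.integral_congr_ae ?_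
      filter_upwards [hh.ae_hasDerivAt_integral] with x hx hxm
      rw [(hx (uIoc_subset_uIcc hxm) a (by simp)).deriv]
    have hφ_int := H φ hφ
    rw [integral_add (hh.mul_continuousOn hφ.contDiff.continuous.continuousOn)
      (hf.mul_continuousOn hφ')] at hφ_int
    simp only [smul_eq_mul, mul_comm (deriv φ _), sub_mul]
    rw [integral_sub (hf.mul_continuousOn hφ') (hKi.mul_continuousOn hφ'), hparts]
    linarith
  obtain ⟨c, hc⟩ := ae_eq_const_of_integral_deriv_smul_eq_zero hab (hf.sub hKi) hortho
  refine ⟨c, ?_⟩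
  filter_upwards [hc] with x hx hx' using sub_eq_iff_eq_add.1 (hx hx')

section Primitives

variable {f k : ℝ → ℝ} {a b : ℝ}

lemma continuousOn_of_sub_eq_integral (hab : a ≤ b) (hk : IntervalIntegrable k volume a b)
    (h : ∀ x ∈ Icc a b, ∀ y ∈ Icc a b, f y - f x = ∫ t in x..y, k t) :
    ContinuousOn f (Icc a b) := by
  have hprim := (hk.absolutelyContinuousOnInterval_intervalIntegral (c := a) (by simp)).continuousOn
  rw [uIcc_of_le hab] at hprim
  exact (continuousOn_const.add hprim).congr fun x hx =>
    eq_add_of_sub_eq' (h a (left_mem_Icc.2 hab) x hx)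

lemma hasDerivAt_of_sub_eq_integral (hk : ContinuousOn k (Ioo a b))
    (h : ∀ x ∈ Ioo a b, ∀ y ∈ Ioo a b, f y - f x = ∫ t in x..y, k t) {θ : ℝ} (hθ : θ ∈ Ioo a b) :
    HasDerivAt f (k θ) θ := by
  have hprim : HasDerivAt (fun x => ∫ t in θ..x, k t) (k θ) θ :=
    integral_hasDerivAt_right (IntervalIntegrable.refl (a := θ))
      (hk.stronglyMeasurableAtFilter isOpen_Ioo θ hθ) (hk.continuousAt (isOpen_Ioo.mem_nhds hθ))
  refine (hprim.const_add (f θ)).congr_of_eventuallyEq ?_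
  filter_upwards [isOpen_Ioo.mem_nhds hθ] with y hy using eq_add_of_sub_eq' (h θ hθ y hy)

lemma eq_of_forall_hasDerivAt_zero (h : ∀ x ∈ Ioo a b, HasDerivAt f 0 x) {x y : ℝ}
    (hx : x ∈ Ioo a b) (hy : y ∈ Ioo a b) : f x = f y :=
  isOpen_Ioo.is_const_of_deriv_eq_zero isPreconnected_Ioo
    (fun x hx => (h x hx).differentiableAt.differentiableWithinAt) (fun x hx => (h x hx).deriv)
    hx hy

lemma integral_congr_ae_Ioo {k₁ k₂ : ℝ → ℝ} (h : ∀ᵐ t, t ∈ Ioo a b → k₁ t = k₂ t) {x y : ℝ}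
    (hx : x ∈ Icc a b) (hy : y ∈ Icc a b) : ∫ t in x..y, k₁ t = ∫ t in x..y, k₂ t := by
  refine intervalIntegral.integral_congr_ae ?_
  filter_upwards [h, Measure.ae_ne volume a, Measure.ae_ne volume b] with t ht hta htb hxy
  have hmem := ordConnected_Icc.uIcc_subset hx hy (uIoc_subset_uIcc hxy)
  exact ht ⟨lt_of_le_of_ne hmem.1 hta.symm, lt_of_le_of_ne hmem.2 htb⟩

end Primitives

namespace IsH1On

variable {ψ g k : ℝ → ℝ} {a b : ℝ}

lemma intervalIntegrable (h : IsH1On ψ g a b) (hab : a ≤ b) : IntervalIntegrable g volume a b :=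
  (intervalIntegrable_iff_integrableOn_Ioo_of_le hab).2 (h.1.integrable (by norm_num))

lemma intervalIntegrable_sq (h : IsH1On ψ g a b) (hab : a ≤ b) :
    IntervalIntegrable (fun x => g x ^ 2) volume a b :=
  (intervalIntegrable_iff_integrableOn_Ioo_of_le hab).2 h.1.integrable_sq

lemma continuousOn (h : IsH1On ψ g a b) (hab : a ≤ b) : ContinuousOn ψ (Icc a b) :=
  continuousOn_of_sub_eq_integral hab (h.intervalIntegrable hab) h.2

lemma hasDerivAt (h : IsH1On ψ g a b) (hk : ContinuousOn k (Ioo a b))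
    (hgk : ∀ᵐ x, x ∈ Ioo a b → g x = k x) {θ : ℝ} (hθ : θ ∈ Ioo a b) : HasDerivAt ψ (k θ) θ := by
  refine hasDerivAt_of_sub_eq_integral hk (fun x hx y hy => ?_) hθ
  have hx' := Ioo_subset_Icc_self hx
  have hy' := Ioo_subset_Icc_self hy
  rw [h.2 x hx' y hy', integral_congr_ae_Ioo hgk hx' hy']

lemma neg (h : IsH1On ψ g a b) : IsH1On (fun x => -ψ x) (fun x => -g x) a b := by
  refine ⟨h.1.neg, fun x hx y hy => ?_⟩
  rw [intervalIntegral.integral_neg, ← h.2 x hx y hy]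
  ring

end IsH1On

/-- The derivative that the equation prescribes for the flux `λψψ'` of a solution, as a function of
the values `y` of `ψ` and `p` of `ψ'`. -/
def fluxDeriv (lam P y p : ℝ) : ℝ := 2 * (lam - 1) * P + (2 * lam - 1) * p ^ 2 - lam ^ 2 * y ^ 2

section Flux

variable {lam P : ℝ} {ψ g : ℝ → ℝ} {a b : ℝ}

lemma IsH1On.intervalIntegrable_fluxDeriv (h : IsH1On ψ g a b) (hab : a ≤ b) :
    IntervalIntegrable (fun t => fluxDeriv lam P (ψ t) (g t)) volume a b := by
  have hψ := h.continuousOn hab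
  rw [← uIcc_of_le hab] at hψ
  exact (intervalIntegrable_const.add ((h.intervalIntegrable_sq hab).const_mul _)).sub
    (continuousOn_const.mul (hψ.pow 2)).intervalIntegrable

lemma IsH1On.intervalIntegrable_flux (h : IsH1On ψ g a b) (hab : a ≤ b) :
    IntervalIntegrable (fun x => lam * ψ x * g x) volume a b := by
  have hψ := h.continuousOn hab
  rw [← uIcc_of_le hab] at hψ
  exact (h.intervalIntegrable hab).continuousOn_mul (continuousOn_const.mul hψ)

lemma weakIdentity_iff (h : IsH1On ψ g a b) (hab : a ≤ b) {φ : ℝ → ℝ} (hφ : ContDiff ℝ ∞ φ) :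
    WeakIdentity lam P ψ g φ a b ↔
      ∫ x in a..b, (fluxDeriv lam P (ψ x) (g x) * φ x + lam * ψ x * g x * deriv φ x) = 0 := by
  have hφc : ContinuousOn φ (uIcc a b) := hφ.continuous.continuousOn
  have hφd : ContinuousOn (deriv φ) (uIcc a b) := (hφ.continuous_deriv (by simp)).continuousOn
  have hleft : IntervalIntegrable (fun θ => 2 * (lam - 1) * P * φ θ) volume a b :=
    (continuousOn_const.mul hφc).intervalIntegrable
  have htotal : IntervalIntegrable (fun x => fluxDeriv lam P (ψ x) (g x) * φ x
      + lam * ψ x * g x * deriv φ x) volume a b :=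
    ((h.intervalIntegrable_fluxDeriv hab).mul_continuousOn hφc).add
      ((h.intervalIntegrable_flux hab).mul_continuousOn hφd)
  have hright : ∫ θ in a..b, ((-(2 * lam - 1) * g θ ^ 2 + lam ^ 2 * ψ θ ^ 2) * φ θ
      - lam * ψ θ * g θ * deriv φ θ) = ∫ θ in a..b, (2 * (lam - 1) * P * φ θ
      - (fluxDeriv lam P (ψ θ) (g θ) * φ θ + lam * ψ θ * g θ * deriv φ θ)) := by
    congr 1
    ext x
    rw [fluxDeriv]
    ring
  rw [WeakIdentity, hright, integral_sub hleft htotal, eq_comm, sub_eq_self]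

lemma WeakIdentity.neg {φ : ℝ → ℝ} (h : WeakIdentity lam P ψ g φ a b) :
    WeakIdentity lam P (fun x => -ψ x) (fun x => -g x) φ a b := by
  simpa only [WeakIdentity, neg_sq, mul_neg, neg_mul, neg_neg] using h

lemma exists_flux_of_weakIdentity (hab : a < b) (h : IsH1On ψ g a b)
    (H : ∀ φ, IsTestFunction φ a b → WeakIdentity lam P ψ g φ a b) :
    ∃ w : ℝ → ℝ, ContinuousOn w (Icc a b) ∧ (∀ᵐ x, x ∈ Ioo a b → lam * ψ x * g x = w x) ∧
      ∀ x ∈ Icc a b, ∀ y ∈ Icc a b, w y - w x = ∫ t in x..y, fluxDeriv lam P (ψ t) (g t) := by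
  have hint := h.intervalIntegrable_fluxDeriv (lam := lam) (P := P) hab.le
  obtain ⟨c, hc⟩ := ae_eq_primitive_of_integral_eq_zero hab (h.intervalIntegrable_flux hab.le) hint
    fun φ hφ => (weakIdentity_iff h hab.le hφ.contDiff).1 (H φ hφ)
  have hincr : ∀ x ∈ Icc a b, ∀ y ∈ Icc a b, (c + ∫ t in a..y, fluxDeriv lam P (ψ t) (g t)) -
      (c + ∫ t in a..x, fluxDeriv lam P (ψ t) (g t)) =
      ∫ t in x..y, fluxDeriv lam P (ψ t) (g t) := fun x hx y hy => by
    have hsub : ∀ z ∈ Icc a b,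
        IntervalIntegrable (fun t => fluxDeriv lam P (ψ t) (g t)) volume a z := fun z hz =>
      hint.mono_set (uIcc_subset_uIcc_left (Icc_subset_uIcc hz))
    rw [add_sub_add_left_eq_sub, integral_interval_sub_left (hsub y hy) (hsub x hx)]
  exact ⟨_, continuousOn_of_sub_eq_integral hab.le hint hincr, hc, hincr⟩

end Flux

section FluxAtZero

variable {ψ ψ' w : ℝ → ℝ} {a b : ℝ}

lemma not_intervalIntegrable_of_inv_sub_le {f : ℝ → ℝ} {c : ℝ} (hab : a < b) (hc : 0 < c)
    (h : ∀ x ∈ Ioo a b, c * (x - a)⁻¹ ≤ f x) : ¬ IntervalIntegrable f volume a b := by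
  intro hf
  have hinv : IntervalIntegrable (fun x => c * (x - a)⁻¹) volume a b := by
    rw [intervalIntegrable_iff_integrableOn_Ioo_of_le hab.le] at hf ⊢
    refine Integrable.mono' hf (Measurable.aestronglyMeasurable (by fun_prop)) ?_
    filter_upwards [ae_restrict_mem measurableSet_Ioo] with x hx
    have hxa : 0 < x - a := sub_pos.2 hx.1
    rw [Real.norm_of_nonneg (by positivity)]
    exact h x hx
  have hinv' := hinv.const_mul c⁻¹
  simp only [inv_mul_cancel_left₀ hc.ne'] at hinv'
  rcases intervalIntegrable_sub_inv_iff.1 hinv' with h | h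
  · exact hab.ne h
  · exact h left_mem_uIcc

lemma sq_le_mul_sub_of_mul_deriv_le {K : ℝ} (hψ : ContinuousOn ψ (Icc a b)) (hψa : ψ a = 0)
    (hd : ∀ x ∈ Ioo a b, HasDerivAt ψ (ψ' x) x) (hK : ∀ x ∈ Ioo a b, ψ x * ψ' x ≤ K) {x : ℝ}
    (hx : x ∈ Ioo a b) : ψ x ^ 2 ≤ 2 * K * (x - a) := by
  have hsq : ∀ t ∈ Ioo a x, HasDerivAt (fun t => ψ t ^ 2) (2 * (ψ t * ψ' t)) t := fun t ht =>
    ((hd t ⟨ht.1, ht.2.trans hx.2⟩).fun_pow 2).congr_deriv (by push_cast; ring)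
  have hcont : ContinuousOn (fun t => ψ t ^ 2) (Icc a x) :=
    (hψ.mono (Icc_subset_Icc_right hx.2.le)).pow 2
  obtain ⟨ξ, hξ, hslope⟩ := exists_hasDerivAt_eq_slope _ _ hx.1 hcont hsq
  have hxa : 0 < x - a := sub_pos.2 hx.1
  rw [hψa, eq_div_iff hxa.ne', zero_pow two_ne_zero, sub_zero] at hslope
  have := hK ξ ⟨hξ.1, hξ.2.trans hx.2⟩
  calc ψ x ^ 2 = 2 * (ψ ξ * ψ' ξ) * (x - a) := by linarith
    _ ≤ 2 * K * (x - a) := by gcongr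

/-- If `ψψ'` had a nonzero limit at the zero `a` of `ψ`, then `ψ²` would be at most of order
`x - a`, and `(ψ')² = (ψψ')² / ψ²` at least of order `1 / (x - a)`, so not integrable. -/
lemma eq_zero_of_mul_deriv_eq (hab : a < b) (hψ : ContinuousOn ψ (Icc a b)) (hψa : ψ a = 0)
    (hd : ∀ x ∈ Ioo a b, HasDerivAt ψ (ψ' x) x)
    (hψ' : IntervalIntegrable (fun x => ψ' x ^ 2) volume a b)
    (hw : ContinuousOn w (Icc a b)) (hww : ∀ x ∈ Ioo a b, ψ x * ψ' x = w x) : w a = 0 := by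
  by_contra hwa
  have hpos : 0 < |w a| := abs_pos.2 hwa
  have hlim : Tendsto w (𝓝[≥] a) (𝓝 (w a)) := by
    rw [← nhdsWithin_Icc_eq_nhdsGE hab]
    exact hw a (left_mem_Icc.2 hab.le)
  obtain ⟨d, had, hbound⟩ := mem_nhdsGE_iff_exists_Icc_subset.1
    ((hlim.abs.eventually_const_lt (by linarith : |w a| / 2 < |w a|)).and
      (hlim.abs.eventually_lt_const (by linarith : |w a| < 2 * |w a|)))
  set e := min d b
  have hae : a < e := lt_min had hab
  have heb : e ≤ b := min_le_right _ _
  have hIoo : Ioo a e ⊆ Ioo a b := Ioo_subset_Ioo_right heb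
  have hbound' : ∀ x ∈ Ioo a e, |w a| / 2 < |w x| ∧ |w x| < 2 * |w a| := fun x hx =>
    hbound ⟨hx.1.le, hx.2.le.trans (min_le_left _ _)⟩
  refine not_intervalIntegrable_of_inv_sub_le hae (div_pos hpos (by norm_num : (0 : ℝ) < 16))
    (fun x hx => ?_) (hψ'.mono_set (uIcc_subset_uIcc_left (by
      rw [uIcc_of_le hab.le]; exact ⟨hae.le, heb⟩)))
  have hsq : ψ x ^ 2 ≤ 2 * (2 * |w a|) * (x - a) :=
    sq_le_mul_sub_of_mul_deriv_le (hψ.mono (Icc_subset_Icc_right heb)) hψa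
      (fun t ht => hd t (hIoo ht)) (fun t ht => by
        rw [hww t (hIoo ht)]
        exact (le_abs_self _).trans (hbound' t ht).2.le) hx
  have hxa : 0 < x - a := sub_pos.2 hx.1
  have hchain : |w a| * |w a| ≤ |w a| * (16 * ((x - a) * ψ' x ^ 2)) := by
    calc |w a| * |w a| = 4 * (|w a| / 2) ^ 2 := by ring
      _ ≤ 4 * |w x| ^ 2 := by gcongr; exact (hbound' x hx).1.le
      _ = 4 * (ψ x ^ 2 * ψ' x ^ 2) := by rw [sq_abs, ← hww x (hIoo hx)]; ring
      _ ≤ 4 * (2 * (2 * |w a|) * (x - a) * ψ' x ^ 2) := by gcongr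
      _ = |w a| * (16 * ((x - a) * ψ' x ^ 2)) := by ring
  have := le_of_mul_le_mul_left hchain hpos
  rw [mul_inv_le_iff₀ hxa]
  linarith

end FluxAtZero

/-- A local solution in the classical sense. The last field says that no flux `λψψ'` enters at the
left end point; it is what the global `H¹` bound adds to the equation inside `(a,b)`. -/
structure IsClassicalLocalSolution (lam P : ℝ) (ψ : ℝ → ℝ) (a b : ℝ) : Prop where
  lt : a < b
  continuousOn : ContinuousOn ψ (Icc a b)
  left : ψ a = 0
  right : ψ b = 0
  ne_zero : ∀ θ ∈ Ioo a b, ψ θ ≠ 0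
  hasDerivAt : ∀ θ ∈ Ioo a b, HasDerivAt ψ (deriv ψ θ) θ
  hasDerivAt_flux : ∀ θ ∈ Ioo a b,
    HasDerivAt (fun x => lam * ψ x * deriv ψ x) (fluxDeriv lam P (ψ θ) (deriv ψ θ)) θ
  tendsto_flux_left : Tendsto (fun x => lam * ψ x * deriv ψ x) (𝓝[>] a) (𝓝 0)

section LocalSolution

variable {lam P B : ℝ} {ψ : ℝ → ℝ} {a b : ℝ}

lemma IsLocalSolution.exists_flux (hlam : lam ≠ 0) (H : IsLocalSolution lam P ψ a b) :
    ∃ w, ContinuousOn w (Icc a b) ∧ ContinuousOn ψ (Icc a b) ∧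
      (∀ θ ∈ Ioo a b, HasDerivAt ψ (w θ / (lam * ψ θ)) θ) ∧
      IntervalIntegrable (fun θ => deriv ψ θ ^ 2) volume a b ∧
      ∀ x ∈ Icc a b, ∀ y ∈ Icc a b,
        w y - w x = ∫ t in x..y, fluxDeriv lam P (ψ t) (deriv ψ t) := by
  obtain ⟨hab, -, -, hne, g, hg, hweak⟩ := H
  have hψ := hg.continuousOn hab.le
  obtain ⟨w, hw, hgw, hincr⟩ := exists_flux_of_weakIdentity hab hg
    fun φ hφ => hweak φ hφ.contDiff hφ.hasCompactSupport hφ.tsupport_subset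
  have hne' : ∀ x ∈ Ioo a b, lam * ψ x ≠ 0 := fun x hx => mul_ne_zero hlam (hne x hx)
  have hquot : ContinuousOn (fun x => w x / (lam * ψ x)) (Ioo a b) :=
    (hw.mono Ioo_subset_Icc_self).div (continuousOn_const.mul (hψ.mono Ioo_subset_Icc_self)) hne'
  have hg_quot : ∀ᵐ x, x ∈ Ioo a b → g x = w x / (lam * ψ x) := by
    filter_upwards [hgw] with x hx hxm
    rw [← hx hxm, mul_div_cancel_left₀ _ (hne' x hxm)]
  have hd : ∀ θ ∈ Ioo a b, HasDerivAt ψ (w θ / (lam * ψ θ)) θ := fun θ hθ =>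
    hg.hasDerivAt hquot hg_quot hθ
  have hg_deriv : ∀ᵐ x, x ∈ Ioo a b → g x = deriv ψ x := by
    filter_upwards [hg_quot] with x hx hxm using (hx hxm).trans (hd x hxm).deriv.symm
  refine ⟨w, hw, hψ, hd, (hg.intervalIntegrable_sq hab.le).congr_ae ?_, fun x hx y hy => ?_⟩
  · rw [uIoc_of_le hab.le, ← restrict_Ioo_eq_restrict_Ioc, Filter.EventuallyEq,
      ae_restrict_iff' measurableSet_Ioo]
    filter_upwards [hg_deriv] with t ht htm using by rw [ht htm]
  · rw [hincr x hx y hy]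
    refine integral_congr_ae_Ioo ?_ hx hy
    filter_upwards [hg_deriv] with t ht htm using by rw [ht htm]

theorem IsLocalSolution.isClassical (hlam : lam ≠ 0) (H : IsLocalSolution lam P ψ a b) :
    IsClassicalLocalSolution lam P ψ a b := by
  obtain ⟨w, hw, hψ, hd, hsq, hincr⟩ := H.exists_flux hlam
  obtain ⟨hab, hψa, hψb, hne, -⟩ := H
  have hne' : ∀ x ∈ Ioo a b, lam * ψ x ≠ 0 := fun x hx => mul_ne_zero hlam (hne x hx)
  have hwo := hw.mono Ioo_subset_Icc_self
  have hψo := hψ.mono Ioo_subset_Icc_self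
  have hd' : ∀ θ ∈ Ioo a b, HasDerivAt ψ (deriv ψ θ) θ := fun θ hθ =>
    (hd θ hθ).differentiableAt.hasDerivAt
  have hderiv_cont : ContinuousOn (deriv ψ) (Ioo a b) :=
    (hwo.div (continuousOn_const.mul hψo) hne').congr fun x hx => (hd x hx).deriv
  have hflux : ∀ θ ∈ Ioo a b, lam * ψ θ * deriv ψ θ = w θ := fun θ hθ => by
    rw [(hd θ hθ).deriv, mul_div_cancel₀ _ (hne' θ hθ)]
  refine ⟨hab, hψ, hψa, hψb, hne, hd', fun θ hθ => ?_, ?_⟩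
  · have hcont : ContinuousOn (fun t => fluxDeriv lam P (ψ t) (deriv ψ t)) (Ioo a b) :=
      (continuousOn_const.add (continuousOn_const.mul (hderiv_cont.pow 2))).sub
        (continuousOn_const.mul (hψo.pow 2))
    refine hasDerivAt_of_sub_eq_integral hcont (fun x hx y hy => ?_) hθ
    rw [hflux x hx, hflux y hy, hincr x (Ioo_subset_Icc_self hx) y (Ioo_subset_Icc_self hy)]
  · have hwa : lam⁻¹ * w a = 0 :=
      eq_zero_of_mul_deriv_eq (w := fun x => lam⁻¹ * w x) hab hψ hψa hd' hsq
        (continuousOn_const.mul hw) fun x hx => by rw [← hflux x hx]; field_simp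
    have hlim : Tendsto w (𝓝[>] a) (𝓝 (w a)) := by
      rw [← nhdsWithin_Ioo_eq_nhdsGT hab]
      exact (hw a (left_mem_Icc.2 hab.le)).mono_left (nhdsWithin_mono _ Ioo_subset_Icc_self)
    rw [(mul_eq_zero.1 hwa).resolve_left (inv_ne_zero hlam)] at hlim
    refine hlim.congr' ?_
    filter_upwards [Ioo_mem_nhdsGT hab] with x hx using (hflux x hx).symm

lemma IsClassicalLocalSolution.hasDerivAt_deriv (H : IsClassicalLocalSolution lam P ψ a b)
    (hlam : lam ≠ 0) {θ : ℝ} (hθ : θ ∈ Ioo a b) :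
    HasDerivAt (deriv ψ) ((2 * (lam - 1) * P + (lam - 1) * deriv ψ θ ^ 2
      - lam ^ 2 * ψ θ ^ 2) / (lam * ψ θ)) θ := by
  have hne := H.ne_zero θ hθ
  have hquot := (H.hasDerivAt_flux θ hθ).fun_div ((H.hasDerivAt θ hθ).const_mul lam)
    (mul_ne_zero hlam hne)
  refine (hquot.congr_of_eventuallyEq ?_).congr_deriv ?_
  · filter_upwards [isOpen_Ioo.mem_nhds hθ] with y hy
    rw [mul_div_cancel_left₀ _ (mul_ne_zero hlam (H.ne_zero y hy))]
  · rw [fluxDeriv]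
    field_simp
    ring

lemma abs_rpow_two_div_sub_two (lam y : ℝ) : |y| ^ (2 / lam - 2) = (y ^ 2) ^ (1 / lam - 1) := by
  rw [← sq_abs, ← Real.rpow_natCast, ← Real.rpow_mul (abs_nonneg _)]
  congr 1
  push_cast
  ring

lemma IsClassicalLocalSolution.hasDerivAt_bernoulli (H : IsClassicalLocalSolution lam P ψ a b)
    (hlam : lam ≠ 0) {θ : ℝ} (hθ : θ ∈ Ioo a b) :
    HasDerivAt (fun x => (2 * P + lam ^ 2 * ψ x ^ 2 + deriv ψ x ^ 2) * |ψ x| ^ (2 / lam - 2))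
      0 θ := by
  have hne := H.ne_zero θ hθ
  have hψ := H.hasDerivAt θ hθ
  have hsq : ψ θ ^ 2 ≠ 0 := pow_ne_zero 2 hne
  have hpow := (hψ.fun_pow 2).rpow_const (p := 1 / lam - 1) (Or.inl hsq)
  have henergy := (((hψ.fun_pow 2).const_mul (lam ^ 2)).const_add (2 * P)).fun_add
    ((H.hasDerivAt_deriv hlam hθ).fun_pow 2)
  have hexp : (ψ θ ^ 2) ^ (1 / lam - 1) = (ψ θ ^ 2) ^ (1 / lam - 1 - 1) * ψ θ ^ 2 := by
    rw [← Real.rpow_add_one hsq, sub_add_cancel]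
  simp only [abs_rpow_two_div_sub_two]
  refine (henergy.fun_mul hpow).congr_deriv ?_
  rw [hexp]
  push_cast
  field_simp
  ring

theorem IsLocalSolution.exists_hasBernoulli (hlam : lam ≠ 0) (H : IsLocalSolution lam P ψ a b) :
    ∃ B : ℝ, HasBernoulli lam P B ψ a b := by
  have hcl := H.isClassical hlam
  obtain ⟨m, hm⟩ := nonempty_Ioo.2 hcl.lt
  exact ⟨_, fun θ hθ => ⟨(hcl.hasDerivAt θ hθ).differentiableAt,
    eq_of_forall_hasDerivAt_zero (fun x hx => hcl.hasDerivAt_bernoulli hlam hx) hθ hm⟩⟩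

lemma IsLocalSolution.neg (H : IsLocalSolution lam P ψ a b) :
    IsLocalSolution lam P (fun x => -ψ x) a b := by
  obtain ⟨hab, hψa, hψb, hne, g, hg, hweak⟩ := H
  exact ⟨hab, by simp [hψa], by simp [hψb], fun θ hθ => neg_ne_zero.2 (hne θ hθ), _, hg.neg,
    fun φ hφ hφc hφs => (hweak φ hφ hφc hφs).neg⟩

lemma HasBernoulli.neg (H : HasBernoulli lam P B ψ a b) :
    HasBernoulli lam P B (fun x => -ψ x) a b := fun θ hθ => by
  obtain ⟨hd, hB⟩ := H θ hθ
  exact ⟨hd.neg, by rwa [deriv.fun_neg, abs_neg, neg_sq, neg_sq]⟩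

/-- A positive classical local solution with Bernoulli constant `B`; up to sign, every local
solution is one. -/
structure IsProfile (lam P B : ℝ) (ψ : ℝ → ℝ) (a b : ℝ) : Prop
    extends IsClassicalLocalSolution lam P ψ a b where
  pos : ∀ θ ∈ Ioo a b, 0 < ψ θ
  bernoulli : ∀ θ ∈ Ioo a b,
    (2 * P + lam ^ 2 * ψ θ ^ 2 + deriv ψ θ ^ 2) * ψ θ ^ (2 / lam - 2) = B

lemma IsLocalSolution.isProfile_of_pos (hlam : lam ≠ 0) (H : IsLocalSolution lam P ψ a b)
    (HB : HasBernoulli lam P B ψ a b) (hpos : ∀ θ ∈ Ioo a b, 0 < ψ θ) :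
    IsProfile lam P B ψ a b :=
  ⟨H.isClassical hlam, hpos, fun θ hθ => by rw [← (HB θ hθ).2, abs_of_pos (hpos θ hθ)]⟩

theorem IsLocalSolution.isProfile_or_isProfile_neg (hlam : lam ≠ 0)
    (H : IsLocalSolution lam P ψ a b) (HB : HasBernoulli lam P B ψ a b) :
    IsProfile lam P B ψ a b ∨ IsProfile lam P B (fun x => -ψ x) a b := by
  have hψ := (H.isClassical hlam).continuousOn.mono Ioo_subset_Icc_self
  rcases isPreconnected_Ioo.mapsTo_Ioi_or_Iio hψ (b := 0) H.2.2.2.1 with h | h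
  · exact .inl (H.isProfile_of_pos hlam HB fun _ hθ => h hθ)
  · exact .inr (H.neg.isProfile_of_pos hlam HB.neg fun θ hθ => neg_pos.2 (h hθ))

end LocalSolution

lemma IsClassicalLocalSolution.tendsto_left {lam P : ℝ} {ψ : ℝ → ℝ} {a b : ℝ}
    (H : IsClassicalLocalSolution lam P ψ a b) : Tendsto ψ (𝓝[>] a) (𝓝 0) := by
  have := H.continuousOn a (left_mem_Icc.2 H.lt.le)
  rw [ContinuousWithinAt, H.left] at this
  rw [← nhdsWithin_Ioo_eq_nhdsGT H.lt]
  exact this.mono_left (nhdsWithin_mono _ Ioo_subset_Icc_self)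

namespace IsProfile

variable {lam P B : ℝ} {ψ : ℝ → ℝ} {a b : ℝ}

lemma tendsto_rpow_left (H : IsProfile lam P B ψ a b) {p : ℝ} (hp : 0 ≤ p) :
    Tendsto (fun x => ψ x ^ p) (𝓝[>] a) (𝓝 (0 ^ p)) :=
  (Real.continuousAt_rpow_const 0 p (Or.inr hp)).tendsto.comp H.tendsto_left

lemma bernoulli_nonneg_of_lt_one (H : IsProfile lam P B ψ a b) (h0 : 0 < lam) (h1 : lam < 1) :
    0 ≤ B := by
  have hexp : 0 < 2 / lam - 2 := by
    rw [sub_pos, lt_div_iff₀ h0]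
    linarith
  have hlim := (H.tendsto_rpow_left hexp.le).const_mul (2 * P)
  rw [Real.zero_rpow hexp.ne', mul_zero] at hlim
  refine le_of_tendsto hlim ?_
  filter_upwards [Ioo_mem_nhdsGT H.lt] with x hx
  rw [← H.bernoulli x hx]
  have := Real.rpow_nonneg (H.pos x hx).le (2 / lam - 2)
  gcongr
  nlinarith [sq_nonneg (lam * ψ x), sq_nonneg (deriv ψ x)]

lemma pressure_nonpos_of_one_lt (H : IsProfile lam P B ψ a b) (h1 : 1 < lam) : P ≤ 0 := by
  have hexp : 0 < 2 - 2 / lam := by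
    rw [sub_pos, div_lt_iff₀ (by linarith)]
    linarith
  have hlim := (H.tendsto_rpow_left hexp.le).const_mul B
  rw [Real.zero_rpow hexp.ne', mul_zero] at hlim
  suffices 2 * P ≤ 0 by linarith
  refine ge_of_tendsto hlim ?_
  filter_upwards [Ioo_mem_nhdsGT H.lt] with x hx
  have hcancel : ψ x ^ (2 / lam - 2) * ψ x ^ (2 - 2 / lam) = 1 := by
    rw [← Real.rpow_add (H.pos x hx), sub_add_sub_cancel, sub_self, Real.rpow_zero]
  rw [← H.bernoulli x hx, mul_assoc, hcancel, mul_one]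
  nlinarith [sq_nonneg (lam * ψ x), sq_nonneg (deriv ψ x)]

/-- `λ²B` is a polynomial in `ψ` and the flux `λψψ'`, both of which vanish at the end point, times
`ψ ^ (2/λ - 4)`, which is bounded there. -/
lemma bernoulli_eq_zero_of_le_half (H : IsProfile lam P B ψ a b) (h0 : 0 < lam)
    (h1 : lam ≤ 1 / 2) : B = 0 := by
  have hexp : 0 ≤ 2 / lam - 4 := by
    rw [sub_nonneg, le_div_iff₀ h0]
    linarith
  have hlim := (((H.tendsto_left.pow 2).const_mul (2 * P * lam ^ 2)).add
    (((H.tendsto_left.pow 4).const_mul (lam ^ 4)).add (H.tendsto_flux_left.pow 2))).mul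
    (H.tendsto_rpow_left hexp)
  have hconst : (fun x => (2 * P * lam ^ 2 * ψ x ^ 2 + (lam ^ 4 * ψ x ^ 4
      + (lam * ψ x * deriv ψ x) ^ 2)) * ψ x ^ (2 / lam - 4)) =ᶠ[𝓝[>] a] fun _ => lam ^ 2 * B := by
    filter_upwards [Ioo_mem_nhdsGT H.lt] with x hx
    have hsplit : ψ x ^ (2 / lam - 2) = ψ x ^ (2 / lam - 4) * ψ x ^ 2 := by
      rw [← Real.rpow_natCast, ← Real.rpow_add (H.pos x hx)]
      congr 1
      push_cast
      ring
    rw [← H.bernoulli x hx, hsplit]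
    ring
  have hzero := tendsto_nhds_unique (tendsto_const_nhds.congr' hconst.symm) hlim
  norm_num at hzero
  exact hzero.resolve_left h0.ne'

lemma nonneg (H : IsProfile lam P B ψ a b) {θ : ℝ} (hθ : θ ∈ Icc a b) : 0 ≤ ψ θ := by
  rcases eq_endpoints_or_mem_Ioo_of_mem_Icc hθ with rfl | rfl | hθ'
  · exact H.left.ge
  · exact H.right.ge
  · exact (H.pos θ hθ').le

lemma exists_isMaxOn (H : IsProfile lam P B ψ a b) :
    ∃ c ∈ Ioo a b, IsMaxOn ψ (Icc a b) c ∧ deriv ψ c = 0 := by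
  obtain ⟨c, hc, hmax⟩ := isCompact_Icc.exists_isMaxOn (nonempty_Icc.2 H.lt.le) H.continuousOn
  obtain ⟨m, hm⟩ := nonempty_Ioo.2 H.lt
  have hpos : 0 < ψ c := (H.pos m hm).trans_le (hmax (Ioo_subset_Icc_self hm))
  rcases eq_endpoints_or_mem_Ioo_of_mem_Icc hc with rfl | rfl | hc'
  · exact absurd H.left hpos.ne'
  · exact absurd H.right hpos.ne'
  · exact ⟨c, hc', hmax, (hmax.isLocalMax (Icc_mem_nhds hc'.1 hc'.2)).deriv_eq_zero⟩

end IsProfile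

section Cosine

/-- The two quantities shown to be constant are the coordinates of `(y, y'/k)` in a frame that
rotates with angular velocity `k`. -/
lemma eq_mul_cos_of_hasDerivAt_neg_sq_mul {y y' : ℝ → ℝ} {k a b c : ℝ} (hk : k ≠ 0)
    (hy : ∀ θ ∈ Ioo a b, HasDerivAt y (y' θ) θ)
    (hy' : ∀ θ ∈ Ioo a b, HasDerivAt y' (-k ^ 2 * y θ) θ) (hc : c ∈ Ioo a b) (hc0 : y' c = 0)
    {θ : ℝ} (hθ : θ ∈ Ioo a b) : y θ = y c * cos (k * (θ - c)) := by
  have harg : ∀ θ, HasDerivAt (fun x => k * (x - c)) k θ := fun θ => by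
    simpa using ((hasDerivAt_id θ).sub_const c).const_mul k
  have hfst := eq_of_forall_hasDerivAt_zero
    (f := fun x => y x * cos (k * (x - c)) - y' x / k * sin (k * (x - c)))
    (fun θ hθ => (((hy θ hθ).mul (harg θ).cos).sub
      (((hy' θ hθ).div_const k).mul (harg θ).sin)).congr_deriv (by field_simp; ring)) hθ hc
  have hsnd := eq_of_forall_hasDerivAt_zero
    (f := fun x => y x * sin (k * (x - c)) + y' x / k * cos (k * (x - c)))
    (fun θ hθ => (((hy θ hθ).mul (harg θ).sin).add
      (((hy' θ hθ).div_const k).mul (harg θ).cos)).congr_deriv (by field_simp; ring)) hθ hc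
  simp only [sub_self, mul_zero, cos_zero, sin_zero, hc0, mul_one, sub_zero, zero_div,
    add_zero] at hfst hsnd
  linear_combination cos (k * (θ - c)) * hfst + sin (k * (θ - c)) * hsnd
    - y θ * sin_sq_add_cos_sq (k * (θ - c))

lemma eq_pi_div_two_of_cos_eq_zero {x : ℝ} (hx : 0 < x) (h : cos x = 0)
    (hne : ∀ y ∈ Ioo 0 x, cos y ≠ 0) : x = π / 2 := by
  rcases lt_trichotomy x (π / 2) with hlt | heq | hgt
  · exact absurd h (cos_pos_of_mem_Ioo ⟨by linarith, hlt⟩).ne'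
  · exact heq
  · exact absurd cos_pi_div_two (hne _ ⟨by positivity, hgt⟩)

namespace IsProfile

variable {lam P : ℝ} {ψ : ℝ → ℝ} {a b : ℝ}

lemma energy_eq_zero (H : IsProfile lam P 0 ψ a b) {θ : ℝ} (hθ : θ ∈ Ioo a b) :
    2 * P + lam ^ 2 * ψ θ ^ 2 + deriv ψ θ ^ 2 = 0 :=
  (mul_eq_zero.1 (H.bernoulli θ hθ)).resolve_right (Real.rpow_pos_of_pos (H.pos θ hθ) _).ne'

lemma exists_eq_mul_cos (H : IsProfile lam P 0 ψ a b) (hlam : lam ≠ 0) :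
    ∃ c ∈ Ioo a b, lam ^ 2 * ψ c ^ 2 = -2 * P ∧
      ∀ θ ∈ Icc a b, ψ θ = ψ c * cos (lam * (θ - c)) := by
  have hderiv2 : ∀ θ ∈ Ioo a b, HasDerivAt (deriv ψ) (-lam ^ 2 * ψ θ) θ := fun θ hθ => by
    have hne := H.ne_zero θ hθ
    refine (H.hasDerivAt_deriv hlam hθ).congr_deriv ?_
    rw [div_eq_iff (mul_ne_zero hlam hne)]
    linear_combination (lam - 1) * H.energy_eq_zero hθ
  obtain ⟨c, hc, -, hc0⟩ := H.exists_isMaxOn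
  have hcos : EqOn ψ (fun θ => ψ c * cos (lam * (θ - c))) (Icc a b) :=
    EqOn.of_subset_closure
      (fun θ hθ => eq_mul_cos_of_hasDerivAt_neg_sq_mul hlam H.hasDerivAt hderiv2 hc hc0 hθ)
      H.continuousOn (by fun_prop) Ioo_subset_Icc_self (closure_Ioo H.lt.ne).ge
  have henergy := H.energy_eq_zero hc
  rw [hc0] at henergy
  exact ⟨c, hc, by linarith, hcos⟩

theorem eq_mul_cos_of_bernoulli_eq_zero (H : IsProfile lam P 0 ψ a b) (h0 : 0 < lam) :
    b - a = π / lam ∧ ∃ M, 0 < M ∧ lam ^ 2 * M ^ 2 = -2 * P ∧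
      ∀ θ ∈ Icc a b, ψ θ = M * cos (lam * (θ - (a + b) / 2)) := by
  obtain ⟨c, hc, hcP, hcos⟩ := H.exists_eq_mul_cos h0.ne'
  have hM := H.pos c hc
  have hne : ∀ θ ∈ Ioo a b, cos (lam * (θ - c)) ≠ 0 := fun θ hθ h => by
    have := hcos θ (Ioo_subset_Icc_self hθ)
    rw [h, mul_zero] at this
    exact H.ne_zero θ hθ this
  have hzero : ∀ θ ∈ Icc a b, ψ θ = 0 → cos (lam * (θ - c)) = 0 := fun θ hθ h =>
    (mul_eq_zero.1 ((hcos θ hθ).symm.trans h)).resolve_left hM.ne'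
  have hright : lam * (b - c) = π / 2 := by
    refine eq_pi_div_two_of_cos_eq_zero (mul_pos h0 (sub_pos.2 hc.2))
      (hzero b (right_mem_Icc.2 H.lt.le) H.right) fun y hy => ?_
    have hy1 : 0 < y / lam := div_pos hy.1 h0
    have hy2 : y / lam < b - c := by rw [div_lt_iff₀ h0, mul_comm]; exact hy.2
    simpa [mul_div_cancel₀ _ h0.ne'] using hne (c + y / lam) ⟨by linarith [hc.1], by linarith⟩
  have hleft : lam * (c - a) = π / 2 := by
    refine eq_pi_div_two_of_cos_eq_zero (mul_pos h0 (sub_pos.2 hc.1)) ?_ fun y hy => ?_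
    · rw [← cos_neg, ← mul_neg, neg_sub]
      exact hzero a (left_mem_Icc.2 H.lt.le) H.left
    have hy1 : 0 < y / lam := div_pos hy.1 h0
    have hy2 : y / lam < c - a := by rw [div_lt_iff₀ h0, mul_comm]; exact hy.2
    simpa [mul_div_cancel₀ _ h0.ne'] using hne (c - y / lam) ⟨by linarith, by linarith [hc.2]⟩
  have hmid : c = (a + b) / 2 := by
    have := mul_left_cancel₀ h0.ne' (hright.trans hleft.symm)
    linarith
  refine ⟨?_, ψ c, hM, hcP, hmid ▸ hcos⟩
  rw [eq_div_iff h0.ne']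
  linarith

end IsProfile

end Cosine

/-- The right-hand side of `(v')² = 1 - v² + κ (1 - v^(2-2λ))`, the equation of `v = (ψ/M)^(1/λ)`
for a local solution `ψ` with maximum `M` and `κ = pressureRatio λ P M`. -/
noncomputable def profileRate (lam κ v : ℝ) : ℝ := 1 - v ^ 2 + κ * (1 - v ^ (2 - 2 * lam))

/-- The dimensionless parameter `κ` that determines, together with `λ`, the shape of a local
solution with pressure `P` and maximum `M`. -/
noncomputable def pressureRatio (lam P M : ℝ) : ℝ := 2 * P / (lam ^ 2 * M ^ 2)

/-- The Bernoulli constant of a local solution with pressure `P` and maximum `M`. -/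
noncomputable def bernoulliOfMax (lam P M : ℝ) : ℝ :=
  (2 * P + lam ^ 2 * M ^ 2) * M ^ (2 / lam - 2)

lemma pressureRatio_mul_nonneg {lam P : ℝ} (M : ℝ) (hP : 0 ≤ P * (1 - lam)) :
    0 ≤ pressureRatio lam P M * (1 - lam) := by
  have : pressureRatio lam P M * (1 - lam) = 2 * (P * (1 - lam)) / (lam ^ 2 * M ^ 2) := by
    rw [pressureRatio]
    ring
  rw [this]
  positivity

lemma mul_one_sub_rpow_nonneg {lam κ v : ℝ} (hκ : 0 ≤ κ * (1 - lam)) (hv : v ∈ Ioo (0 : ℝ) 1) :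
    0 ≤ κ * (1 - v ^ (2 - 2 * lam)) := by
  rcases lt_trichotomy lam 1 with h | h | h
  · have hκ0 : 0 ≤ κ := nonneg_of_mul_nonneg_left hκ (by linarith)
    have := Real.rpow_le_one hv.1.le hv.2.le (show 0 ≤ 2 - 2 * lam by linarith)
    exact mul_nonneg hκ0 (by linarith)
  · simp [h]
  · have hκ0 : κ ≤ 0 := by nlinarith
    have := Real.one_le_rpow_of_pos_of_le_one_of_nonpos hv.1 hv.2.le
      (show 2 - 2 * lam ≤ 0 by linarith)
    exact mul_nonneg_of_nonpos_of_nonpos hκ0 (by linarith)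

lemma one_sub_sq_pos {v : ℝ} (hv : v ∈ Ioo (0 : ℝ) 1) : 0 < 1 - v ^ 2 := by
  nlinarith [hv.1, hv.2]

lemma profileRate_pos {lam κ v : ℝ} (hκ : 0 ≤ κ * (1 - lam)) (hv : v ∈ Ioo (0 : ℝ) 1) :
    0 < profileRate lam κ v :=
  add_pos_of_pos_of_nonneg (one_sub_sq_pos hv) (mul_one_sub_rpow_nonneg hκ hv)

/-- A rescaled profile: it rises from `0` to its maximum `1` and returns to `0`, and solves
`(v')² = F v`. Constant pieces at the maximum, which this equation allows when `F 1 = 0`, are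
excluded separately. -/
structure IsBump (F : ℝ → ℝ) (v : ℝ → ℝ) (a c b : ℝ) : Prop where
  mem : c ∈ Ioo a b
  continuousOn : ContinuousOn v (Icc a b)
  left : v a = 0
  right : v b = 0
  top : v c = 1
  pos : ∀ θ ∈ Ioo a b, 0 < v θ
  le_one : ∀ θ ∈ Icc a b, v θ ≤ 1
  exists_hasDerivAt : ∀ θ ∈ Ioo a b, ∃ d, HasDerivAt v d θ ∧ d ^ 2 = F (v θ)
  not_flat : ∀ x ∈ Ioo a b, ∀ y ∈ Ioo a b, x < y → ∃ t ∈ Icc x y, v t ≠ 1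

section MeanValue

lemma hasDerivAt_sqrt_of_sq_deriv_eq {f v : ℝ → ℝ} {a c : ℝ} (hac : a < c)
    (hv : ContinuousOn v (Icc a c)) (hlt : v a < v c)
    (hd : ∀ θ ∈ Ioo a c, ∃ d, HasDerivAt v d θ ∧ d ^ 2 = f θ) (hf : ∀ θ ∈ Ioo a c, 0 < f θ)
    {θ : ℝ} (hθ : θ ∈ Ioo a c) : HasDerivAt v (√(f θ)) θ := by
  choose! d hd hd_sq using hd
  have hne : ∀ θ ∈ Ioo a c, d θ ≠ 0 := fun θ hθ h => by
    have := hf θ hθ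
    rw [← hd_sq θ hθ, h] at this
    norm_num at this
  have hpos : ∀ θ ∈ Ioo a c, 0 < d θ := by
    refine (hasDerivWithinAt_forall_lt_or_forall_gt_of_forall_ne (convex_Ioo a c)
      (fun x hx => (hd x hx).hasDerivWithinAt) hne).resolve_left fun hneg => ?_
    obtain ⟨ξ, hξ, hslope⟩ := exists_hasDerivAt_eq_slope v d hac hv hd
    exact (div_pos (sub_pos.2 hlt) (sub_pos.2 hac)).not_gt (hslope ▸ hneg ξ hξ)
  rw [← hd_sq θ hθ, Real.sqrt_sq (hpos θ hθ).le]
  exact hd θ hθ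

/-- The mean value theorem for `Z ∘ v`: a substitute for the substitution rule
`∫ z(x) dx = ∫ z(v) v' dθ` that needs no integrability. -/
lemma exists_mean_value_of_sq_deriv {F v Z z : ℝ → ℝ} {a c : ℝ} (hac : a < c)
    (hF : ∀ x ∈ Ioo (0 : ℝ) 1, 0 < F x) (hv : ContinuousOn v (Icc a c)) (ha : v a = 0)
    (hc : v c = 1) (hmem : ∀ θ ∈ Ioo a c, v θ ∈ Ioo (0 : ℝ) 1)
    (hd : ∀ θ ∈ Ioo a c, ∃ d, HasDerivAt v d θ ∧ d ^ 2 = F (v θ))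
    (hZ : ContinuousOn Z (Icc 0 1)) (hz : ∀ x ∈ Ioo (0 : ℝ) 1, HasDerivAt Z (z x) x) :
    ∃ ξ ∈ Ioo (0 : ℝ) 1, Z 1 - Z 0 = z ξ * √(F ξ) * (c - a) := by
  have hderiv : ∀ θ ∈ Ioo a c, HasDerivAt v (√(F (v θ))) θ := fun θ hθ =>
    hasDerivAt_sqrt_of_sq_deriv_eq hac hv (by rw [ha, hc]; exact one_pos) hd
      (fun θ hθ => hF _ (hmem θ hθ)) hθ
  have hmaps : MapsTo v (Icc a c) (Icc 0 1) := fun θ hθ => by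
    rcases eq_endpoints_or_mem_Ioo_of_mem_Icc hθ with rfl | rfl | hθ'
    · simp [ha]
    · simp [hc]
    · exact Ioo_subset_Icc_self (hmem θ hθ')
  obtain ⟨ξ, hξ, hslope⟩ := exists_hasDerivAt_eq_slope (fun θ => Z (v θ))
    (fun θ => z (v θ) * √(F (v θ))) hac (hZ.comp hv hmaps)
    fun θ hθ => (hz _ (hmem θ hθ)).comp θ (hderiv θ hθ)
  refine ⟨v ξ, hmem ξ hξ, ?_⟩
  rw [hslope, ha, hc, div_mul_cancel₀ _ (sub_pos.2 hac).ne']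

end MeanValue

namespace IsBump

variable {F v : ℝ → ℝ} {a c b : ℝ}

/-- Between two maxima there would be an interior minimum with value in `(0,1)`. -/
lemma ne_one_of_lt (H : IsBump F v a c b) (hF : ∀ x ∈ Ioo (0 : ℝ) 1, 0 < F x) {x y : ℝ}
    (hx : x ∈ Ioo a b) (hy : y ∈ Ioo a b) (hxy : x < y) (hvx : v x = 1) : v y ≠ 1 := by
  intro hvy
  obtain ⟨t, ht, htne⟩ := H.not_flat x hx y hy hxy
  have hsub : Icc x y ⊆ Ioo a b := Icc_subset_Ioo hx.1 hy.2
  obtain ⟨m, hm, hmin⟩ := isCompact_Icc.exists_isMinOn (nonempty_Icc.2 hxy.le)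
    (H.continuousOn.mono (hsub.trans Ioo_subset_Icc_self))
  have hm1 : v m < 1 :=
    (hmin ht).trans_lt (lt_of_le_of_ne (H.le_one t (Ioo_subset_Icc_self (hsub ht))) htne)
  have hmo : m ∈ Ioo x y := by
    rcases eq_endpoints_or_mem_Ioo_of_mem_Icc hm with rfl | rfl | hm'
    · exact absurd hvx hm1.ne
    · exact absurd hvy hm1.ne
    · exact hm'
  obtain ⟨d, hd, hd_sq⟩ := H.exists_hasDerivAt m (hsub hm)
  have hd0 : d = 0 := (hmin.isLocalMin (Icc_mem_nhds hmo.1 hmo.2)).hasDerivAt_eq_zero hd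
  have := hF (v m) ⟨H.pos m (hsub hm), hm1⟩
  rw [← hd_sq, hd0] at this
  norm_num at this

lemma lt_one (H : IsBump F v a c b) (hF : ∀ x ∈ Ioo (0 : ℝ) 1, 0 < F x) {θ : ℝ}
    (hθ : θ ∈ Ioo a b) (hne : θ ≠ c) : v θ < 1 := by
  refine lt_of_le_of_ne (H.le_one θ (Ioo_subset_Icc_self hθ)) fun h => ?_
  rcases lt_or_gt_of_ne hne with hlt | hgt
  · exact H.ne_one_of_lt hF hθ H.mem hlt h H.top
  · exact H.ne_one_of_lt hF H.mem hθ hgt H.top h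

lemma comp_neg (H : IsBump F v a c b) : IsBump F (fun θ => v (-θ)) (-b) (-c) (-a) := by
  have hIoo : ∀ {θ}, θ ∈ Ioo (-b) (-a) → -θ ∈ Ioo a b := fun hθ =>
    ⟨lt_neg.1 hθ.2, neg_lt.1 hθ.1⟩
  have hIcc : ∀ {θ}, θ ∈ Icc (-b) (-a) → -θ ∈ Icc a b := fun hθ => ⟨le_neg.1 hθ.2, neg_le.1 hθ.1⟩
  refine ⟨⟨neg_lt_neg H.mem.2, neg_lt_neg H.mem.1⟩,
    H.continuousOn.comp continuousOn_neg fun _ => hIcc, by simp [H.right], by simp [H.left],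
    by simp [H.top], fun θ hθ => H.pos _ (hIoo hθ), fun θ hθ => H.le_one _ (hIcc hθ),
    fun θ hθ => ?_, fun x hx y hy hxy => ?_⟩
  · obtain ⟨d, hd, hd_sq⟩ := H.exists_hasDerivAt _ (hIoo hθ)
    exact ⟨-d, (hd.comp θ (hasDerivAt_neg θ)).congr_deriv (by ring), by rw [neg_sq, hd_sq]⟩
  · obtain ⟨t, ht, htne⟩ := H.not_flat _ (hIoo hy) _ (hIoo hx) (neg_lt_neg hxy)
    exact ⟨-t, ⟨le_neg.1 ht.2, neg_le.1 ht.1⟩, by rwa [neg_neg]⟩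

lemma exists_mean_value_left (H : IsBump F v a c b) (hF : ∀ x ∈ Ioo (0 : ℝ) 1, 0 < F x)
    {Z z : ℝ → ℝ} (hZ : ContinuousOn Z (Icc 0 1))
    (hz : ∀ x ∈ Ioo (0 : ℝ) 1, HasDerivAt Z (z x) x) :
    ∃ ξ ∈ Ioo (0 : ℝ) 1, Z 1 - Z 0 = z ξ * √(F ξ) * (c - a) := by
  have hsub : Ioo a c ⊆ Ioo a b := Ioo_subset_Ioo_right H.mem.2.le
  exact exists_mean_value_of_sq_deriv H.mem.1 hF
    (H.continuousOn.mono (Icc_subset_Icc_right H.mem.2.le)) H.left H.top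
    (fun θ hθ => ⟨H.pos θ (hsub hθ), H.lt_one hF (hsub hθ) hθ.2.ne⟩)
    (fun θ hθ => H.exists_hasDerivAt θ (hsub hθ)) hZ hz

lemma exists_mean_value (H : IsBump F v a c b) (hF : ∀ x ∈ Ioo (0 : ℝ) 1, 0 < F x)
    {Z z : ℝ → ℝ} (hZ : ContinuousOn Z (Icc 0 1))
    (hz : ∀ x ∈ Ioo (0 : ℝ) 1, HasDerivAt Z (z x) x) :
    ∃ ξ ∈ Ioo (0 : ℝ) 1, ∃ η ∈ Ioo (0 : ℝ) 1,
      2 * (Z 1 - Z 0) = z ξ * √(F ξ) * (c - a) + z η * √(F η) * (b - c) := by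
  obtain ⟨ξ, hξ, hleft⟩ := H.exists_mean_value_left hF hZ hz
  obtain ⟨η, hη, hright⟩ := H.comp_neg.exists_mean_value_left hF hZ hz
  refine ⟨ξ, hξ, η, hη, ?_⟩
  rw [neg_sub_neg] at hright
  linarith

end IsBump

section Rescaling

variable {lam P B M : ℝ} {ψ : ℝ → ℝ} {a b : ℝ}

lemma IsProfile.rescaled_hasDerivAt (H : IsProfile lam P (bernoulliOfMax lam P M) ψ a b)
    (hlam : lam ≠ 0) (hM : 0 < M) {θ : ℝ} (hθ : θ ∈ Ioo a b) :
    ∃ d, HasDerivAt (fun x => (ψ x / M) ^ (1 / lam)) d θ ∧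
      d ^ 2 = profileRate lam (pressureRatio lam P M) ((ψ θ / M) ^ (1 / lam)) := by
  have hu : 0 < ψ θ / M := div_pos (H.pos θ hθ) hM
  refine ⟨_, ((H.hasDerivAt θ hθ).div_const M).rpow_const (Or.inl hu.ne'), ?_⟩
  have hbernoulli := H.bernoulli θ hθ
  have hψ : ψ θ = ψ θ / M * M := by rw [div_mul_cancel₀ _ hM.ne']
  generalize ψ θ / M = u at hu hψ ⊢
  have hd_sq : (u ^ (1 / lam - 1)) ^ 2 = u ^ (2 / lam - 2) := by
    rw [← Real.rpow_natCast, ← Real.rpow_mul hu.le]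
    congr 1
    push_cast
    ring
  have hv_sq : (u ^ (1 / lam)) ^ 2 = u ^ (2 / lam - 2) * u ^ 2 := by
    rw [← Real.rpow_natCast, ← Real.rpow_mul hu.le, ← Real.rpow_natCast u, ← Real.rpow_add hu]
    congr 1
    push_cast
    ring
  have hv_rpow : (u ^ (1 / lam)) ^ (2 - 2 * lam) = u ^ (2 / lam - 2) := by
    rw [← Real.rpow_mul hu.le]
    congr 1
    field_simp
  rw [bernoulliOfMax, hψ, Real.mul_rpow hu.le hM.le] at hbernoulli
  have hscaled : (2 * P + lam ^ 2 * (u * M) ^ 2 + deriv ψ θ ^ 2) * u ^ (2 / lam - 2) =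
      2 * P + lam ^ 2 * M ^ 2 := by
    apply mul_right_cancel₀ (Real.rpow_pos_of_pos hM (2 / lam - 2)).ne'
    linarith
  rw [profileRate, pressureRatio, mul_pow, hd_sq, hv_sq, hv_rpow]
  generalize u ^ (2 / lam - 2) = X at hscaled
  field_simp
  linear_combination hscaled

lemma IsClassicalLocalSolution.sq_eq_of_constant (H : IsClassicalLocalSolution lam P ψ a b)
    {x y : ℝ} (hxy : x < y) (hsub : Ioo x y ⊆ Ioo a b) (hM : ∀ t ∈ Ioo x y, ψ t = M) :
    2 * (lam - 1) * P = lam ^ 2 * M ^ 2 := by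
  have hderiv : ∀ t ∈ Ioo x y, deriv ψ t = 0 := fun t ht => by
    have : ψ =ᶠ[𝓝 t] fun _ => M := by
      filter_upwards [isOpen_Ioo.mem_nhds ht] with s hs using hM s hs
    rw [this.deriv_eq, deriv_const]
  obtain ⟨m, hm⟩ := nonempty_Ioo.2 hxy
  have hflux : (fun x => lam * ψ x * deriv ψ x) =ᶠ[𝓝 m] fun _ => 0 := by
    filter_upwards [isOpen_Ioo.mem_nhds hm] with s hs
    rw [hderiv s hs, mul_zero]
  have hzero := (H.hasDerivAt_flux m (hsub hm)).unique
    ((hasDerivAt_const m (0 : ℝ)).congr_of_eventuallyEq hflux)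
  rw [fluxDeriv, hderiv m hm, hM m hm] at hzero
  linarith

lemma IsProfile.isBump {c : ℝ} (H : IsProfile lam P (bernoulliOfMax lam P (ψ c)) ψ a b)
    (h0 : 0 < lam) (hc : c ∈ Ioo a b) (hmax : IsMaxOn ψ (Icc a b) c)
    (hne : 2 * (lam - 1) * P ≠ lam ^ 2 * ψ c ^ 2) :
    IsBump (profileRate lam (pressureRatio lam P (ψ c))) (fun θ => (ψ θ / ψ c) ^ (1 / lam))
      a c b where
  mem := hc
  continuousOn := (H.continuousOn.div_const _).rpow_const fun x _ => Or.inr (by positivity)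
  left := by simp [H.left, Real.zero_rpow, h0.ne']
  right := by simp [H.right, Real.zero_rpow, h0.ne']
  top := by simp [(H.pos c hc).ne']
  pos θ hθ := Real.rpow_pos_of_pos (div_pos (H.pos θ hθ) (H.pos c hc)) _
  le_one θ hθ := Real.rpow_le_one (div_nonneg (H.nonneg hθ) (H.pos c hc).le)
    ((div_le_one (H.pos c hc)).2 (hmax hθ)) (by positivity)
  exists_hasDerivAt θ hθ := H.rescaled_hasDerivAt h0.ne' (H.pos c hc) hθ
  not_flat x hx y hy hxy := by
    by_contra! hflat
    have hsub : Icc x y ⊆ Ioo a b := Icc_subset_Ioo hx.1 hy.2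
    refine hne (H.sq_eq_of_constant hxy (Ioo_subset_Icc_self.trans hsub) fun t ht => ?_)
    have ht' := Ioo_subset_Icc_self ht
    have hratio : ψ t / ψ c = 1 := by
      have hnonneg : 0 ≤ ψ t / ψ c :=
        div_nonneg (H.nonneg (Ioo_subset_Icc_self (hsub ht'))) (H.pos c hc).le
      rw [← Real.rpow_rpow_inv hnonneg (one_div_pos.2 h0).ne', hflat t ht', Real.one_rpow]
    rwa [div_eq_one_iff_eq (H.pos c hc).ne'] at hratio

theorem IsProfile.exists_isBump (H : IsProfile lam P B ψ a b) (h0 : 0 < lam) :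
    ∃ M, 0 < M ∧ B = bernoulliOfMax lam P M ∧ (2 * (lam - 1) * P ≠ lam ^ 2 * M ^ 2 →
      ∃ v c, IsBump (profileRate lam (pressureRatio lam P M)) v a c b) := by
  obtain ⟨c, hc, hmax, hc0⟩ := H.exists_isMaxOn
  have hB : B = bernoulliOfMax lam P (ψ c) := by
    rw [bernoulliOfMax, ← H.bernoulli c hc, hc0]
    ring
  exact ⟨ψ c, H.pos c hc, hB, fun hne => ⟨_, c, (hB ▸ H).isBump h0 hc hmax hne⟩⟩

end Rescaling

section PhaseTime

/-- With `v = sin p`, the equation `(v')² = profileRate λ κ v` becomes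
`(p')² = 1 + |κ| * timeExcess λ p` when `κ (1 - λ) ≥ 0`. -/
noncomputable def timeExcess (lam p : ℝ) : ℝ := |1 - |sin p| ^ (2 - 2 * lam)| / cos p ^ 2

/-- The density `dθ/dp` of time with respect to the phase `p`, where `s = |κ|`. -/
noncomputable def timeDensity (lam s p : ℝ) : ℝ := 1 / √(1 + s * timeExcess lam p)

/-- The time that the phase needs to increase from `0` to `p`. -/
noncomputable def phaseTime (lam s p : ℝ) : ℝ := ∫ q in 0..p, timeDensity lam s q

/-- The life-span as a function of `s = |κ|`. -/
noncomputable def timeMap (lam s : ℝ) : ℝ := phaseTime lam s π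

variable {lam s : ℝ}

lemma timeExcess_nonneg (lam p : ℝ) : 0 ≤ timeExcess lam p :=
  div_nonneg (abs_nonneg _) (sq_nonneg _)

lemma one_add_mul_timeExcess_pos (hs : 0 ≤ s) (p : ℝ) : 0 < 1 + s * timeExcess lam p :=
  add_pos_of_pos_of_nonneg one_pos (mul_nonneg hs (timeExcess_nonneg lam p))

lemma measurable_timeDensity (lam s : ℝ) : Measurable (timeDensity lam s) := by
  unfold timeDensity timeExcess
  fun_prop

lemma timeDensity_pos (hs : 0 ≤ s) (p : ℝ) : 0 < timeDensity lam s p :=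
  one_div_pos.2 (Real.sqrt_pos.2 (one_add_mul_timeExcess_pos hs p))

lemma timeDensity_le_one (hs : 0 ≤ s) (p : ℝ) : timeDensity lam s p ≤ 1 := by
  rw [timeDensity, div_le_one (Real.sqrt_pos.2 (one_add_mul_timeExcess_pos hs p))]
  exact Real.one_le_sqrt.2 (le_add_of_nonneg_right (mul_nonneg hs (timeExcess_nonneg lam p)))

lemma intervalIntegrable_timeDensity (hs : 0 ≤ s) (x y : ℝ) :
    IntervalIntegrable (timeDensity lam s) volume x y := by
  refine intervalIntegrable_const (c := (1 : ℝ)) |>.mono_fun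
    (measurable_timeDensity lam s).aestronglyMeasurable (ae_of_all _ fun p => ?_)
  simpa [abs_of_pos (timeDensity_pos hs p)] using timeDensity_le_one hs p

lemma timeDensity_add_pi (p : ℝ) : timeDensity lam s (p + π) = timeDensity lam s p := by
  simp [timeDensity, timeExcess, sin_add_pi, cos_add_pi]

lemma timeDensity_neg (p : ℝ) : timeDensity lam s (-p) = timeDensity lam s p := by
  simp [timeDensity, timeExcess]

lemma continuousAt_timeDensity (hs : 0 ≤ s) {p : ℝ} (hsin : sin p ≠ 0) (hcos : cos p ≠ 0) :
    ContinuousAt (timeDensity lam s) p := by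
  have hexcess : ContinuousAt (timeExcess lam) p := by
    refine ContinuousAt.div ?_ (by fun_prop) (by positivity)
    refine (continuousAt_const.sub (ContinuousAt.rpow_const ?_ (Or.inl (by positivity)))).abs
    fun_prop
  exact continuousAt_const.div (continuousAt_const.add (continuousAt_const.mul hexcess)).sqrt
    (Real.sqrt_pos.2 (one_add_mul_timeExcess_pos hs p)).ne'

lemma continuous_phaseTime (hs : 0 ≤ s) : Continuous (phaseTime lam s) :=
  continuous_primitive (fun _ _ => intervalIntegrable_timeDensity hs _ _) 0

lemma hasDerivAt_phaseTime (hs : 0 ≤ s) {p : ℝ} (hsin : sin p ≠ 0) (hcos : cos p ≠ 0) :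
    HasDerivAt (phaseTime lam s) (timeDensity lam s p) p :=
  integral_hasDerivAt_right (intervalIntegrable_timeDensity hs _ _)
    (measurable_timeDensity lam s).stronglyMeasurable.stronglyMeasurableAtFilter
    (continuousAt_timeDensity hs hsin hcos)

lemma phaseTime_zero : phaseTime lam s 0 = 0 := integral_same

lemma two_mul_phaseTime_pi_div_two (hs : 0 ≤ s) :
    2 * phaseTime lam s (π / 2) = timeMap lam s := by
  have hreflect := integral_comp_sub_left (timeDensity lam s) π (a := 0) (b := π / 2)
  have hsymm : ∀ p, timeDensity lam s (π - p) = timeDensity lam s p := fun p => by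
    rw [sub_eq_neg_add, timeDensity_add_pi, timeDensity_neg]
  simp only [hsymm, sub_zero, show π - π / 2 = π / 2 by ring] at hreflect
  have hadd := integral_add_adjacent_intervals
    (intervalIntegrable_timeDensity (lam := lam) hs 0 (π / 2))
    (intervalIntegrable_timeDensity hs (π / 2) π)
  rw [timeMap, phaseTime, phaseTime]
  linarith

end PhaseTime

section LifeSpan

variable {lam κ : ℝ} {v : ℝ → ℝ} {a c b : ℝ}

lemma timeDensity_arcsin_mul {x : ℝ} (hκ : 0 ≤ κ * (1 - lam)) (hx : x ∈ Ioo (0 : ℝ) 1) :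
    timeDensity lam |κ| (arcsin x) * (1 / √(1 - x ^ 2)) * √(profileRate lam κ x) = 1 := by
  have hx2 := one_sub_sq_pos hx
  have hF := profileRate_pos hκ hx
  have hexcess : 1 + |κ| * timeExcess lam (arcsin x) = profileRate lam κ x / (1 - x ^ 2) := by
    rw [timeExcess, cos_arcsin, Real.sq_sqrt hx2.le, sin_arcsin (by linarith [hx.1]) hx.2.le,
      abs_of_pos hx.1, ← mul_div_assoc, ← abs_mul, abs_of_nonneg (mul_one_sub_rpow_nonneg hκ hx),
      profileRate]
    field_simp
  have := Real.sqrt_pos.2 hx2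
  have := Real.sqrt_pos.2 hF
  rw [timeDensity, hexcess, Real.sqrt_div hF.le]
  field_simp

lemma hasDerivAt_phaseTime_arcsin {s x : ℝ} (hs : 0 ≤ s) (hx : x ∈ Ioo (0 : ℝ) 1) :
    HasDerivAt (fun x => phaseTime lam s (arcsin x))
      (timeDensity lam s (arcsin x) * (1 / √(1 - x ^ 2))) x := by
  refine (hasDerivAt_phaseTime hs ?_ ?_).comp x (hasDerivAt_arcsin (by linarith [hx.1]) hx.2.ne)
  · rw [sin_arcsin (by linarith [hx.1]) hx.2.le]
    exact hx.1.ne'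
  · rw [cos_arcsin]
    exact (Real.sqrt_pos.2 (one_sub_sq_pos hx)).ne'

lemma IsBump.lifespan_eq (hκ : 0 ≤ κ * (1 - lam)) (H : IsBump (profileRate lam κ) v a c b) :
    b - a = timeMap lam |κ| := by
  obtain ⟨ξ, hξ, η, hη, hmean⟩ := H.exists_mean_value (fun x hx => profileRate_pos hκ hx)
    ((continuous_phaseTime (abs_nonneg κ)).comp continuous_arcsin).continuousOn
    (fun x hx => hasDerivAt_phaseTime_arcsin (lam := lam) (abs_nonneg κ) hx)
  simp only [Function.comp_apply, timeDensity_arcsin_mul hκ hξ, timeDensity_arcsin_mul hκ hη,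
    arcsin_one, arcsin_zero, phaseTime_zero, sub_zero,
    two_mul_phaseTime_pi_div_two (abs_nonneg κ)] at hmean
  linarith

theorem IsProfile.lifespan_eq {P B : ℝ} {ψ : ℝ → ℝ} (H : IsProfile lam P B ψ a b)
    (h0 : 0 < lam) (hP : 0 ≤ P * (1 - lam)) :
    ∃ M, 0 < M ∧ B = bernoulliOfMax lam P M ∧ b - a = timeMap lam |pressureRatio lam P M| := by
  obtain ⟨M, hM, hB, hbump⟩ := H.exists_isBump h0
  have hM2 : 0 < lam ^ 2 * M ^ 2 := by positivity
  obtain ⟨v, c, hv⟩ := hbump (by nlinarith)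
  exact ⟨M, hM, hB, hv.lifespan_eq (pressureRatio_mul_nonneg M hP)⟩

lemma sq_lt_rpow_two_sub {x : ℝ} (h0 : 0 < lam) (hx : x ∈ Ioo (0 : ℝ) 1) :
    x ^ 2 < x ^ (2 - 2 * lam) := by
  rw [← Real.rpow_two]
  exact Real.rpow_lt_rpow_of_exponent_gt hx.1 hx.2 (by linarith)

lemma profileRate_lt_one_sub_sq {x : ℝ} (h1 : lam < 1) (hκ : κ < 0) (hx : x ∈ Ioo (0 : ℝ) 1) :
    profileRate lam κ x < 1 - x ^ 2 :=
  add_lt_of_neg_right _ (mul_neg_of_neg_of_pos hκ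
    (sub_pos.2 (Real.rpow_lt_one hx.1.le hx.2 (by linarith))))

lemma rpow_sub_sq_lt_profileRate {x : ℝ} (h1 : lam < 1) (hκ : -1 < κ) (hx : x ∈ Ioo (0 : ℝ) 1) :
    x ^ (2 - 2 * lam) - x ^ 2 < profileRate lam κ x := by
  have hlt : x ^ (2 - 2 * lam) < 1 := Real.rpow_lt_one hx.1.le hx.2 (by linarith)
  rw [profileRate]
  nlinarith

lemma profileRate_pos_of_neg_one_lt {x : ℝ} (h0 : 0 < lam) (h1 : lam < 1) (hκ : -1 < κ)
    (hx : x ∈ Ioo (0 : ℝ) 1) : 0 < profileRate lam κ x :=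
  (sub_pos.2 (sq_lt_rpow_two_sub h0 hx)).trans (rpow_sub_sq_lt_profileRate h1 hκ hx)

lemma IsBump.pi_lt_lifespan {F : ℝ → ℝ} (H : IsBump F v a c b)
    (hF : ∀ x ∈ Ioo (0 : ℝ) 1, 0 < F x) (hlt : ∀ x ∈ Ioo (0 : ℝ) 1, F x < 1 - x ^ 2) :
    π < b - a := by
  obtain ⟨ξ, hξ, η, hη, hmean⟩ := H.exists_mean_value hF continuous_arcsin.continuousOn
    fun x hx => hasDerivAt_arcsin (by linarith [hx.1]) hx.2.ne
  have hfactor : ∀ x ∈ Ioo (0 : ℝ) 1, 1 / √(1 - x ^ 2) * √(F x) < 1 := fun x hx => by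
    rw [one_div_mul_eq_div, div_lt_one (Real.sqrt_pos.2 (one_sub_sq_pos hx))]
    exact Real.sqrt_lt_sqrt (hF x hx).le (hlt x hx)
  rw [arcsin_one, arcsin_zero] at hmean
  nlinarith [hfactor ξ hξ, hfactor η hη, H.mem.1, H.mem.2]

/-- `x = (sin(λθ))^(1/λ)` solves `(x')² = x^(2-2λ) - x²`, with inverse `θ = arcsin(x^λ)/λ`. -/
lemma hasDerivAt_arcsin_rpow {x : ℝ} (h0 : 0 < lam) (hx : x ∈ Ioo (0 : ℝ) 1) :
    HasDerivAt (fun x => 1 / lam * arcsin (x ^ lam)) (1 / √(x ^ (2 - 2 * lam) - x ^ 2)) x := by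
  have hpow_lt : x ^ lam < 1 := Real.rpow_lt_one hx.1.le hx.2 h0
  have hpow_pos : 0 < x ^ lam := Real.rpow_pos_of_pos hx.1 _
  refine (((hasDerivAt_arcsin (by linarith) hpow_lt.ne).comp x
    (Real.hasDerivAt_rpow_const (p := lam) (Or.inl hx.1.ne'))).const_mul (1 / lam)).congr_deriv ?_
  have hfactor : x ^ (2 - 2 * lam) - x ^ 2 = (1 - (x ^ lam) ^ 2) * (x ^ (1 - lam)) ^ 2 := by
    have hsq : (x ^ (1 - lam)) ^ 2 = x ^ (2 - 2 * lam) := by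
      rw [← Real.rpow_mul_natCast hx.1.le]
      push_cast
      ring_nf
    rw [sub_mul, one_mul, ← mul_pow, ← Real.rpow_add hx.1, add_sub_cancel, Real.rpow_one, hsq]
  have hinv : x ^ (1 - lam) * x ^ (lam - 1) = 1 := by
    rw [← Real.rpow_add hx.1, sub_add_sub_cancel, sub_self, Real.rpow_zero]
  have hpow_pos' := Real.rpow_pos_of_pos hx.1 (1 - lam)
  have hsqrt_pos : 0 < √(1 - (x ^ lam) ^ 2) := Real.sqrt_pos.2 (one_sub_sq_pos ⟨hpow_pos, hpow_lt⟩)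
  rw [hfactor, Real.sqrt_mul' _ (by positivity), Real.sqrt_sq hpow_pos'.le]
  field_simp
  linear_combination hinv

lemma IsBump.lifespan_lt_pi_div {F : ℝ → ℝ} (H : IsBump F v a c b) (h0 : 0 < lam)
    (hlt : ∀ x ∈ Ioo (0 : ℝ) 1, x ^ (2 - 2 * lam) - x ^ 2 < F x) : b - a < π / lam := by
  have hpos : ∀ x ∈ Ioo (0 : ℝ) 1, 0 < x ^ (2 - 2 * lam) - x ^ 2 := fun x hx =>
    sub_pos.2 (sq_lt_rpow_two_sub h0 hx)
  obtain ⟨ξ, hξ, η, hη, hmean⟩ := H.exists_mean_value (fun x hx => (hpos x hx).trans (hlt x hx))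
    (Z := fun x => 1 / lam * arcsin (x ^ lam))
    (continuousOn_const.mul (continuous_arcsin.comp_continuousOn
      (continuousOn_id.rpow_const fun x _ => Or.inr h0.le)))
    (fun x hx => hasDerivAt_arcsin_rpow h0 hx)
  have hfactor : ∀ x ∈ Ioo (0 : ℝ) 1, 1 < 1 / √(x ^ (2 - 2 * lam) - x ^ 2) * √(F x) :=
    fun x hx => by
      rw [one_div_mul_eq_div, one_lt_div (Real.sqrt_pos.2 (hpos x hx))]
      exact Real.sqrt_lt_sqrt (hpos x hx).le (hlt x hx)
  simp only [Real.one_rpow, Real.zero_rpow h0.ne', arcsin_one, arcsin_zero, mul_zero,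
    sub_zero] at hmean
  rw [show 2 * (1 / lam * (π / 2)) = π / lam by field_simp] at hmean
  nlinarith [hfactor ξ hξ, hfactor η hη, H.mem.1, H.mem.2]

theorem IsProfile.lifespan_mem_Ioo {P B : ℝ} {ψ : ℝ → ℝ} (H : IsProfile lam P B ψ a b)
    (h0 : 0 < lam) (h1 : lam < 1) (hP : P < 0) (hB : 0 < B) : b - a ∈ Ioo π (π / lam) := by
  obtain ⟨M, hM, hBM, hbump⟩ := H.exists_isBump h0
  have hM2 : 0 < lam ^ 2 * M ^ 2 := by positivity
  have hpos : 0 < 2 * P + lam ^ 2 * M ^ 2 := by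
    rw [hBM] at hB
    exact pos_of_mul_pos_left hB (Real.rpow_nonneg hM.le _)
  obtain ⟨v, c, hv⟩ := hbump (by nlinarith)
  have hκ0 : pressureRatio lam P M < 0 := div_neg_of_neg_of_pos (by linarith) hM2
  have hκ1 : -1 < pressureRatio lam P M := by
    rw [pressureRatio, lt_div_iff₀ hM2]
    linarith
  exact ⟨hv.pi_lt_lifespan (fun x hx => profileRate_pos_of_neg_one_lt h0 h1 hκ1 hx)
      fun x hx => profileRate_lt_one_sub_sq h1 hκ0 hx,
    hv.lifespan_lt_pi_div h0 fun x hx => rpow_sub_sq_lt_profileRate h1 hκ1 hx⟩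

end LifeSpan

section TimeMap

variable {lam s : ℝ}

lemma timeMap_zero (lam : ℝ) : timeMap lam 0 = π := by
  simp [timeMap, phaseTime, timeDensity]

lemma strictMono_phaseTime (hs : 0 ≤ s) : StrictMono (phaseTime lam s) := by
  intro x y hxy
  rw [← sub_pos, phaseTime, phaseTime,
    integral_interval_sub_left (intervalIntegrable_timeDensity hs 0 y)
      (intervalIntegrable_timeDensity hs 0 x)]
  exact intervalIntegral_pos_of_pos (intervalIntegrable_timeDensity hs x y)
    (timeDensity_pos hs) hxy

lemma timeMap_pos (hs : 0 ≤ s) : 0 < timeMap lam s :=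
  phaseTime_zero (lam := lam) (s := s) ▸ strictMono_phaseTime hs pi_pos

lemma abs_sin_lt_one_of_cos_ne_zero {p : ℝ} (hcos : cos p ≠ 0) : |sin p| < 1 := by
  rw [← sq_lt_one_iff_abs_lt_one, sin_sq]
  exact sub_lt_self 1 (by positivity)

lemma timeExcess_pos (hlam : lam ≠ 1) {p : ℝ} (hcos : cos p ≠ 0) : 0 < timeExcess lam p := by
  refine div_pos (abs_pos.2 (sub_ne_zero.2 fun h => ?_)) (by positivity)
  have hexp : 2 - 2 * lam ≠ 0 := fun h => hlam (by linarith)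
  refine (abs_sin_lt_one_of_cos_ne_zero hcos).ne ?_
  rw [← Real.rpow_rpow_inv (abs_nonneg (sin p)) hexp, ← h, Real.one_rpow]

lemma timeExcess_pos_of_mem_Ioo (hlam : lam ≠ 1) {p : ℝ} (hp : p ∈ Ioo 0 (π / 2)) :
    0 < timeExcess lam p :=
  timeExcess_pos hlam (cos_pos_of_mem_Ioo ⟨by linarith [hp.1, pi_pos], hp.2⟩).ne'

lemma timeDensity_lt_of_lt {t p : ℝ} (hs : 0 ≤ s) (hst : s < t) (hp : 0 < timeExcess lam p) :
    timeDensity lam t p < timeDensity lam s p := by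
  have hpos := one_add_mul_timeExcess_pos (lam := lam) hs p
  refine one_div_lt_one_div_of_lt (Real.sqrt_pos.2 hpos) (Real.sqrt_lt_sqrt hpos.le ?_)
  gcongr

lemma strictAntiOn_timeMap (hlam : lam ≠ 1) : StrictAntiOn (timeMap lam) (Ici 0) := by
  intro s hs t ht hst
  have hint := fun {r : ℝ} (hr : 0 ≤ r) =>
    intervalIntegrable_timeDensity (lam := lam) hr 0 (π / 2)
  have hpos : 0 < phaseTime lam s (π / 2) - phaseTime lam t (π / 2) := by
    rw [phaseTime, phaseTime, ← integral_sub (hint hs) (hint ht)]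
    exact intervalIntegral_pos_of_pos_on ((hint hs).sub (hint ht))
      (fun p hp => sub_pos.2 (timeDensity_lt_of_lt hs hst (timeExcess_pos_of_mem_Ioo hlam hp)))
      (by positivity)
  rw [← two_mul_phaseTime_pi_div_two hs, ← two_mul_phaseTime_pi_div_two ht]
  linarith

lemma timeMap_le_pi (hs : 0 ≤ s) : timeMap lam s ≤ π := by
  have hle := integral_mono_on pi_pos.le (intervalIntegrable_timeDensity (lam := lam) hs 0 π)
    (intervalIntegrable_const (c := (1 : ℝ))) fun p _ => timeDensity_le_one hs p
  simpa [timeMap, phaseTime] using hle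

lemma norm_timeDensity_le_one (hs : 0 ≤ s) (p : ℝ) : ‖timeDensity lam s p‖ ≤ 1 := by
  rw [Real.norm_of_nonneg (timeDensity_pos hs p).le]
  exact timeDensity_le_one hs p

lemma continuousOn_timeMap (lam : ℝ) : ContinuousOn (timeMap lam) (Ici 0) := by
  intro s hs
  refine continuousWithinAt_of_dominated_interval (bound := fun _ => 1)
    (Eventually.of_forall fun t => (measurable_timeDensity lam t).aestronglyMeasurable)
    ?_ intervalIntegrable_const (ae_of_all _ fun p _ => ContinuousAt.continuousWithinAt ?_)
  · filter_upwards [self_mem_nhdsWithin] with t ht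
    exact ae_of_all _ fun p _ => norm_timeDensity_le_one ht p
  · exact continuousAt_const.div (by fun_prop)
      (Real.sqrt_pos.2 (one_add_mul_timeExcess_pos hs p)).ne'

lemma tendsto_timeDensity_atTop {p : ℝ} (hp : 0 < timeExcess lam p) :
    Tendsto (fun s => timeDensity lam s p) atTop (𝓝 0) := by
  simp only [timeDensity, one_div]
  exact (tendsto_sqrt_atTop.comp (tendsto_atTop_add_const_left _ _
    (tendsto_id.atTop_mul_const hp))).inv_tendsto_atTop

lemma tendsto_timeMap_atTop (hlam : lam ≠ 1) : Tendsto (timeMap lam) atTop (𝓝 0) := by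
  have hhalf : Tendsto (fun s => phaseTime lam s (π / 2)) atTop
      (𝓝 (∫ _ in (0 : ℝ)..(π / 2), (0 : ℝ))) := by
    refine tendsto_integral_filter_of_dominated_convergence (fun _ => 1)
      (Eventually.of_forall fun t => (measurable_timeDensity lam t).aestronglyMeasurable)
      ?_ intervalIntegrable_const ?_
    · filter_upwards [eventually_ge_atTop 0] with t ht
      exact ae_of_all _ fun p _ => norm_timeDensity_le_one ht p
    · filter_upwards [Measure.ae_ne volume (π / 2)] with p hne hp
      rw [uIoc_of_le (by positivity)] at hp
      exact tendsto_timeDensity_atTop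
        (timeExcess_pos_of_mem_Ioo hlam ⟨hp.1, lt_of_le_of_ne hp.2 hne⟩)
  have htwice := hhalf.const_mul 2
  rw [intervalIntegral.integral_zero, mul_zero] at htwice
  refine htwice.congr' ?_
  filter_upwards [eventually_ge_atTop 0] with t ht
  exact two_mul_phaseTime_pi_div_two ht

lemma exists_timeMap_eq (hlam : lam ≠ 1) (hs : 0 ≤ s) {y : ℝ} (hy : y ∈ Ioo 0 (timeMap lam s)) :
    ∃ t, s < t ∧ timeMap lam t = y := by
  obtain ⟨u, hu, hsu⟩ := (((tendsto_timeMap_atTop hlam).eventually_lt_const hy.1).and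
    (eventually_ge_atTop s)).exists
  obtain ⟨t, ht, hty⟩ := intermediate_value_Icc' hsu
    ((continuousOn_timeMap lam).mono fun x hx => hs.trans hx.1) ⟨hu.le, hy.2.le⟩
  refine ⟨t, lt_of_le_of_ne ht.1 ?_, hty⟩
  rintro rfl
  exact hy.2.ne' hty

end TimeMap

section Phase

variable {lam s : ℝ}

lemma phaseTime_add_pi (hs : 0 ≤ s) (p : ℝ) :
    phaseTime lam s (p + π) = phaseTime lam s p + timeMap lam s := by
  have hperiod : Function.Periodic (timeDensity lam s) π := timeDensity_add_pi
  rw [timeMap, phaseTime, phaseTime, phaseTime, ← zero_add π,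
    ← hperiod.intervalIntegral_add_eq p 0, zero_add,
    integral_add_adjacent_intervals (intervalIntegrable_timeDensity hs 0 p)
      (intervalIntegrable_timeDensity hs p (p + π))]

lemma phaseTime_surjective (hs : 0 ≤ s) : Function.Surjective (phaseTime lam s) := by
  have hperiod : Function.Periodic (timeDensity lam s) π := timeDensity_add_pi
  exact (continuous_phaseTime hs).surjective
    (hperiod.tendsto_atTop_intervalIntegral_of_pos (timeMap_pos hs) pi_pos)
    (hperiod.tendsto_atBot_intervalIntegral_of_pos (timeMap_pos hs) pi_pos)

variable {κ : ℝ}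

/-- The phase as a function of time: the inverse of `phaseTime λ |κ|`. -/
noncomputable def phase (lam κ : ℝ) : ℝ ≃o ℝ :=
  ((strictMono_phaseTime (lam := lam) (abs_nonneg κ)).orderIsoOfSurjective _
    (phaseTime_surjective (abs_nonneg κ))).symm

lemma phaseTime_phase (θ : ℝ) : phaseTime lam |κ| (phase lam κ θ) = θ :=
  StrictMono.orderIsoOfSurjective_self_symm_apply _ _ _ θ

lemma phase_phaseTime (p : ℝ) : phase lam κ (phaseTime lam |κ| p) = p :=
  StrictMono.orderIsoOfSurjective_symm_apply_self _ _ _ p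

lemma phase_add_timeMap (θ : ℝ) : phase lam κ (θ + timeMap lam |κ|) = phase lam κ θ + π := by
  rw [← phase_phaseTime (lam := lam) (κ := κ) (phase lam κ θ + π),
    phaseTime_add_pi (abs_nonneg κ), phaseTime_phase]

lemma phase_zero : phase lam κ 0 = 0 := by
  rw [← phaseTime_zero (lam := lam) (s := |κ|), phase_phaseTime, phaseTime_zero]

lemma phase_timeMap_div_two : phase lam κ (timeMap lam |κ| / 2) = π / 2 := by
  rw [← two_mul_phaseTime_pi_div_two (abs_nonneg κ), mul_div_cancel_left₀ _ two_ne_zero,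
    phase_phaseTime]

lemma phase_timeMap : phase lam κ (timeMap lam |κ|) = π := phase_phaseTime π

lemma phase_int_mul (k : ℤ) : phase lam κ (k * timeMap lam |κ|) = k * π := by
  induction k using Int.induction_on with
  | zero => simp [phase_zero]
  | succ n ih =>
    push_cast at ih ⊢
    rw [add_mul, one_mul, phase_add_timeMap, ih]
    ring
  | pred n ih =>
    push_cast at ih ⊢
    have hstep := phase_add_timeMap (lam := lam) (κ := κ) ((-n - 1) * timeMap lam |κ|)
    rw [show (-(n : ℝ) - 1) * timeMap lam |κ| + timeMap lam |κ| = -n * timeMap lam |κ| by ring,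
      ih] at hstep
    linarith

lemma sin_phase_eq_zero_iff {θ : ℝ} :
    sin (phase lam κ θ) = 0 ↔ ∃ k : ℤ, θ = k * timeMap lam |κ| := by
  rw [sin_eq_zero_iff]
  refine exists_congr fun k => ?_
  rw [← phase_int_mul (lam := lam) k, (phase lam κ).injective.eq_iff, eq_comm]

lemma countable_setOf_sin_phase_mul_cos_phase_eq_zero :
    {θ | sin (phase lam κ θ) * cos (phase lam κ θ) = 0}.Countable := by
  refine (countable_range fun k : ℤ => phaseTime lam |κ| (k * π / 2)).mono fun θ hθ => ?_
  have hsin : sin (2 * phase lam κ θ) = 0 := by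
    rw [sin_two_mul, mul_assoc]
    exact mul_eq_zero_of_right _ hθ
  obtain ⟨k, hk⟩ := sin_eq_zero_iff.1 hsin
  refine ⟨k, ?_⟩
  beta_reduce
  rw [hk, mul_div_cancel_left₀ _ two_ne_zero, phaseTime_phase]

lemma hasDerivAt_phase {θ : ℝ} (hθ : sin (phase lam κ θ) * cos (phase lam κ θ) ≠ 0) :
    HasDerivAt (phase lam κ) (timeDensity lam |κ| (phase lam κ θ))⁻¹ θ :=
  HasDerivAt.of_local_left_inverse (phase lam κ).continuous.continuousAt
    (hasDerivAt_phaseTime (abs_nonneg κ) (left_ne_zero_of_mul hθ) (right_ne_zero_of_mul hθ))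
    (timeDensity_pos (abs_nonneg κ) _).ne' (Eventually.of_forall phaseTime_phase)

end Phase

section WeakIdentity

lemma isH1On_of_hasDerivAt_off_countable {ψ g : ℝ → ℝ} {S : Set ℝ} (hS : S.Countable)
    (hψ : Continuous ψ) (hg : Measurable g) (hd : ∀ θ ∉ S, HasDerivAt ψ (g θ) θ)
    (hg_sq : ∀ x y, IntervalIntegrable (fun t => g t ^ 2) volume x y) {a b : ℝ} (hab : a ≤ b) :
    IsH1On ψ g a b := by
  have hg_int : ∀ x y, IntervalIntegrable g volume x y := fun x y => by
    refine ((intervalIntegrable_const (c := (1 : ℝ))).add (hg_sq x y)).mono_fun'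
      hg.aestronglyMeasurable (Eventually.of_forall fun t => abs_le.2 ⟨?_, ?_⟩) <;>
    nlinarith [sq_nonneg (g t + 1), sq_nonneg (g t - 1)]
  refine ⟨?_, fun x _ y _ => ?_⟩
  · rw [memLp_two_iff_integrable_sq hg.aestronglyMeasurable]
    exact (intervalIntegrable_iff_integrableOn_Ioo_of_le hab).1 (hg_sq a b)
  · exact (integral_eq_of_hasDerivAt_off_countable ψ g hS hψ.continuousOn
      (fun t ht => hd t ht.2) (hg_int x y)).symm

lemma weakIdentity_of_hasDerivAt_flux {lam P : ℝ} {ψ g φ : ℝ → ℝ} {S : Set ℝ} {a b : ℝ}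
    (hS : S.Countable) (h : IsH1On ψ g a b) (hab : a ≤ b)
    (hflux : Continuous fun θ => lam * ψ θ * g θ)
    (hd : ∀ θ ∉ S, HasDerivAt (fun θ => lam * ψ θ * g θ) (fluxDeriv lam P (ψ θ) (g θ)) θ)
    (hφ : ContDiff ℝ ∞ φ) (hboundary : lam * ψ b * g b * φ b = lam * ψ a * g a * φ a) :
    WeakIdentity lam P ψ g φ a b := by
  rw [weakIdentity_iff h hab hφ, integral_eq_of_hasDerivAt_off_countable
    (fun θ => lam * ψ θ * g θ * φ θ) _ hS (hflux.mul hφ.continuous).continuousOn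
    (fun θ hθ => (hd θ hθ.2).mul (hφ.differentiable (by simp) θ).hasDerivAt)
    (((h.intervalIntegrable_fluxDeriv hab).mul_continuousOn hφ.continuous.continuousOn).add
      ((h.intervalIntegrable_flux hab).mul_continuousOn
        (hφ.continuous_deriv (by simp)).continuousOn)), hboundary, sub_self]

end WeakIdentity

section Sign

lemma abs_sign_le_one (x : ℝ) : |Real.sign x| ≤ 1 := by
  rcases Real.sign_apply_eq x with h | h | h <;> simp [h]

lemma sign_sq_of_ne_zero {x : ℝ} (hx : x ≠ 0) : Real.sign x ^ 2 = 1 := by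
  rcases Real.sign_apply_eq_of_ne_zero x hx with h | h <;> simp [h]

lemma measurable_sign : Measurable Real.sign :=
  Measurable.ite measurableSet_Iio measurable_const
    (Measurable.ite measurableSet_Ioi measurable_const measurable_const)

lemma eventually_sign_eq {f : ℝ → ℝ} {x : ℝ} (hf : ContinuousAt f x) (hx : f x ≠ 0) :
    ∀ᶠ y in 𝓝 x, Real.sign (f y) = Real.sign (f x) := by
  rcases lt_or_gt_of_ne hx with h | h
  · filter_upwards [hf.eventually_lt_const h] with y hy
    rw [Real.sign_of_neg hy, Real.sign_of_neg h]
  · filter_upwards [hf.eventually_const_lt h] with y hy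
    rw [Real.sign_of_pos hy, Real.sign_of_pos h]

lemma continuous_sign_mul {f q : ℝ → ℝ} (hf : Continuous f) (hq : Continuous q)
    (hzero : ∀ x, f x = 0 → q x = 0) : Continuous fun x => Real.sign (f x) * q x := by
  rw [continuous_iff_continuousAt]
  intro x
  by_cases hx : f x = 0
  · have hlim : Tendsto (fun y => |q y|) (𝓝 x) (𝓝 0) := by
      simpa [hzero x hx] using hq.abs.tendsto x
    rw [ContinuousAt, hzero x hx, mul_zero]
    refine squeeze_zero_norm (fun y => ?_) hlim
    rw [Real.norm_eq_abs, abs_mul]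
    exact mul_le_of_le_one_left (abs_nonneg _) (abs_sign_le_one _)
  · exact ((continuousAt_const (y := Real.sign (f x))).congr
      ((eventually_sign_eq hf.continuousAt hx).mono fun _ hy => hy.symm)).mul hq.continuousAt

end Sign

section Wave

variable {lam κ : ℝ}

/-- The sign of the velocity of the wave is that of `sin p cos p`, where `p` is the phase. -/
noncomputable def waveSlope (lam κ θ : ℝ) : ℝ := sin (phase lam κ θ) * cos (phase lam κ θ)

/-- The periodic solution of `(v')² = 1 - v² + κ (1 - v^(2-2λ))` with values in `[0,1]`. -/
noncomputable def wave (lam κ θ : ℝ) : ℝ := |sin (phase lam κ θ)|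

/-- The derivative of the wave, with value `0` at the points where the wave is `0` or `1`. -/
noncomputable def waveVelocity (lam κ θ : ℝ) : ℝ :=
  Real.sign (waveSlope lam κ θ) * √(profileRate lam κ (wave lam κ θ))

lemma continuous_waveSlope : Continuous (waveSlope lam κ) :=
  (continuous_sin.comp (phase lam κ).continuous).mul (continuous_cos.comp (phase lam κ).continuous)

lemma continuous_wave : Continuous (wave lam κ) :=
  (continuous_sin.comp (phase lam κ).continuous).abs

lemma continuous_wave_rpow {r : ℝ} (hr : 0 ≤ r) : Continuous fun θ => wave lam κ θ ^ r :=
  continuous_wave.rpow_const fun _ => Or.inr hr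

lemma wave_periodic : Function.Periodic (wave lam κ) (timeMap lam |κ|) := fun θ => by
  simp [wave, phase_add_timeMap, sin_add_pi]

lemma waveVelocity_periodic : Function.Periodic (waveVelocity lam κ) (timeMap lam |κ|) :=
  fun θ => by
    simp [waveVelocity, waveSlope, wave_periodic θ, phase_add_timeMap, sin_add_pi, cos_add_pi]

lemma wave_nonneg (θ : ℝ) : 0 ≤ wave lam κ θ := abs_nonneg _

lemma wave_le_one (θ : ℝ) : wave lam κ θ ≤ 1 := abs_sin_le_one _

lemma wave_timeMap_div_two : wave lam κ (timeMap lam |κ| / 2) = 1 := by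
  rw [wave, phase_timeMap_div_two, sin_pi_div_two, abs_one]

lemma wave_eq_zero_iff {θ : ℝ} : wave lam κ θ = 0 ↔ ∃ k : ℤ, θ = k * timeMap lam |κ| := by
  rw [wave, abs_eq_zero, sin_phase_eq_zero_iff]

lemma wave_eq_zero_or_one {θ : ℝ} (h : waveSlope lam κ θ = 0) :
    wave lam κ θ = 0 ∨ wave lam κ θ = 1 := by
  rcases mul_eq_zero.1 h with hsin | hcos
  · left
    rw [wave, hsin, abs_zero]
  · right
    rw [wave, abs_sin_eq_sqrt_one_sub_cos_sq, hcos]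
    simp

lemma wave_mem_Ioo {θ : ℝ} (h : waveSlope lam κ θ ≠ 0) : wave lam κ θ ∈ Ioo (0 : ℝ) 1 :=
  ⟨abs_pos.2 (left_ne_zero_of_mul h), abs_sin_lt_one_of_cos_ne_zero (right_ne_zero_of_mul h)⟩

lemma waveSlope_pos {θ : ℝ} (hθ : θ ∈ Ioo 0 (timeMap lam |κ| / 2)) : 0 < waveSlope lam κ θ := by
  have hleft := (phase lam κ).strictMono hθ.1
  have hright := (phase lam κ).strictMono hθ.2
  rw [phase_zero] at hleft
  rw [phase_timeMap_div_two] at hright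
  exact mul_pos (sin_pos_of_pos_of_lt_pi hleft (by linarith [pi_pos]))
    (cos_pos_of_mem_Ioo ⟨by linarith [pi_pos], hright⟩)

lemma waveSlope_neg {θ : ℝ} (hθ : θ ∈ Ioo (timeMap lam |κ| / 2) (timeMap lam |κ|)) :
    waveSlope lam κ θ < 0 := by
  have hleft := (phase lam κ).strictMono hθ.1
  have hright := (phase lam κ).strictMono hθ.2
  rw [phase_timeMap_div_two] at hleft
  rw [phase_timeMap] at hright
  exact mul_neg_of_pos_of_neg (sin_pos_of_pos_of_lt_pi (by linarith [pi_pos]) hright)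
    (cos_neg_of_pi_div_two_lt_of_lt hleft (by linarith))

lemma countable_setOf_waveSlope_eq_zero : {θ | waveSlope lam κ θ = 0}.Countable :=
  countable_setOf_sin_phase_mul_cos_phase_eq_zero

lemma inv_timeDensity_phase (hκ : 0 ≤ κ * (1 - lam)) {θ : ℝ} (h : waveSlope lam κ θ ≠ 0) :
    (timeDensity lam |κ| (phase lam κ θ))⁻¹ =
      √(profileRate lam κ (wave lam κ θ)) / |cos (phase lam κ θ)| := by
  have hcos : cos (phase lam κ θ) ^ 2 = 1 - wave lam κ θ ^ 2 := by
    rw [wave, sq_abs, cos_sq']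
  have hcos_pos : cos (phase lam κ θ) ^ 2 ≠ 0 := pow_ne_zero 2 (right_ne_zero_of_mul h)
  have hexcess : 1 + |κ| * timeExcess lam (phase lam κ θ) =
      profileRate lam κ (wave lam κ θ) / cos (phase lam κ θ) ^ 2 := by
    rw [timeExcess, ← wave, ← mul_div_assoc, ← abs_mul,
      abs_of_nonneg (mul_one_sub_rpow_nonneg hκ (wave_mem_Ioo h)), profileRate, ← hcos, add_div,
      div_self hcos_pos]
  rw [timeDensity, hexcess, one_div, inv_inv, Real.sqrt_div' _ (sq_nonneg _), Real.sqrt_sq_eq_abs]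

lemma hasDerivAt_wave (hκ : 0 ≤ κ * (1 - lam)) {θ : ℝ} (h : waveSlope lam κ θ ≠ 0) :
    HasDerivAt (wave lam κ) (waveVelocity lam κ θ) θ := by
  have hsin : sin (phase lam κ θ) ≠ 0 := left_ne_zero_of_mul h
  have hcos : cos (phase lam κ θ) ≠ 0 := right_ne_zero_of_mul h
  refine ((hasDerivAt_abs hsin).comp θ (hasDerivAt_phase h).sin).congr_deriv ?_
  rw [inv_timeDensity_phase hκ h, waveVelocity, waveSlope]
  rcases lt_or_gt_of_ne hsin with hs | hs <;> rcases lt_or_gt_of_ne hcos with hc | hc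
  · rw [sign_neg hs, Real.sign_of_pos (mul_pos_of_neg_of_neg hs hc), abs_of_neg hc]
    field_simp
    simp
  · rw [sign_neg hs, Real.sign_of_neg (mul_neg_of_neg_of_pos hs hc), abs_of_pos hc]
    field_simp
    simp
  · rw [sign_pos hs, Real.sign_of_neg (mul_neg_of_pos_of_neg hs hc), abs_of_neg hc]
    field_simp
    simp
  · rw [sign_pos hs, Real.sign_of_pos (mul_pos hs hc), abs_of_pos hc]
    field_simp
    simp

lemma hasDerivAt_profileRate {v : ℝ} (hv : v ≠ 0) :
    HasDerivAt (profileRate lam κ) (-2 * v - 2 * κ * (1 - lam) * v ^ (1 - 2 * lam)) v := by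
  refine (((hasDerivAt_pow 2 v).const_sub 1).add (((Real.hasDerivAt_rpow_const
    (p := 2 - 2 * lam) (Or.inl hv)).const_sub 1).const_mul κ)).congr_deriv ?_
  rw [show 2 - 2 * lam - 1 = 1 - 2 * lam by ring]
  push_cast
  ring

lemma hasDerivAt_waveVelocity (hκ : 0 ≤ κ * (1 - lam)) {θ : ℝ} (h : waveSlope lam κ θ ≠ 0) :
    HasDerivAt (waveVelocity lam κ)
      (-wave lam κ θ - κ * (1 - lam) * wave lam κ θ ^ (1 - 2 * lam)) θ := by
  have hmem := wave_mem_Ioo h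
  have hF := profileRate_pos hκ hmem
  have hsqrt := ((((hasDerivAt_profileRate hmem.1.ne').comp θ (hasDerivAt_wave hκ h)).sqrt
    hF.ne').const_mul (Real.sign (waveSlope lam κ θ)))
  refine (hsqrt.congr_of_eventuallyEq ?_).congr_deriv ?_
  · filter_upwards [eventually_sign_eq continuous_waveSlope.continuousAt h] with y hy
    rw [waveVelocity, hy]
    rfl
  · have hsign := sign_sq_of_ne_zero h
    have := Real.sqrt_pos.2 hF
    simp only [Function.comp_apply, waveVelocity]
    field_simp
    rw [hsign]
    ring

end Wave

section WaveStream

variable {lam κ : ℝ}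

/-- The periodic stream profile `M v^λ` built from the wave `v`. -/
noncomputable def waveStream (lam κ M θ : ℝ) : ℝ := M * wave lam κ θ ^ lam

/-- The weak derivative of `waveStream`, with value `0` at the points where the wave is `0` or
`1`. -/
noncomputable def waveStreamDeriv (lam κ M θ : ℝ) : ℝ :=
  lam * M * wave lam κ θ ^ (lam - 1) * waveVelocity lam κ θ

lemma continuous_waveStream (hlam : 0 ≤ lam) (M : ℝ) : Continuous (waveStream lam κ M) :=
  continuous_const.mul (continuous_wave_rpow hlam)

lemma waveStream_periodic (M : ℝ) : Function.Periodic (waveStream lam κ M) (timeMap lam |κ|) :=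
  fun θ => by rw [waveStream, wave_periodic θ, waveStream]

lemma waveStreamDeriv_periodic (M : ℝ) :
    Function.Periodic (waveStreamDeriv lam κ M) (timeMap lam |κ|) := fun θ => by
  rw [waveStreamDeriv, wave_periodic θ, waveVelocity_periodic θ, waveStreamDeriv]

lemma waveStream_eq_zero_iff (hlam : 0 < lam) {M : ℝ} (hM : 0 < M) {θ : ℝ} :
    waveStream lam κ M θ = 0 ↔ ∃ k : ℤ, θ = k * timeMap lam |κ| := by
  rw [waveStream, mul_eq_zero, or_iff_right hM.ne', Real.rpow_eq_zero (wave_nonneg θ) hlam.ne',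
    wave_eq_zero_iff]

lemma waveStream_timeMap_div_two (M : ℝ) : waveStream lam κ M (timeMap lam |κ| / 2) = M := by
  rw [waveStream, wave_timeMap_div_two, Real.one_rpow, mul_one]

lemma waveStream_le (hlam : 0 ≤ lam) {M : ℝ} (hM : 0 ≤ M) (θ : ℝ) : waveStream lam κ M θ ≤ M :=
  mul_le_of_le_one_right hM (Real.rpow_le_one (wave_nonneg θ) (wave_le_one θ) hlam)

lemma measurable_waveStreamDeriv (M : ℝ) : Measurable (waveStreamDeriv lam κ M) := by
  have hwave : Measurable (wave lam κ) := continuous_wave.measurable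
  have hsign : Measurable fun θ => Real.sign (waveSlope lam κ θ) :=
    measurable_sign.comp continuous_waveSlope.measurable
  unfold waveStreamDeriv waveVelocity profileRate
  fun_prop

lemma hasDerivAt_waveStream (hκ : 0 ≤ κ * (1 - lam)) (M : ℝ) {θ : ℝ}
    (h : waveSlope lam κ θ ≠ 0) :
    HasDerivAt (waveStream lam κ M) (waveStreamDeriv lam κ M θ) θ := by
  refine (((hasDerivAt_wave hκ h).rpow_const (p := lam)
    (Or.inl (wave_mem_Ioo h).1.ne')).const_mul M).congr_deriv ?_
  rw [waveStreamDeriv]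
  ring

lemma rpow_mul_sqrt_profileRate {v : ℝ} (hv : 0 < v) :
    v ^ (2 * lam - 1) * √(profileRate lam κ v) =
      √((1 + κ) * v ^ (4 * lam - 2) - v ^ (4 * lam) - κ * v ^ (2 * lam)) := by
  have hsq : v ^ (4 * lam - 2) = (v ^ (2 * lam - 1)) ^ 2 := by
    rw [← Real.rpow_mul_natCast hv.le]
    congr 1
    push_cast
    ring
  have hfour : v ^ (4 * lam) = (v ^ (2 * lam - 1)) ^ 2 * v ^ 2 := by
    rw [← hsq, ← Real.rpow_natCast v, ← Real.rpow_add hv]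
    congr 1
    push_cast
    ring
  have htwo : v ^ (2 * lam) = (v ^ (2 * lam - 1)) ^ 2 * v ^ (2 - 2 * lam) := by
    rw [← hsq, ← Real.rpow_add hv]
    congr 1
    ring
  rw [hsq, hfour, htwo, ← Real.sqrt_sq (Real.rpow_nonneg hv.le (2 * lam - 1)),
    ← Real.sqrt_mul (sq_nonneg _), Real.sqrt_sq (Real.rpow_nonneg hv.le (2 * lam - 1)),
    profileRate]
  congr 1
  ring

lemma waveStream_mul_deriv (M : ℝ) {θ : ℝ} (h : waveSlope lam κ θ ≠ 0) :
    lam * waveStream lam κ M θ * waveStreamDeriv lam κ M θ =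
      lam ^ 2 * M ^ 2 * (wave lam κ θ ^ (2 * lam - 1) * waveVelocity lam κ θ) := by
  have hpow : wave lam κ θ ^ (2 * lam - 1) = wave lam κ θ ^ lam * wave lam κ θ ^ (lam - 1) := by
    rw [← Real.rpow_add (wave_mem_Ioo h).1]
    congr 1
    ring
  rw [waveStream, waveStreamDeriv, hpow]
  ring

-- For `λ > 1/2` all exponents under the root are positive, so it vanishes where `v = 0` as well
-- as where `v = 1`, and the jumps of the sign are harmless.
lemma continuous_waveFlux (hlam : 1 / 2 < lam) (M : ℝ) :
    Continuous fun θ => lam * waveStream lam κ M θ * waveStreamDeriv lam κ M θ := by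
  have hroot : Continuous fun θ => √((1 + κ) * wave lam κ θ ^ (4 * lam - 2)
      - wave lam κ θ ^ (4 * lam) - κ * wave lam κ θ ^ (2 * lam)) :=
    (((continuous_const.mul (continuous_wave_rpow (by linarith))).sub
      (continuous_wave_rpow (by linarith))).sub
      (continuous_const.mul (continuous_wave_rpow (by linarith)))).sqrt
  refine ((continuous_sign_mul (continuous_waveSlope (lam := lam) (κ := κ)) hroot
    fun θ hθ => ?_).const_mul (lam ^ 2 * M ^ 2)).congr fun θ => ?_
  · rcases wave_eq_zero_or_one hθ with hv | hv <;> rw [hv]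
    · rw [Real.zero_rpow (by linarith), Real.zero_rpow (by linarith),
        Real.zero_rpow (by linarith)]
      simp
    · simp
  · by_cases hθ : waveSlope lam κ θ = 0
    · simp [waveStreamDeriv, waveVelocity, hθ]
    · rw [waveStream_mul_deriv M hθ, ← rpow_mul_sqrt_profileRate (wave_mem_Ioo hθ).1,
        waveVelocity]
      ring

lemma hasDerivAt_waveFlux (hκ : 0 ≤ κ * (1 - lam)) {M P : ℝ} (hP : 2 * P = κ * lam ^ 2 * M ^ 2)
    {θ : ℝ} (h : waveSlope lam κ θ ≠ 0) :
    HasDerivAt (fun t => lam * waveStream lam κ M t * waveStreamDeriv lam κ M t)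
      (fluxDeriv lam P (waveStream lam κ M θ) (waveStreamDeriv lam κ M θ)) θ := by
  have hv := (wave_mem_Ioo h).1
  have hprod := (((hasDerivAt_wave hκ h).rpow_const (p := 2 * lam - 1) (Or.inl hv.ne')).mul
    (hasDerivAt_waveVelocity hκ h)).const_mul (lam ^ 2 * M ^ 2)
  refine (hprod.congr_of_eventuallyEq ?_).congr_deriv ?_
  · filter_upwards [continuous_waveSlope.continuousAt.eventually_ne h] with y hy
    exact waveStream_mul_deriv M hy
  · have hfirst : wave lam κ θ ^ (2 * lam - 1 - 1) = (wave lam κ θ ^ (lam - 1)) ^ 2 := by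
      rw [← Real.rpow_mul_natCast hv.le]
      congr 1
      push_cast
      ring
    have hsecond : wave lam κ θ ^ (2 * lam - 1) * wave lam κ θ = (wave lam κ θ ^ lam) ^ 2 := by
      rw [← Real.rpow_mul_natCast hv.le, ← Real.rpow_add_one hv.ne']
      congr 1
      push_cast
      ring
    have hcancel : wave lam κ θ ^ (2 * lam - 1) * wave lam κ θ ^ (1 - 2 * lam) = 1 := by
      rw [← Real.rpow_add hv, show 2 * lam - 1 + (1 - 2 * lam) = 0 by ring, Real.rpow_zero]
    rw [fluxDeriv, waveStream, waveStreamDeriv, hfirst]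
    linear_combination (-lam ^ 2 * M ^ 2) * hsecond
      - lam ^ 2 * M ^ 2 * κ * (1 - lam) * hcancel - (lam - 1) * hP

lemma intervalIntegrable_sq_waveStreamDeriv_of_forall_ne (hlam : 1 / 2 < lam)
    (hκ : 0 ≤ κ * (1 - lam)) {M P : ℝ} (hP : 2 * P = κ * lam ^ 2 * M ^ 2) {a b : ℝ} (hab : a ≤ b)
    (hne : ∀ θ ∈ Ioo a b, waveSlope lam κ θ ≠ 0) :
    IntervalIntegrable (fun θ => waveStreamDeriv lam κ M θ ^ 2) volume a b := by
  have hψ := continuous_waveStream (κ := κ) (by linarith : 0 ≤ lam) M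
  set k : ℝ → ℝ := fun θ => 2 * (lam - 1) * P - lam ^ 2 * waveStream lam κ M θ ^ 2 with hk
  have hkc : Continuous k := by fun_prop
  have hscaled : IntervalIntegrable (fun θ => (2 * lam - 1) * waveStreamDeriv lam κ M θ ^ 2)
      volume a b := by
    refine intervalIntegrable_deriv_of_nonneg (g := fun θ =>
      lam * waveStream lam κ M θ * waveStreamDeriv lam κ M θ - ∫ t in 0..θ, k t) ?_ ?_ ?_
    · exact ((continuous_waveFlux hlam M).sub
        (continuous_primitive (fun _ _ => hkc.intervalIntegrable _ _) 0)).continuousOn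
    · intro θ hθ
      rw [min_eq_left hab, max_eq_right hab] at hθ
      refine ((hasDerivAt_waveFlux hκ hP (hne θ hθ)).sub
        (hkc.integral_hasStrictDerivAt 0 θ).hasDerivAt).congr_deriv ?_
      rw [fluxDeriv, hk]
      ring
    · exact fun θ _ => mul_nonneg (by linarith) (sq_nonneg _)
  have hne' : 2 * lam - 1 ≠ 0 := by linarith
  simpa only [inv_mul_cancel_left₀ hne'] using hscaled.const_mul (2 * lam - 1)⁻¹

lemma intervalIntegrable_sq_waveStreamDeriv (hlam : 1 / 2 < lam) (hκ : 0 ≤ κ * (1 - lam))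
    {M P : ℝ} (hP : 2 * P = κ * lam ^ 2 * M ^ 2) (x y : ℝ) :
    IntervalIntegrable (fun θ => waveStreamDeriv lam κ M θ ^ 2) volume x y := by
  have hT := timeMap_pos (lam := lam) (abs_nonneg κ)
  have hper : Function.Periodic (fun θ => waveStreamDeriv lam κ M θ ^ 2) (timeMap lam |κ|) :=
    (waveStreamDeriv_periodic M).comp (· ^ 2)
  refine hper.intervalIntegrable₀ hT.ne' ?_ x y
  exact (intervalIntegrable_sq_waveStreamDeriv_of_forall_ne hlam hκ hP (half_pos hT).le
      fun θ hθ => (waveSlope_pos hθ).ne').trans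
    (intervalIntegrable_sq_waveStreamDeriv_of_forall_ne hlam hκ hP (half_le_self hT.le)
      fun θ hθ => (waveSlope_neg hθ).ne)

lemma isH1On_waveStream (hlam : 1 / 2 < lam) (hκ : 0 ≤ κ * (1 - lam)) {M P : ℝ}
    (hP : 2 * P = κ * lam ^ 2 * M ^ 2) {a b : ℝ} (hab : a ≤ b) :
    IsH1On (waveStream lam κ M) (waveStreamDeriv lam κ M) a b :=
  isH1On_of_hasDerivAt_off_countable countable_setOf_waveSlope_eq_zero
    (continuous_waveStream (by linarith) M) (measurable_waveStreamDeriv M)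
    (fun _ hθ => hasDerivAt_waveStream hκ M hθ)
    (intervalIntegrable_sq_waveStreamDeriv hlam hκ hP) hab

lemma weakIdentity_waveStream (hlam : 1 / 2 < lam) (hκ : 0 ≤ κ * (1 - lam)) {M P : ℝ}
    (hP : 2 * P = κ * lam ^ 2 * M ^ 2) {φ : ℝ → ℝ} (hφ : ContDiff ℝ ∞ φ) {a b : ℝ} (hab : a ≤ b)
    (hboundary : lam * waveStream lam κ M b * waveStreamDeriv lam κ M b * φ b =
      lam * waveStream lam κ M a * waveStreamDeriv lam κ M a * φ a) :
    WeakIdentity lam P (waveStream lam κ M) (waveStreamDeriv lam κ M) φ a b :=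
  weakIdentity_of_hasDerivAt_flux countable_setOf_waveSlope_eq_zero
    (isH1On_waveStream hlam hκ hP hab) hab (continuous_waveFlux hlam M)
    (fun _ hθ => hasDerivAt_waveFlux hκ hP hθ) hφ hboundary

lemma isLocalSolution_waveStream (hlam : 1 / 2 < lam) (hκ : 0 ≤ κ * (1 - lam)) {M P : ℝ}
    (hM : 0 < M) (hP : 2 * P = κ * lam ^ 2 * M ^ 2) :
    IsLocalSolution lam P (waveStream lam κ M) 0 (timeMap lam |κ|) := by
  have h0 : 0 < lam := by linarith
  have hT := timeMap_pos (lam := lam) (abs_nonneg κ)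
  have hleft : waveStream lam κ M 0 = 0 := (waveStream_eq_zero_iff h0 hM).2 ⟨0, by simp⟩
  have hright : waveStream lam κ M (timeMap lam |κ|) = 0 :=
    (waveStream_eq_zero_iff h0 hM).2 ⟨1, by simp⟩
  refine ⟨hT, hleft, hright, fun θ hθ hzero => ?_, waveStreamDeriv lam κ M,
    isH1On_waveStream hlam hκ hP hT.le,
    fun φ hφ _ _ => weakIdentity_waveStream hlam hκ hP hφ hT.le (by simp [hleft, hright])⟩
  obtain ⟨k, rfl⟩ := (waveStream_eq_zero_iff h0 hM).1 hzero
  have hk_pos : 0 < k := by exact_mod_cast pos_of_mul_pos_left hθ.1 hT.le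
  have hk_lt : k < 1 := by exact_mod_cast (mul_lt_iff_lt_one_left hT).1 hθ.2
  omega

lemma hasBernoulli_waveStream (hlam : 1 / 2 < lam) (hκ : 0 ≤ κ * (1 - lam)) {M P : ℝ}
    (hM : 0 < M) (hP : 2 * P = κ * lam ^ 2 * M ^ 2) :
    HasBernoulli lam P (bernoulliOfMax lam P M) (waveStream lam κ M) 0 (timeMap lam |κ|) := by
  have h0 : 0 < lam := by linarith
  have hT := timeMap_pos (lam := lam) (abs_nonneg κ)
  obtain ⟨B, hB⟩ := (isLocalSolution_waveStream hlam hκ hM hP).exists_hasBernoulli h0.ne'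
  have hcrit : deriv (waveStream lam κ M) (timeMap lam |κ| / 2) = 0 :=
    IsLocalMax.deriv_eq_zero (Eventually.of_forall fun θ => by
      rw [waveStream_timeMap_div_two]
      exact waveStream_le h0.le hM.le θ)
  have hmid := (hB _ ⟨half_pos hT, half_lt_self hT⟩).2
  rw [hcrit, waveStream_timeMap_div_two, abs_of_pos hM] at hmid
  have hB_eq : bernoulliOfMax lam P M = B := by
    rw [bernoulliOfMax, ← hmid]
    ring
  rwa [hB_eq]

end WaveStream

section Existence

variable {lam P : ℝ}

lemma two_mul_eq_pressureRatio_mul {M : ℝ} (hlam : lam ≠ 0) (hM : M ≠ 0) :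
    2 * P = pressureRatio lam P M * lam ^ 2 * M ^ 2 := by
  rw [pressureRatio]
  field_simp

theorem exists_isLocalSolution_hasBernoulli_bernoulliOfMax {M : ℝ} (hlam : 1 / 2 < lam)
    (hP : 0 ≤ P * (1 - lam)) (hM : 0 < M) :
    ∃ ψ, IsLocalSolution lam P ψ 0 (timeMap lam |pressureRatio lam P M|) ∧
      HasBernoulli lam P (bernoulliOfMax lam P M) ψ 0 (timeMap lam |pressureRatio lam P M|) := by
  have hκP := two_mul_eq_pressureRatio_mul (P := P) (by linarith : lam ≠ 0) hM.ne'
  have hκ := pressureRatio_mul_nonneg M hP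
  exact ⟨_, isLocalSolution_waveStream hlam hκ hM hκP, hasBernoulli_waveStream hlam hκ hM hκP⟩

lemma exists_abs_pressureRatio_eq {t : ℝ} (hP : P ≠ 0) (hlam : lam ≠ 0) (ht : 0 < t) :
    ∃ M, 0 < M ∧ |pressureRatio lam P M| = t := by
  have : 0 < |P| := abs_pos.2 hP
  have hM : 0 < 2 * |P| / (lam ^ 2 * t) := by positivity
  refine ⟨√(2 * |P| / (lam ^ 2 * t)), Real.sqrt_pos.2 hM, ?_⟩
  rw [pressureRatio, Real.sq_sqrt hM.le, abs_div, abs_mul, abs_two,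
    abs_of_pos (show 0 < lam ^ 2 * (2 * |P| / (lam ^ 2 * t)) by positivity)]
  field_simp

theorem exists_isSolution_eq_zero_iff (hlam : 1 / 2 < lam) (hP : 0 < P * (1 - lam)) {N : ℕ}
    (hN : 3 ≤ N) :
    ∃ ψ, IsSolution lam P ψ ∧ ∀ θ, ψ θ = 0 ↔ θ ∈ AddSubgroup.zmultiples (2 * π / N) := by
  have h0 : 0 < lam := by linarith
  have hlam1 : lam ≠ 1 := by
    rintro rfl
    simp at hP
  have hP0 : P ≠ 0 := left_ne_zero_of_mul hP.ne'
  have hN' : (3 : ℝ) ≤ N := by exact_mod_cast hN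
  have hN_pos : (0 : ℝ) < N := by linarith
  have hmem : 2 * π / N ∈ Ioo 0 (timeMap lam 0) := by
    rw [timeMap_zero]
    refine ⟨by positivity, ?_⟩
    rw [div_lt_iff₀ hN_pos]
    nlinarith [pi_pos]
  obtain ⟨t, ht, hty⟩ := exists_timeMap_eq hlam1 le_rfl hmem
  obtain ⟨M, hM, hratio⟩ := exists_abs_pressureRatio_eq hP0 h0.ne' ht
  have hκP := two_mul_eq_pressureRatio_mul (P := P) h0.ne' hM.ne'
  have hκ := pressureRatio_mul_nonneg M hP.le
  have hT : timeMap lam |pressureRatio lam P M| = 2 * π / N := by rw [hratio, hty]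
  have hNT : (N : ℝ) * timeMap lam |pressureRatio lam P M| = 2 * π := by
    rw [hT]
    field_simp
  have hψ_per := (waveStream_periodic (lam := lam) (κ := pressureRatio lam P M) M).nat_mul N
  have hg_per := (waveStreamDeriv_periodic (lam := lam) (κ := pressureRatio lam P M) M).nat_mul N
  rw [hNT] at hψ_per hg_per
  refine ⟨waveStream lam (pressureRatio lam P M) M, ⟨hψ_per, _,
    isH1On_waveStream hlam hκ hκP two_pi_pos.le, fun φ hφ hφ_per =>
    weakIdentity_waveStream hlam hκ hκP hφ two_pi_pos.le ?_⟩,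
    fun θ => by simp [waveStream_eq_zero_iff h0 hM, hT, AddSubgroup.mem_zmultiples_iff, eq_comm]⟩
  rw [hψ_per.eq, hg_per.eq, hφ_per.eq]

end Existence

section ZeroSets

lemma eventually_eq_zero_of_shear {lam A C θ₀ x : ℝ} {ψ : ℝ → ℝ}
    (h : ∀ θ, ψ θ = |cos (θ - θ₀)| ^ lam * (if 0 < cos (θ - θ₀) then A else C)) (hx : ψ x = 0)
    (hcos : cos (x - θ₀) ≠ 0) : ∀ᶠ θ in 𝓝 x, ψ θ = 0 := by
  have hcont : ContinuousAt (fun θ => cos (θ - θ₀)) x := by fun_prop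
  rw [h, mul_eq_zero, or_iff_right (Real.rpow_pos_of_pos (abs_pos.2 hcos) _).ne'] at hx
  rcases lt_or_gt_of_ne hcos with hneg | hpos
  · filter_upwards [hcont.eventually_lt_const hneg] with θ hθ
    rw [if_neg (not_lt.2 hneg.le)] at hx
    rw [h, if_neg (not_lt.2 hθ.le), hx, mul_zero]
  · filter_upwards [hcont.eventually_const_lt hpos] with θ hθ
    rw [if_pos hpos] at hx
    rw [h, if_pos hθ, hx, mul_zero]

lemma not_isParallelShear_of_countable_zeros {lam x y : ℝ} {ψ : ℝ → ℝ}
    (hψ : {θ | ψ θ = 0}.Countable) (hx : ψ x = 0) (hy : ψ y = 0) (hxy : x < y) (hyx : y < x + π) :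
    ¬ IsParallelShear lam ψ := by
  rintro ⟨A, C, θ₀, h⟩
  have hcos : ∀ z, ψ z = 0 → cos (z - θ₀) = 0 := fun z hz => by
    by_contra hne
    obtain ⟨θ, hθ, hzero⟩ :=
      (hψ.dense_compl ℝ).inter_nhds_nonempty (eventually_eq_zero_of_shear h hz hne)
    exact hθ hzero
  have hsin : sin (y - x) = 0 := by
    rw [show y - x = y - θ₀ - (x - θ₀) by ring, sin_sub, hcos x hx, hcos y hy]
    ring
  exact (sin_pos_of_pos_of_lt_pi (by linarith) (by linarith)).ne' hsin

lemma not_symEquiv_of_zeros_eq_zmultiples {ψ₁ ψ₂ : ℝ → ℝ} {τ₁ τ₂ : ℝ} (hτ₁ : 0 < τ₁) (hτ₂ : 0 < τ₂)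
    (hz₁ : ∀ θ, ψ₁ θ = 0 ↔ θ ∈ AddSubgroup.zmultiples τ₁)
    (hz₂ : ∀ θ, ψ₂ θ = 0 ↔ θ ∈ AddSubgroup.zmultiples τ₂) (hne : τ₁ ≠ τ₂) :
    ¬ SymEquiv ψ₁ ψ₂ := by
  rintro ⟨α, σ, θ₀, hα, hσ, h⟩
  have hzeros : ∀ θ, θ ∈ AddSubgroup.zmultiples τ₂ ↔ σ * θ + θ₀ ∈ AddSubgroup.zmultiples τ₁ :=
    fun θ => by rw [← hz₁, ← hz₂, h, mul_eq_zero, or_iff_right hα]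
  have hθ₀ : θ₀ ∈ AddSubgroup.zmultiples τ₁ := by
    simpa using (hzeros 0).1 (zero_mem _)
  have heq : AddSubgroup.zmultiples τ₁ = AddSubgroup.zmultiples τ₂ := by
    ext θ
    rw [hzeros, AddSubgroup.add_mem_cancel_right _ hθ₀]
    rcases hσ with rfl | rfl <;> simp
  rcases (AddSubgroup.zmultiples_eq_zmultiples_iff
    (not_isOfFinAddOrder_of_isAddTorsionFree hτ₁.ne')).1 heq with h' | h'
  · exact hne h'
  · linarith

theorem infinitelyManyHyperbolic {lam P : ℝ} (hlam : 1 / 2 < lam) (hP : 0 < P * (1 - lam)) :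
    InfinitelyManyHyperbolic lam P := by
  choose ψ hψ hzeros using fun n : ℕ => exists_isSolution_eq_zero_iff hlam hP
    (show 3 ≤ n + 3 by omega)
  have hstep_pos : ∀ n : ℕ, 0 < 2 * π / (n + 3 : ℕ) := fun n => by positivity
  have hstep_lt : ∀ n : ℕ, 2 * π / (n + 3 : ℕ) < π := fun n => by
    rw [div_lt_iff₀ (by positivity)]
    push_cast
    nlinarith [pi_pos, (Nat.cast_nonneg n : (0 : ℝ) ≤ n)]
  have hleft : ∀ n, ψ n 0 = 0 := fun n => (hzeros n 0).2 (zero_mem _)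
  have hright : ∀ n, ψ n (2 * π / (n + 3 : ℕ)) = 0 := fun n =>
    (hzeros n _).2 (AddSubgroup.mem_zmultiples _)
  refine ⟨ψ, fun n => ⟨hψ n, ⟨0, ⟨le_rfl, two_pi_pos⟩, _, ⟨(hstep_pos n).le, ?_⟩,
    (hstep_pos n).ne, hleft n, hright n⟩, ?_⟩, fun m n hmn => ?_⟩
  · linarith [hstep_lt n, pi_pos]
  · refine not_isParallelShear_of_countable_zeros ?_ (hleft n) (hright n) (hstep_pos n)
      (by linarith [hstep_lt n])
    exact (countable_range fun k : ℤ => k • (2 * π / (n + 3 : ℕ))).mono fun θ => (hzeros n θ).1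
  · refine not_symEquiv_of_zeros_eq_zmultiples (hstep_pos m) (hstep_pos n) (hzeros m) (hzeros n)
      fun h => hmn ?_
    rw [div_eq_div_iff (by positivity) (by positivity), mul_right_inj' two_pi_pos.ne'] at h
    have : n + 3 = m + 3 := by exact_mod_cast h
    omega

end ZeroSets

section Periodize

variable {T a b : ℝ}

/-- The `T`-periodic extension of the restriction of `φ` to `[a, a + T)`. -/
noncomputable def periodize (hT : 0 < T) (a : ℝ) (φ : ℝ → ℝ) (x : ℝ) : ℝ := φ (toIcoMod hT a x)

lemma periodize_periodic (hT : 0 < T) (a : ℝ) (φ : ℝ → ℝ) :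
    Function.Periodic (periodize hT a φ) T :=
  fun x => by rw [periodize, periodize, toIcoMod_periodic]

lemma periodize_eq (hT : 0 < T) {φ : ℝ → ℝ} {x : ℝ} (hx : x ∈ Ico a (a + T)) :
    periodize hT a φ x = φ x := by
  rw [periodize, (toIcoMod_eq_self hT).2 hx]

-- Near any point the periodic extension is the sum of two consecutive translates of `φ`.
lemma IsTestFunction.contDiff_periodize {φ : ℝ → ℝ} (hφ : IsTestFunction φ a b) (hT : 0 < T)
    (hb : b ≤ a + T) : ContDiff ℝ ∞ (periodize hT a φ) := by
  rw [contDiff_iff_contDiffAt]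
  intro x
  set n := toIcoDiv hT a x
  have hx : x - n • T ∈ Ico a (a + T) := sub_toIcoDiv_zsmul_mem_Ico hT a x
  have hshift : ContDiff ℝ ∞ fun y : ℝ => y - n • T := contDiff_id.sub contDiff_const
  have hsum : ContDiff ℝ ∞ fun y => φ (y - n • T) + φ (y - n • T + T) :=
    (hφ.contDiff.comp hshift).add (hφ.contDiff.comp (hshift.add contDiff_const))
  refine hsum.contDiffAt.congr_of_eventuallyEq ?_
  have hnear : ∀ᶠ y in 𝓝 x, y - n • T ∈ Ioo (a - T) (a + T) :=
    hshift.continuous.continuousAt.eventually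
      (isOpen_Ioo.mem_nhds ⟨by linarith [hx.1], hx.2⟩)
  filter_upwards [hnear] with y hy
  rcases lt_or_ge (y - n • T) a with h | h
  · have hmod : toIcoMod hT a y = y - n • T + T :=
      (toIcoMod_eq_iff hT).2 ⟨⟨by linarith [hy.1], by linarith⟩, n - 1, by
        rw [sub_smul]
        simp⟩
    rw [periodize, hmod, hφ.eq_zero_of_notMem (x := y - n • T) fun h' => by linarith [h'.1],
      zero_add]
  · have hmod : toIcoMod hT a y = y - n • T := (toIcoMod_eq_iff hT).2 ⟨⟨h, hy.2⟩, n, by simp⟩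
    rw [periodize, hmod, hφ.eq_zero_of_notMem (x := y - n • T + T) fun h' => by linarith [h'.2],
      add_zero]

lemma periodic_deriv {φ : ℝ → ℝ} (hφ : Function.Periodic φ T) : Function.Periodic (deriv φ) T :=
  fun x => by
    rw [← deriv_comp_add_const, funext hφ]

end Periodize

section PeriodicDerivative

variable {ψ g : ℝ → ℝ} {T : ℝ}

lemma sub_eq_integral_of_periodic (hT : 0 < T) (hψ : Function.Periodic ψ T)
    (hg : Function.Periodic g T) (hgi : ∀ x y, IntervalIntegrable g volume x y)
    (h : ∀ x ∈ Icc 0 T, ψ x - ψ 0 = ∫ t in 0..x, g t) (x y : ℝ) :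
    ψ y - ψ x = ∫ t in x..y, g t := by
  have hperiod : ∫ t in 0..T, g t = 0 := by
    rw [← h T (right_mem_Icc.2 hT.le), hψ.eq, sub_self]
  have hdiff : Function.Periodic (fun x => ψ x - ∫ t in 0..x, g t) T := fun x => by
    have hshift := hg.intervalIntegral_add_eq x 0
    rw [zero_add, hperiod] at hshift
    simp only [hψ x, ← integral_add_adjacent_intervals (hgi 0 x) (hgi x (x + T)), hshift, add_zero]
  have hprim : ∀ z, ψ z - ψ 0 = ∫ t in 0..z, g t := fun z => by
    obtain ⟨z', hz', hzz'⟩ := hdiff.exists_mem_Ico₀ hT z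
    have := h z' (Ico_subset_Icc_self hz')
    linarith
  rw [← integral_interval_sub_left (hgi 0 y) (hgi 0 x), ← hprim, ← hprim]
  ring

lemma IsH1On.exists_periodic (hT : 0 < T) (hψ : Function.Periodic ψ T) {g₀ : ℝ → ℝ}
    (h : IsH1On ψ g₀ 0 T) :
    ∃ g, Function.Periodic g T ∧ (∀ᵐ t, t ∈ Ioo 0 T → g₀ t = g t) ∧
      ∀ a b, a ≤ b → IsH1On ψ g a b := by
  have hg := periodize_periodic hT 0 g₀
  have hae : ∀ᵐ t, t ∈ Ioo 0 T → g₀ t = periodize hT 0 g₀ t := ae_of_all _ fun t ht =>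
    (periodize_eq hT (by simpa using Ioo_subset_Ico_self ht)).symm
  have hae_restrict : g₀ =ᵐ[volume.restrict (Ioo 0 T)] periodize hT 0 g₀ :=
    (ae_restrict_iff' measurableSet_Ioo).2 hae
  have hint : ∀ x y, IntervalIntegrable (periodize hT 0 g₀) volume x y :=
    hg.intervalIntegrable₀ hT.ne' ((intervalIntegrable_iff_integrableOn_Ioo_of_le hT.le).2
      ((h.1.integrable one_le_two).congr hae_restrict))
  have hint_sq : ∀ x y, IntervalIntegrable (fun t => periodize hT 0 g₀ t ^ 2) volume x y :=
    (hg.comp (· ^ 2)).intervalIntegrable₀ hT.ne'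
      ((intervalIntegrable_iff_integrableOn_Ioo_of_le hT.le).2
        (h.1.ae_eq hae_restrict).integrable_sq)
  refine ⟨_, hg, hae, fun a b hab => ⟨?_, fun x _ y _ => ?_⟩⟩
  · rw [memLp_two_iff_integrable_sq
      ((intervalIntegrable_iff_integrableOn_Ioo_of_le hab).1 (hint a b)).aestronglyMeasurable]
    exact (intervalIntegrable_iff_integrableOn_Ioo_of_le hab).1 (hint_sq a b)
  · refine sub_eq_integral_of_periodic hT hψ hg hint (fun x hx => ?_) x y
    have h0 := left_mem_Icc.2 hT.le
    rw [h.2 0 h0 x hx, integral_congr_ae_Ioo hae h0 hx]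

lemma WeakIdentity.congr_ae {lam P a b : ℝ} {φ g₁ g₂ : ℝ → ℝ} (hab : a ≤ b)
    (h : ∀ᵐ t, t ∈ Ioo a b → g₁ t = g₂ t) (H : WeakIdentity lam P ψ g₁ φ a b) :
    WeakIdentity lam P ψ g₂ φ a b := by
  refine Eq.trans H (integral_congr_ae_Ioo ?_ (left_mem_Icc.2 hab) (right_mem_Icc.2 hab))
  filter_upwards [h] with t ht htm
  rw [ht htm]

-- The integrals over `[0,T]`, `[a,a+T]` and `[a,b]` agree by periodicity and by the support of `φ`.
lemma weakIdentity_of_forall_periodic {lam P a b : ℝ} {φ : ℝ → ℝ} (hT : 0 < T)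
    (hψ : Function.Periodic ψ T) (hg : Function.Periodic g T)
    (hH1 : ∀ a b, a ≤ b → IsH1On ψ g a b)
    (H : ∀ φ, ContDiff ℝ ∞ φ → Function.Periodic φ T → WeakIdentity lam P ψ g φ 0 T)
    (hab : a ≤ b) (hb : b ≤ a + T) (hφ : IsTestFunction φ a b) :
    WeakIdentity lam P ψ g φ a b := by
  have hsmooth := hφ.contDiff_periodize hT hb
  have hper := periodize_periodic hT a φ
  have hzero := (weakIdentity_iff (hH1 0 T hT.le) hT.le hsmooth).1 (H _ hsmooth hper)
  have hintegrand : Function.Periodic (fun x => fluxDeriv lam P (ψ x) (g x) * periodize hT a φ x +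
      lam * ψ x * g x * deriv (periodize hT a φ) x) T := fun x => by
    simp only [hψ x, hg x, hper x, periodic_deriv hper x]
  have hshift := hintegrand.intervalIntegral_add_eq 0 a
  rw [zero_add, hzero] at hshift
  rw [weakIdentity_iff (hH1 a b hab) hab hφ.contDiff, hshift]
  have hunperiodize : ∀ x ∈ Ioo a (a + T), periodize hT a φ =ᶠ[𝓝 x] φ := fun x hx => by
    filter_upwards [isOpen_Ioo.mem_nhds hx] with y hy using periodize_eq hT (Ioo_subset_Ico_self hy)
  have hsupp : Function.support (fun x => fluxDeriv lam P (ψ x) (g x) * φ x +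
      lam * ψ x * g x * deriv φ x) ⊆ Ioc a b := fun x hx => by
    by_contra hxb
    have hxφ : x ∉ tsupport φ := fun h => hxb (Ioo_subset_Ioc_self (hφ.tsupport_subset h))
    have hxφ' : deriv φ x = 0 := Function.notMem_support.1 fun h => hxφ (support_deriv_subset h)
    simp [image_eq_zero_of_notMem_tsupport hxφ, hxφ'] at hx
  rw [integral_eq_integral_of_support_subset hsupp,
    ← integral_eq_integral_of_support_subset (hsupp.trans (Ioc_subset_Ioc_right hb))]
  refine (integral_congr_ae_Ioo (ae_of_all _ fun x hx => ?_) (left_mem_Icc.2 (by linarith))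
    (right_mem_Icc.2 (by linarith))).symm
  rw [(hunperiodize x hx).deriv_eq, (hunperiodize x hx).eq_of_nhds]

end PeriodicDerivative

namespace IsSolution

variable {lam P : ℝ} {ψ : ℝ → ℝ}

lemma exists_isH1On_weakIdentity (H : IsSolution lam P ψ) :
    ∃ g : ℝ → ℝ, (∀ a b, a ≤ b → IsH1On ψ g a b) ∧ ∀ a b, a ≤ b → b ≤ a + 2 * π →
      ∀ φ, IsTestFunction φ a b → WeakIdentity lam P ψ g φ a b := by
  obtain ⟨hψ, g₀, hg₀, hweak⟩ := H
  obtain ⟨g, hg, hae, hH1⟩ := hg₀.exists_periodic two_pi_pos hψ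
  exact ⟨g, hH1, fun a b hab hb φ hφ => weakIdentity_of_forall_periodic two_pi_pos hψ hg hH1
    (fun φ hφ hφ_per => (hweak φ hφ hφ_per).congr_ae two_pi_pos.le hae) hab hb hφ⟩

lemma continuous (H : IsSolution lam P ψ) : Continuous ψ := by
  obtain ⟨g, hg, -⟩ := H.exists_isH1On_weakIdentity
  refine continuous_iff_continuousAt.2 fun x => ?_
  exact ((hg (x - 1) (x + 1) (by linarith)).continuousOn (by linarith)).continuousAt
    (Icc_mem_nhds (by linarith) (by linarith))

lemma isLocalSolution (H : IsSolution lam P ψ) {a b : ℝ} (hab : a < b) (hb : b ≤ a + 2 * π)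
    (ha_zero : ψ a = 0) (hb_zero : ψ b = 0) (hne : ∀ θ ∈ Ioo a b, ψ θ ≠ 0) :
    IsLocalSolution lam P ψ a b := by
  obtain ⟨g, hg, hweak⟩ := H.exists_isH1On_weakIdentity
  exact ⟨hab, ha_zero, hb_zero, hne, g, hg a b hab.le,
    fun φ hφ hcomp hsub => hweak a b hab.le hb φ ⟨hφ, hcomp, hsub⟩⟩

end IsSolution

section Arcs

lemma IsH1On.ae_eq_zero {ψ g : ℝ → ℝ} {a b : ℝ} (h : IsH1On ψ g a b) (hab : a ≤ b)
    (hψ : ∀ x ∈ Ioo a b, ψ x = 0) : ∀ᵐ x, x ∈ Ioo a b → g x = 0 := by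
  filter_upwards [(h.intervalIntegrable hab).ae_hasDerivAt_integral] with x hx hxm
  have hxm' : x ∈ uIcc a b := by
    rw [uIcc_of_le hab]
    exact Ioo_subset_Icc_self hxm
  refine (hx hxm' x hxm').unique ((hasDerivAt_const x (0 : ℝ)).congr_of_eventuallyEq ?_)
  filter_upwards [isOpen_Ioo.mem_nhds hxm] with y hy
  rw [← h.2 x (Ioo_subset_Icc_self hxm) y (Ioo_subset_Icc_self hy), hψ x hxm, hψ y hy, sub_zero]

variable {lam P : ℝ} {ψ : ℝ → ℝ}

lemma IsSolution.exists_ne_zero (H : IsSolution lam P ψ) (hP : P ≠ 0) (hlam : lam ≠ 1) {a b : ℝ}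
    (hab : a < b) (hb : b ≤ a + 2 * π) : ∃ θ ∈ Ioo a b, ψ θ ≠ 0 := by
  by_contra! hzero
  obtain ⟨g, hg, hweak⟩ := H.exists_isH1On_weakIdentity
  obtain ⟨η, hη, hη_one⟩ := exists_isTestFunction_integral_eq_one hab
  have hid := hweak a b hab.le hb η hη
  have hright : ∀ᵐ x, x ∈ Ioo a b → (-(2 * lam - 1) * g x ^ 2 + lam ^ 2 * ψ x ^ 2) * η x
      - lam * ψ x * g x * deriv η x = 0 := by
    filter_upwards [(hg a b hab.le).ae_eq_zero hab.le hzero] with x hx hxm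
    rw [hx hxm, hzero x hxm]
    ring
  rw [WeakIdentity, integral_congr_ae_Ioo hright (left_mem_Icc.2 hab.le) (right_mem_Icc.2 hab.le),
    intervalIntegral.integral_const_mul, hη_one, intervalIntegral.integral_zero, mul_one] at hid
  exact mul_ne_zero (mul_ne_zero two_ne_zero (sub_ne_zero.2 hlam)) hP hid

lemma exists_Ioo_forall_ne_zero (hψ : Continuous ψ) {a b x : ℝ} (hx : x ∈ Ioo a b)
    (ha : ψ a = 0) (hb : ψ b = 0) (hne : ψ x ≠ 0) :
    ∃ c d, a ≤ c ∧ c < d ∧ d ≤ b ∧ ψ c = 0 ∧ ψ d = 0 ∧ ∀ θ ∈ Ioo c d, ψ θ ≠ 0 := by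
  have hclosed : IsClosed {θ | ψ θ = 0} := isClosed_eq hψ continuous_const
  obtain ⟨c, ⟨hc, hc_zero⟩, hc_max⟩ :=
    (isCompact_Icc.inter_right hclosed (s := Icc a x)).exists_isGreatest
      ⟨a, left_mem_Icc.2 hx.1.le, ha⟩
  obtain ⟨d, ⟨hd, hd_zero⟩, hd_min⟩ :=
    (isCompact_Icc.inter_right hclosed (s := Icc x b)).exists_isLeast
      ⟨b, right_mem_Icc.2 hx.2.le, hb⟩
  have hcx : c < x := lt_of_le_of_ne hc.2 fun h => hne (h ▸ hc_zero)
  refine ⟨c, d, hc.1, hcx.trans_le hd.1, hd.2, hc_zero, hd_zero, fun θ hθ hzero => ?_⟩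
  rcases le_total θ x with h | h
  · exact absurd (hc_max ⟨⟨hc.1.trans hθ.1.le, h⟩, hzero⟩) (not_le.2 hθ.1)
  · exact absurd (hd_min ⟨⟨h, hθ.2.le.trans hd.2⟩, hzero⟩) (not_le.2 hθ.2)

lemma IsSolution.exists_isLocalSolution_of_zeros (H : IsSolution lam P ψ) {a b x : ℝ}
    (hx : x ∈ Ioo a b) (hb : b ≤ a + 2 * π) (ha_zero : ψ a = 0) (hb_zero : ψ b = 0)
    (hne : ψ x ≠ 0) : ∃ c d, IsLocalSolution lam P ψ c d ∧ d - c ≤ b - a := by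
  obtain ⟨c, d, hac, hcd, hdb, hc, hd, hcd_ne⟩ :=
    exists_Ioo_forall_ne_zero H.continuous hx ha_zero hb_zero hne
  exact ⟨c, d, H.isLocalSolution hcd (by linarith) hc hd hcd_ne, by linarith⟩

-- One of the two arcs between the zeros has length at most `π`.
lemma IsSolution.exists_isLocalSolution_le_pi (H : IsSolution lam P ψ) (hP : P ≠ 0)
    (hlam : lam ≠ 1) {θ₁ θ₂ : ℝ} (h₁ : θ₁ ∈ Ico 0 (2 * π)) (h₂ : θ₂ ∈ Ico 0 (2 * π))
    (hne : θ₁ ≠ θ₂) (hz₁ : ψ θ₁ = 0) (hz₂ : ψ θ₂ = 0) :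
    ∃ a b, IsLocalSolution lam P ψ a b ∧ b - a ≤ π := by
  wlog hlt : θ₁ < θ₂ generalizing θ₁ θ₂
  · exact this h₂ h₁ hne.symm hz₂ hz₁ (lt_of_le_of_ne (not_lt.1 hlt) hne.symm)
  have harc : ∀ a b, a < b → b - a ≤ π → ψ a = 0 → ψ b = 0 →
      ∃ a b, IsLocalSolution lam P ψ a b ∧ b - a ≤ π := by
    intro a b hab hle ha hb
    have hle' : b ≤ a + 2 * π := by linarith [pi_pos]
    obtain ⟨x, hx, hx_ne⟩ := H.exists_ne_zero hP hlam hab hle'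
    obtain ⟨c, d, hloc, hcd⟩ := H.exists_isLocalSolution_of_zeros hx hle' ha hb hx_ne
    exact ⟨c, d, hloc, hcd.trans hle⟩
  rcases le_or_gt (θ₂ - θ₁) π with h | h
  · exact harc θ₁ θ₂ hlt h hz₁ hz₂
  · exact harc θ₂ (θ₁ + 2 * π) (by linarith [h₁.1, h₂.2]) (by linarith) hz₂ (by rw [H.1, hz₁])

end Arcs

section Lifespans

variable {lam P B a b : ℝ} {ψ : ℝ → ℝ}

lemma IsLocalSolution.exists_isProfile (H : IsLocalSolution lam P ψ a b) (hlam : lam ≠ 0)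
    (HB : HasBernoulli lam P B ψ a b) : ∃ ψ', IsProfile lam P B ψ' a b :=
  (H.isProfile_or_isProfile_neg hlam HB).elim (fun h => ⟨_, h⟩) (fun h => ⟨_, h⟩)

lemma IsLocalSolution.exists_bernoulli_isProfile (H : IsLocalSolution lam P ψ a b)
    (hlam : lam ≠ 0) : ∃ B ψ', IsProfile lam P B ψ' a b :=
  (H.exists_hasBernoulli hlam).imp fun _ HB => H.exists_isProfile hlam HB

lemma IsProfile.pressure_neg_of_le_half (H : IsProfile lam P B ψ a b) (h0 : 0 < lam)
    (h1 : lam ≤ 1 / 2) : P < 0 := by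
  obtain rfl := H.bernoulli_eq_zero_of_le_half h0 h1
  obtain ⟨-, M, hM, hPM, -⟩ := H.eq_mul_cos_of_bernoulli_eq_zero h0
  have : 0 < lam ^ 2 * M ^ 2 := by positivity
  linarith

lemma IsProfile.lifespan_mem_Ioc (H : IsProfile lam P B ψ a b) (h0 : 0 < lam) (h1 : lam < 1)
    (hP : P < 0) : b - a ∈ Ioc π (π / lam) := by
  rcases (H.bernoulli_nonneg_of_lt_one h0 h1).eq_or_lt with rfl | hB
  · rw [(H.eq_mul_cos_of_bernoulli_eq_zero h0).1]
    exact ⟨(lt_div_iff₀ h0).2 (mul_lt_of_lt_one_right pi_pos h1), le_rfl⟩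
  · exact Ioo_subset_Ioc_self (H.lifespan_mem_Ioo h0 h1 hP hB)

lemma IsProfile.lifespan_le_pi (H : IsProfile lam P B ψ a b) (h0 : 0 < lam)
    (hP : 0 ≤ P * (1 - lam)) : b - a ≤ π := by
  obtain ⟨M, -, -, h⟩ := H.lifespan_eq h0 hP
  exact h ▸ timeMap_le_pi (abs_nonneg _)

lemma IsProfile.lifespan_lt_two_pi (H : IsProfile lam P B ψ a b) (hlam : 1 / 2 < lam) :
    b - a < 2 * π := by
  have h0 : 0 < lam := by linarith
  rcases le_or_gt 0 (P * (1 - lam)) with hP | hP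
  · linarith [H.lifespan_le_pi h0 hP, pi_pos]
  · have h1 : lam < 1 := by
      by_contra! hge
      have hne : lam ≠ 1 := by
        rintro rfl
        simp at hP
      nlinarith [H.pressure_nonpos_of_one_lt (lt_of_le_of_ne hge hne.symm)]
    refine (H.lifespan_mem_Ioc h0 h1 (neg_of_mul_neg_left hP (by linarith))).2.trans_lt ?_
    rw [div_lt_iff₀ h0]
    nlinarith [pi_pos]

end Lifespans

section Nonexistence

variable {lam P : ℝ} {ψ : ℝ → ℝ}

theorem not_isHyperbolic_of_lt_one (h0 : 0 < lam) (h1 : lam < 1) (hP : P < 0) :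
    ¬ IsHyperbolic lam P ψ := by
  rintro ⟨H, ⟨θ₁, hθ₁, θ₂, hθ₂, hne, hz₁, hz₂⟩, -⟩
  obtain ⟨a, b, hloc, hle⟩ := H.exists_isLocalSolution_le_pi hP.ne h1.ne hθ₁ hθ₂ hne hz₁ hz₂
  obtain ⟨B, ψ', hprofile⟩ := hloc.exists_bernoulli_isProfile h0.ne'
  exact hle.not_gt (hprofile.lifespan_mem_Ioc h0 h1 hP).1

theorem not_isHyperbolic_of_one_lt (h1 : 1 < lam) (hP : 0 < P) : ¬ IsHyperbolic lam P ψ := by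
  rintro ⟨H, ⟨θ₁, hθ₁, θ₂, hθ₂, hne, hz₁, hz₂⟩, -⟩
  obtain ⟨a, b, hloc, -⟩ := H.exists_isLocalSolution_le_pi hP.ne' h1.ne' hθ₁ hθ₂ hne hz₁ hz₂
  obtain ⟨B, ψ', hprofile⟩ := hloc.exists_bernoulli_isProfile (by linarith)
  exact hP.not_ge (hprofile.pressure_nonpos_of_one_lt h1)

lemma IsSolution.eq_zero_of_pressure_nonneg_of_le_half (H : IsSolution lam P ψ) (h0 : 0 < lam)
    (h1 : lam ≤ 1 / 2) (hP : 0 ≤ P) {z : ℝ} (hz : ψ z = 0) (θ : ℝ) : ψ θ = 0 := by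
  by_contra hθ
  obtain ⟨x, hx, hψx⟩ := H.1.exists_mem_Ico two_pi_pos θ z
  rw [hψx] at hθ
  have hzx : z < x := lt_of_le_of_ne hx.1 fun h => hθ (h ▸ hz)
  obtain ⟨a, b, hloc, -⟩ := H.exists_isLocalSolution_of_zeros ⟨hzx, hx.2⟩ le_rfl hz
    (by rw [H.1, hz]) hθ
  obtain ⟨B, ψ', hprofile⟩ := hloc.exists_bernoulli_isProfile h0.ne'
  exact hP.not_gt (hprofile.pressure_neg_of_le_half h0 h1)

theorem not_isHyperbolic_of_le_half (h0 : 0 < lam) (h1 : lam ≤ 1 / 2) :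
    ¬ IsHyperbolic lam P ψ := fun H => by
  rcases lt_or_ge P 0 with hP | hP
  · exact not_isHyperbolic_of_lt_one h0 (by linarith) hP H
  · obtain ⟨hsol, ⟨z, -, -, -, -, hz, -⟩, hshear⟩ := H
    refine hshear ⟨0, 0, 0, fun θ => ?_⟩
    rw [ite_self, mul_zero, hsol.eq_zero_of_pressure_nonneg_of_le_half h0 h1 hP hz]

end Nonexistence

section ParabolicStream

/-- The angular part `ψ` of the parabolic flows with stream function `r ^ (1 / 2) * ψ θ`;
`ε = ± 1` is its sign and `θ₀` its axis of symmetry. -/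
noncomputable def parabolicStream (γ ε θ₀ θ : ℝ) : ℝ := ε * √(γ + γ * cos (θ - θ₀))

/-- The derivative of `parabolicStream` away from its zeros; it vanishes at the zeros because
there the denominator is `0`. -/
noncomputable def parabolicStreamDeriv (γ ε θ₀ θ : ℝ) : ℝ :=
  ε * (-(γ * sin (θ - θ₀)) / (2 * √(γ + γ * cos (θ - θ₀))))

variable {γ ε θ₀ θ : ℝ}

lemma add_mul_cos_nonneg (hγ : 0 ≤ γ) (x : ℝ) : 0 ≤ γ + γ * cos x := by
  nlinarith [neg_one_le_cos x]

lemma parabolicStream_eq_zero_iff (hγ : 0 < γ) (hε : ε = 1 ∨ ε = -1) :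
    parabolicStream γ ε θ₀ θ = 0 ↔ ∃ k : ℤ, θ = θ₀ + π + k * (2 * π) := by
  have hε_ne : ε ≠ 0 := by rcases hε with rfl | rfl <;> norm_num
  have hcos : γ + γ * cos (θ - θ₀) = γ * (1 - cos (θ - θ₀ - π)) := by
    rw [cos_sub_pi]
    ring
  rw [parabolicStream, mul_eq_zero, or_iff_right hε_ne,
    Real.sqrt_eq_zero (add_mul_cos_nonneg hγ.le _), hcos, mul_eq_zero, or_iff_right hγ.ne',
    sub_eq_zero, eq_comm, cos_eq_one_iff]
  exact exists_congr fun k => ⟨fun h => by linarith, fun h => by linarith⟩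

lemma countable_parabolicStream_eq_zero (hγ : 0 < γ) (hε : ε = 1 ∨ ε = -1) :
    {θ | parabolicStream γ ε θ₀ θ = 0}.Countable := by
  refine (countable_range fun k : ℤ => θ₀ + π + k * (2 * π)).mono fun θ hθ => ?_
  obtain ⟨k, hk⟩ := (parabolicStream_eq_zero_iff hγ hε).1 hθ
  exact ⟨k, hk.symm⟩

lemma parabolicStream_sq (hγ : 0 ≤ γ) (hε : ε = 1 ∨ ε = -1) :
    parabolicStream γ ε θ₀ θ ^ 2 = γ + γ * cos (θ - θ₀) := by
  rw [parabolicStream, mul_pow, Real.sq_sqrt (add_mul_cos_nonneg hγ _), sq_eq_one_iff.2 hε,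
    one_mul]

lemma hasDerivAt_parabolicStream (h : parabolicStream γ ε θ₀ θ ≠ 0) :
    HasDerivAt (parabolicStream γ ε θ₀) (parabolicStreamDeriv γ ε θ₀ θ) θ := by
  have hne : γ + γ * cos (θ - θ₀) ≠ 0 := fun h0 => h (by simp [parabolicStream, h0])
  have hinner : HasDerivAt (fun x => γ + γ * cos (x - θ₀)) (-(γ * sin (θ - θ₀))) θ :=
    ((((hasDerivAt_id θ).sub_const θ₀).cos.const_mul γ).const_add γ).congr_deriv (by simp)
  exact (hinner.sqrt hne).const_mul ε

lemma flux_parabolicStream (hγ : 0 ≤ γ) (hε : ε = 1 ∨ ε = -1) :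
    1 / 2 * parabolicStream γ ε θ₀ θ * parabolicStreamDeriv γ ε θ₀ θ =
      -(γ / 4) * sin (θ - θ₀) := by
  have hε_sq : ε ^ 2 = 1 := sq_eq_one_iff.2 hε
  rcases eq_or_ne (√(γ + γ * cos (θ - θ₀))) 0 with h0 | h0
  · have hzero : γ * (1 + cos (θ - θ₀)) = 0 := by
      linarith [(Real.sqrt_eq_zero (add_mul_cos_nonneg hγ _)).1 h0]
    have hsin : γ * sin (θ - θ₀) = 0 := by
      refine (pow_eq_zero_iff two_ne_zero).1 ?_
      rw [mul_pow, sin_sq]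
      linear_combination γ * (1 - cos (θ - θ₀)) * hzero
    rw [parabolicStream, h0]
    linarith
  · rw [parabolicStream, parabolicStreamDeriv]
    generalize √(γ + γ * cos (θ - θ₀)) = r at h0 ⊢
    field_simp
    rw [hε_sq]
    ring

lemma parabolicStreamDeriv_sq (hγ : 0 ≤ γ) (hε : ε = 1 ∨ ε = -1)
    (h : parabolicStream γ ε θ₀ θ ≠ 0) :
    parabolicStreamDeriv γ ε θ₀ θ ^ 2 = γ * (1 - cos (θ - θ₀)) / 4 := by
  have hflux := flux_parabolicStream (θ₀ := θ₀) (θ := θ) hγ hε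
  refine mul_left_cancel₀ (pow_ne_zero 2 h) ?_
  calc parabolicStream γ ε θ₀ θ ^ 2 * parabolicStreamDeriv γ ε θ₀ θ ^ 2
      = 4 * (1 / 2 * parabolicStream γ ε θ₀ θ * parabolicStreamDeriv γ ε θ₀ θ) ^ 2 := by ring
    _ = parabolicStream γ ε θ₀ θ ^ 2 * (γ * (1 - cos (θ - θ₀)) / 4) := by
        rw [hflux, mul_pow, sin_sq, parabolicStream_sq hγ hε]
        ring

lemma intervalIntegrable_parabolicStreamDeriv_sq (hγ : 0 < γ) (hε : ε = 1 ∨ ε = -1) (x y : ℝ) :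
    IntervalIntegrable (fun θ => parabolicStreamDeriv γ ε θ₀ θ ^ 2) volume x y := by
  have hint : IntervalIntegrable (fun θ => γ * (1 - cos (θ - θ₀)) / 4) volume x y :=
    Continuous.intervalIntegrable (by fun_prop) _ _
  refine hint.congr_ae (ae_restrict_of_ae ?_)
  filter_upwards [(countable_parabolicStream_eq_zero hγ hε).ae_notMem volume] with θ hθ
  exact (parabolicStreamDeriv_sq hγ.le hε hθ).symm

lemma periodic_parabolicStream : Function.Periodic (parabolicStream γ ε θ₀) (2 * π) :=
  (cos_periodic.sub_const θ₀).comp fun c => ε * √(γ + γ * c)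

lemma isSolution_parabolicStream (hγ : 0 < γ) (hε : ε = 1 ∨ ε = -1) :
    IsSolution (1 / 2) (-γ / 4) (parabolicStream γ ε θ₀) := by
  have hS := countable_parabolicStream_eq_zero (θ₀ := θ₀) hγ hε
  have hflux : (fun θ => 1 / 2 * parabolicStream γ ε θ₀ θ * parabolicStreamDeriv γ ε θ₀ θ) =
      fun θ => -(γ / 4) * sin (θ - θ₀) := funext fun θ => flux_parabolicStream hγ.le hε
  have hH1 : IsH1On (parabolicStream γ ε θ₀) (parabolicStreamDeriv γ ε θ₀) 0 (2 * π) := by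
    refine isH1On_of_hasDerivAt_off_countable hS ?_ ?_ (fun θ => hasDerivAt_parabolicStream)
      (intervalIntegrable_parabolicStreamDeriv_sq hγ hε) two_pi_pos.le
    · unfold parabolicStream
      fun_prop
    · unfold parabolicStreamDeriv
      fun_prop
  refine ⟨periodic_parabolicStream, _, hH1, fun φ hφ hφ_periodic =>
    weakIdentity_of_hasDerivAt_flux hS hH1 two_pi_pos.le ?_ (fun θ _ => ?_) hφ ?_⟩
  · rw [hflux]
    fun_prop
  · rw [hflux, fluxDeriv, parabolicStream_sq hγ.le hε]
    refine (((hasDerivAt_id θ).sub_const θ₀).sin.const_mul (-(γ / 4))).congr_deriv ?_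
    simp only [id_eq, mul_one]
    ring
  · rw [flux_parabolicStream hγ.le hε, flux_parabolicStream hγ.le hε, hφ_periodic.eq,
      show 2 * π - θ₀ = 0 - θ₀ + 2 * π by ring, sin_add_two_pi]

lemma isParabolic_parabolicStream (hγ : 0 < γ) (hε : ε = 1 ∨ ε = -1) :
    IsParabolic (1 / 2) (-γ / 4) (parabolicStream γ ε θ₀) := by
  obtain ⟨m, hm, hm_unique⟩ := existsUnique_add_zsmul_mem_Ico two_pi_pos (θ₀ + π) 0
  simp only [zero_add, zsmul_eq_mul] at hm hm_unique
  refine ⟨isSolution_parabolicStream hγ hε, θ₀ + π + m * (2 * π),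
    ⟨hm, (parabolicStream_eq_zero_iff hγ hε).2 ⟨m, rfl⟩⟩, ?_⟩
  rintro θ ⟨hθ, hzero⟩
  obtain ⟨k, rfl⟩ := (parabolicStream_eq_zero_iff hγ hε).1 hzero
  rw [hm_unique k hθ]

end ParabolicStream

section ParabolicClassification

variable {lam P : ℝ} {ψ : ℝ → ℝ}

lemma eq_of_periodic_of_eqOn_Ico {f g : ℝ → ℝ} {T z : ℝ} (hT : 0 < T)
    (hf : Function.Periodic f T) (hg : Function.Periodic g T) (h : EqOn f g (Ico z (z + T))) :
    f = g :=
  funext fun x => by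
    rw [← hf.sub_zsmul_eq (toIcoDiv hT z x), ← hg.sub_zsmul_eq (toIcoDiv hT z x),
      h (sub_toIcoDiv_zsmul_mem_Ico hT z x)]

lemma IsParabolic.exists_isLocalSolution (H : IsParabolic lam P ψ) :
    ∃ z, IsLocalSolution lam P ψ z (z + 2 * π) := by
  obtain ⟨hsol, z, ⟨hz, hz_zero⟩, hz_unique⟩ := H
  refine ⟨z, hsol.isLocalSolution (by linarith [pi_pos]) le_rfl hz_zero (by rw [hsol.1, hz_zero])
    fun θ hθ hzero => ?_⟩
  rcases lt_or_ge θ (2 * π) with hlt | hge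
  · exact hθ.1.ne' (hz_unique θ ⟨⟨hz.1.trans hθ.1.le, hlt⟩, hzero⟩)
  · have hshift : ψ (θ - 2 * π) = 0 := by rw [← hsol.1, sub_add_cancel, hzero]
    linarith [hθ.2, hz_unique (θ - 2 * π) ⟨⟨by linarith, by linarith [hθ.2, hz.2]⟩, hshift⟩]

lemma sqrt_add_mul_cos {M x : ℝ} (hM : 0 ≤ M) (hx : x ∈ Icc (-π) π) :
    √(M ^ 2 / 2 + M ^ 2 / 2 * cos x) = M * cos (x / 2) := by
  have hcos : 0 ≤ cos (x / 2) := cos_nonneg_of_mem_Icc ⟨by linarith [hx.1], by linarith [hx.2]⟩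
  have hhalf : cos (x / 2) ^ 2 = 1 / 2 + cos x / 2 := by
    rw [cos_sq, mul_div_cancel₀ _ (two_ne_zero' ℝ)]
  rw [show M ^ 2 / 2 + M ^ 2 / 2 * cos x = (M * cos (x / 2)) ^ 2 by rw [mul_pow, hhalf]; ring,
    Real.sqrt_sq (by positivity)]

lemma IsProfile.eq_sqrt_of_lifespan_eq_two_pi {B z : ℝ} (H : IsProfile lam P B ψ z (z + 2 * π))
    (h0 : 0 < lam) : lam = 1 / 2 ∧ ∃ γ, 0 < γ ∧ P = -γ / 4 ∧
      ∀ θ ∈ Icc z (z + 2 * π), ψ θ = √(γ + γ * cos (θ - (z + π))) := by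
  have hle : lam ≤ 1 / 2 := by
    by_contra! hlt
    linarith [H.lifespan_lt_two_pi hlt]
  obtain rfl := H.bernoulli_eq_zero_of_le_half h0 hle
  obtain ⟨hlife, M, hM, hMP, hcos⟩ := H.eq_mul_cos_of_bernoulli_eq_zero h0
  obtain rfl : lam = 1 / 2 := by
    rw [add_sub_cancel_left, eq_div_iff h0.ne'] at hlife
    exact mul_left_cancel₀ pi_pos.ne' (by linarith)
  refine ⟨rfl, M ^ 2 / 2, by positivity, by linarith, fun θ hθ => ?_⟩
  rw [hcos θ hθ, sqrt_add_mul_cos hM.le ⟨by linarith [hθ.1], by linarith [hθ.2]⟩]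
  ring_nf

lemma IsParabolic.exists_eq_parabolicStream (hlam : 0 < lam) (H : IsParabolic lam P ψ) :
    lam = 1 / 2 ∧ ∃ γ ε θ₀ : ℝ, 0 < γ ∧ (ε = 1 ∨ ε = -1) ∧ P = -γ / 4 ∧
      ψ = parabolicStream γ ε θ₀ := by
  obtain ⟨z, hloc⟩ := H.exists_isLocalSolution
  obtain ⟨B, hB⟩ := hloc.exists_hasBernoulli hlam.ne'
  obtain ⟨ε, hε, hprofile⟩ :
      ∃ ε : ℝ, (ε = 1 ∨ ε = -1) ∧ IsProfile lam P B (fun θ => ε * ψ θ) z (z + 2 * π) := by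
    rcases hloc.isProfile_or_isProfile_neg hlam.ne' hB with h | h
    · exact ⟨1, Or.inl rfl, by simpa only [one_mul] using h⟩
    · exact ⟨-1, Or.inr rfl, by simpa only [neg_one_mul] using h⟩
  obtain ⟨hlam_eq, γ, hγ, hPγ, hψ⟩ := hprofile.eq_sqrt_of_lifespan_eq_two_pi hlam
  refine ⟨hlam_eq, γ, ε, z + π, hγ, hε, hPγ, eq_of_periodic_of_eqOn_Ico two_pi_pos H.1.1
    periodic_parabolicStream (z := z) fun θ hθ => ?_⟩
  rw [parabolicStream, ← hψ θ (Ico_subset_Icc_self hθ), ← mul_assoc, ← sq, sq_eq_one_iff.2 hε,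
    one_mul]

theorem isParabolic_iff (hlam : 0 < lam) :
    IsParabolic lam P ψ ↔ lam = 1 / 2 ∧ ∃ γ ε θ₀ : ℝ, 0 < γ ∧ (ε = 1 ∨ ε = -1) ∧ P = -γ / 4 ∧
      ∀ θ : ℝ, ψ θ = ε * √(γ + γ * cos (θ - θ₀)) := by
  constructor
  · intro H
    obtain ⟨hlam_eq, γ, ε, θ₀, hγ, hε, hP, rfl⟩ := H.exists_eq_parabolicStream hlam
    exact ⟨hlam_eq, γ, ε, θ₀, hγ, hε, hP, fun _ => rfl⟩
  · rintro ⟨rfl, γ, ε, θ₀, hγ, hε, rfl, h⟩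
    exact (funext h : ψ = parabolicStream γ ε θ₀) ▸ isParabolic_parabolicStream hγ hε

end ParabolicClassification

section BernoulliOfMax

variable {lam P M : ℝ}

lemma bernoulliOfMax_eq_add (hM : 0 < M) :
    bernoulliOfMax lam P M = 2 * P * M ^ (2 / lam - 2) + lam ^ 2 * M ^ (2 / lam) := by
  have hsplit : M ^ (2 / lam) = M ^ 2 * M ^ (2 / lam - 2) := by
    rw [← Real.rpow_natCast, ← Real.rpow_add hM, Nat.cast_ofNat, add_sub_cancel]
  rw [bernoulliOfMax, hsplit]
  ring

lemma pressureRatio_ne_zero (hlam : lam ≠ 0) (hP : P ≠ 0) (hM : M ≠ 0) :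
    pressureRatio lam P M ≠ 0 :=
  div_ne_zero (mul_ne_zero two_ne_zero hP) (by positivity)

lemma bernoulliOfMax_eq_mul (hlam : lam ≠ 0) (hM : 0 < M) :
    bernoulliOfMax lam P M =
      lam ^ 2 * M ^ 2 * M ^ (2 / lam - 2) * (1 + pressureRatio lam P M) := by
  rw [bernoulliOfMax, pressureRatio]
  field_simp
  ring

lemma bernoulliOfMax_eq_mul_one_sub_abs (hlam : lam ≠ 0) (hP : P < 0) (hM : 0 < M) :
    bernoulliOfMax lam P M =
      lam ^ 2 * M ^ 2 * M ^ (2 / lam - 2) * (1 - |pressureRatio lam P M|) := by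
  have hneg : pressureRatio lam P M < 0 := div_neg_of_neg_of_pos (by linarith) (by positivity)
  rw [bernoulliOfMax_eq_mul hlam hM, abs_of_neg hneg, sub_neg_eq_add]

lemma bernoulliOfMax_pos (hlam : lam ≠ 0) (hP : 0 ≤ P) (hM : 0 < M) :
    0 < bernoulliOfMax lam P M := by
  unfold bernoulliOfMax
  positivity

lemma mul_rpow_le_mul_rpow (h0 : 0 < lam) (hP : 0 ≤ P * (1 - lam)) {x y : ℝ} (hx : 0 < x)
    (hxy : x ≤ y) : P * x ^ (2 / lam - 2) ≤ P * y ^ (2 / lam - 2) := by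
  rcases lt_trichotomy lam 1 with h | rfl | h
  · have hexp : 0 ≤ 2 / lam - 2 := by
      rw [sub_nonneg, le_div_iff₀ h0]
      linarith
    exact mul_le_mul_of_nonneg_left (Real.rpow_le_rpow hx.le hxy hexp)
      (nonneg_of_mul_nonneg_left hP (by linarith))
  · norm_num
  · have hexp : 2 / lam - 2 ≤ 0 := by
      rw [sub_nonpos, div_le_iff₀ h0]
      linarith
    have hP_nonpos : P ≤ 0 := by
      by_contra! hpos
      nlinarith
    exact mul_le_mul_of_nonpos_left (Real.rpow_le_rpow_of_nonpos hx hxy hexp) hP_nonpos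

lemma strictMonoOn_bernoulliOfMax (h0 : 0 < lam) (hP : 0 ≤ P * (1 - lam)) :
    StrictMonoOn (bernoulliOfMax lam P) (Ioi 0) := by
  intro x hx y hy hxy
  rw [bernoulliOfMax_eq_add hx, bernoulliOfMax_eq_add hy]
  have hpow : lam ^ 2 * x ^ (2 / lam) < lam ^ 2 * y ^ (2 / lam) :=
    mul_lt_mul_of_pos_left (Real.rpow_lt_rpow (le_of_lt hx) hxy (by positivity)) (by positivity)
  linarith [mul_rpow_le_mul_rpow h0 hP hx hxy.le]

lemma exists_le_bernoulliOfMax (h0 : 0 < lam) (hP : 0 ≤ P * (1 - lam)) (B : ℝ) :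
    ∃ M, 0 < M ∧ B ≤ bernoulliOfMax lam P M := by
  have hlim : Tendsto (fun M : ℝ => lam ^ 2 * M ^ (2 / lam)) atTop atTop :=
    (tendsto_rpow_atTop (by positivity)).const_mul_atTop (by positivity)
  obtain ⟨M, hMB, hM1⟩ := ((hlim.eventually_ge_atTop (B - 2 * P)).and
    (eventually_ge_atTop 1)).exists
  have hM : 0 < M := by linarith
  have hge := mul_rpow_le_mul_rpow h0 hP one_pos hM1
  rw [Real.one_rpow] at hge
  exact ⟨M, hM, by rw [bernoulliOfMax_eq_add hM]; linarith⟩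

lemma tendsto_rpow_nhdsGT_zero {p : ℝ} (hp : 0 < p) :
    Tendsto (fun x : ℝ => x ^ p) (𝓝[>] 0) (𝓝 0) := by
  have h := (Real.continuousAt_rpow_const 0 p (Or.inr hp.le)).tendsto
  rw [Real.zero_rpow hp.ne'] at h
  exact h.mono_left nhdsWithin_le_nhds

lemma tendsto_bernoulliOfMax_of_lt_one (h0 : 0 < lam) (h1 : lam < 1) :
    Tendsto (bernoulliOfMax lam P) (𝓝[>] 0) (𝓝 0) := by
  have hexp : 0 < 2 / lam - 2 := by
    rw [sub_pos, lt_div_iff₀ h0]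
    linarith
  have h := ((tendsto_rpow_nhdsGT_zero hexp).const_mul (2 * P)).add
    ((tendsto_rpow_nhdsGT_zero (div_pos two_pos h0)).const_mul (lam ^ 2))
  rw [mul_zero, mul_zero, add_zero] at h
  refine h.congr' ?_
  filter_upwards [self_mem_nhdsWithin] with M hM using (bernoulliOfMax_eq_add hM).symm

lemma tendsto_bernoulliOfMax_of_one_lt (h1 : 1 < lam) (hP : P < 0) :
    Tendsto (bernoulliOfMax lam P) (𝓝[>] 0) atBot := by
  have h0 : 0 < lam := by linarith
  have hexp : 2 / lam - 2 < 0 := by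
    rw [sub_neg, div_lt_iff₀ h0]
    linarith
  refine (((tendsto_rpow_neg_nhdsGT_zero hexp).const_mul_atTop_of_neg
    (show 2 * P < 0 by linarith)).atBot_add
    ((tendsto_rpow_nhdsGT_zero (div_pos two_pos h0)).const_mul (lam ^ 2))).congr' ?_
  filter_upwards [self_mem_nhdsWithin] with M hM using (bernoulliOfMax_eq_add hM).symm

lemma exists_bernoulliOfMax_eq (h0 : 0 < lam) (hP : 0 ≤ P * (1 - lam)) {B : ℝ}
    (h : ∃ᶠ M in 𝓝[>] 0, bernoulliOfMax lam P M ≤ B) :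
    ∃ M, 0 < M ∧ bernoulliOfMax lam P M = B := by
  obtain ⟨x, hxB, hx⟩ := (h.and_eventually self_mem_nhdsWithin).exists
  obtain ⟨y, hy, hyB⟩ := exists_le_bernoulliOfMax h0 hP B
  have hcont : ContinuousOn (bernoulliOfMax lam P) (Ioi 0) := by
    unfold bernoulliOfMax
    exact (by fun_prop : Continuous fun M : ℝ => 2 * P + lam ^ 2 * M ^ 2).continuousOn.mul
      (continuousOn_id.rpow_const fun M hM => Or.inl (ne_of_gt hM))
  exact isPreconnected_Ioi.intermediate_value hx hy hcont ⟨hxB, hyB⟩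

end BernoulliOfMax

section TimeMapRange

variable {lam s t : ℝ}

lemma image_timeMap_Ioi (hlam : lam ≠ 1) (hs : 0 ≤ s) :
    timeMap lam '' Ioi s = Ioo 0 (timeMap lam s) := by
  refine Subset.antisymm ?_ fun y hy => exists_timeMap_eq hlam hs hy
  rintro _ ⟨t, ht, rfl⟩
  have ht_nonneg : 0 ≤ t := hs.trans (le_of_lt ht)
  exact ⟨timeMap_pos ht_nonneg, strictAntiOn_timeMap hlam hs ht_nonneg ht⟩

lemma image_timeMap_Ioo (hlam : lam ≠ 1) (hs : 0 ≤ s) (hst : s < t) :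
    timeMap lam '' Ioo s t = Ioo (timeMap lam t) (timeMap lam s) := by
  have hanti := strictAntiOn_timeMap hlam
  have ht : 0 ≤ t := hs.trans hst.le
  apply Subset.antisymm
  · rintro _ ⟨r, hr, rfl⟩
    have hr_nonneg : 0 ≤ r := hs.trans hr.1.le
    exact ⟨hanti hr_nonneg ht hr.2, hanti hs hr_nonneg hr.1⟩
  · intro y hy
    obtain ⟨r, hr, rfl⟩ := exists_timeMap_eq hlam hs ⟨(timeMap_pos ht).trans hy.1, hy.2⟩
    exact ⟨r, ⟨hr, (hanti.lt_iff_gt ht (hs.trans hr.le)).1 hy.1⟩, rfl⟩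

-- At pressure `-1 / 2` and maximum `1 / lam` the Bernoulli constant is `0`, so the local solution
-- is an arch of `cos (lam * θ)`.
lemma timeMap_one (h1 : 1 < lam) : timeMap lam 1 = π / lam := by
  have h0 : 0 < lam := by linarith
  have hratio : pressureRatio lam (-1 / 2) (1 / lam) = -1 := by
    rw [pressureRatio]
    field_simp
  have hbernoulli : bernoulliOfMax lam (-1 / 2) (1 / lam) = 0 := by
    rw [bernoulliOfMax_eq_mul h0.ne' (by positivity), hratio]
    ring
  obtain ⟨ψ, hloc, hB⟩ := exists_isLocalSolution_hasBernoulli_bernoulliOfMax (lam := lam)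
    (P := -1 / 2) (M := 1 / lam) (by linarith) (by linarith) (by positivity)
  rw [hratio, abs_neg, abs_one] at hloc hB
  rw [hbernoulli] at hB
  obtain ⟨ψ', hprofile⟩ := hloc.exists_isProfile h0.ne' hB
  simpa only [sub_zero] using (hprofile.eq_mul_cos_of_bernoulli_eq_zero h0).1

end TimeMapRange

section LifespanFunction

variable {lam P : ℝ} {S : Set ℝ}

theorem exists_isLifeSpanFunction (hlam : 1 / 2 < lam) (hP : 0 ≤ P * (1 - lam))
    (hS : ∀ B ∈ S, ∃ M, 0 < M ∧ bernoulliOfMax lam P M = B) :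
    ∃ T : ℝ → ℝ, IsLifeSpanFunction lam P S T ∧ ∀ M, 0 < M → bernoulliOfMax lam P M ∈ S →
      T (bernoulliOfMax lam P M) = timeMap lam |pressureRatio lam P M| := by
  have h0 : 0 < lam := by linarith
  choose! peak hpeak_pos hpeak using hS
  have hpeak_eq : ∀ M, 0 < M → bernoulliOfMax lam P M ∈ S → peak (bernoulliOfMax lam P M) = M :=
    fun M hM hMS => (strictMonoOn_bernoulliOfMax h0 hP).injOn (hpeak_pos _ hMS) hM (hpeak _ hMS)
  refine ⟨fun B => timeMap lam |pressureRatio lam P (peak B)|, fun B hB => ⟨?_, ?_⟩,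
    fun M hM hMS => by simp only [hpeak_eq M hM hMS]⟩
  · obtain ⟨ψ, hloc, hbernoulli⟩ :=
      exists_isLocalSolution_hasBernoulli_bernoulliOfMax hlam hP (hpeak_pos B hB)
    rw [hpeak B hB] at hbernoulli
    exact ⟨ψ, 0, _, hloc, hbernoulli⟩
  · intro ψ a b H HB
    obtain ⟨ψ', hprofile⟩ := H.exists_isProfile h0.ne' HB
    obtain ⟨M, hM, rfl, hlife⟩ := hprofile.lifespan_eq h0 hP
    simp only [hpeak_eq M hM hB, hlife]

lemma image_lifespan_eq_image_timeMap {T : ℝ → ℝ} {R : Set ℝ} (hlam : lam ≠ 0) (hP : P ≠ 0)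
    (hT : ∀ M, 0 < M → bernoulliOfMax lam P M ∈ S →
      T (bernoulliOfMax lam P M) = timeMap lam |pressureRatio lam P M|)
    (hS : ∀ B ∈ S, ∃ M, 0 < M ∧ bernoulliOfMax lam P M = B) (hR : R ⊆ Ioi 0)
    (hSR : ∀ M, 0 < M → (bernoulliOfMax lam P M ∈ S ↔ |pressureRatio lam P M| ∈ R)) :
    T '' S = timeMap lam '' R := by
  apply Subset.antisymm
  · rintro _ ⟨B, hB, rfl⟩
    obtain ⟨M, hM, rfl⟩ := hS B hB
    exact ⟨_, (hSR M hM).1 hB, (hT M hM hB).symm⟩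
  · rintro _ ⟨t, ht, rfl⟩
    obtain ⟨M, hM, rfl⟩ := exists_abs_pressureRatio_eq hP hlam (hR ht)
    exact ⟨_, (hSR M hM).2 ht, hT M hM ((hSR M hM).2 ht)⟩

lemma exists_lifespan_of_one_lt (h1 : 1 < lam) (hP : P < 0) :
    ∃ T : ℝ → ℝ, IsLifeSpanFunction lam P univ T ∧
      T '' Ioi 0 = Ioo (π / lam) π ∧ T 0 = π / lam ∧ T '' Iio 0 = Ioo 0 (π / lam) := by
  have h0 : 0 < lam := by linarith
  have hP' : 0 ≤ P * (1 - lam) := mul_nonneg_of_nonpos_of_nonpos hP.le (by linarith)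
  have hmax : ∀ B : ℝ, ∃ M, 0 < M ∧ bernoulliOfMax lam P M = B := fun B =>
    exists_bernoulliOfMax_eq h0 hP'
      ((tendsto_bernoulliOfMax_of_one_lt h1 hP).eventually_le_atBot B).frequently
  obtain ⟨T, hT, hTM⟩ :=
    exists_isLifeSpanFunction (S := univ) (by linarith) hP' fun B _ => hmax B
  have hratio_pos : ∀ M, 0 < M → 0 < |pressureRatio lam P M| := fun M hM =>
    abs_pos.2 (pressureRatio_ne_zero h0.ne' hP.ne hM.ne')
  have himage : ∀ {S R : Set ℝ}, R ⊆ Ioi 0 →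
      (∀ M, 0 < M → (bernoulliOfMax lam P M ∈ S ↔ |pressureRatio lam P M| ∈ R)) →
      T '' S = timeMap lam '' R :=
    image_lifespan_eq_image_timeMap h0.ne' hP.ne (fun M hM _ => hTM M hM (mem_univ _))
      (fun B _ => hmax B)
  have hcoeff : ∀ M, 0 < M → 0 < lam ^ 2 * M ^ 2 * M ^ (2 / lam - 2) := fun M hM => by positivity
  refine ⟨T, hT, ?_, ?_, ?_⟩
  · rw [himage (R := Ioo 0 1) Ioo_subset_Ioi_self fun M hM => ?_,
      image_timeMap_Ioo h1.ne' le_rfl one_pos, timeMap_one h1, timeMap_zero]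
    rw [mem_Ioi, bernoulliOfMax_eq_mul_one_sub_abs h0.ne' hP hM, mul_pos_iff_of_pos_left
      (hcoeff M hM), sub_pos, mem_Ioo, and_iff_right (hratio_pos M hM)]
  · have hzero := himage (S := {0}) (R := {1}) (by simp) fun M hM => by
      rw [mem_singleton_iff, mem_singleton_iff, bernoulliOfMax_eq_mul_one_sub_abs h0.ne' hP hM,
        mul_eq_zero, or_iff_right (hcoeff M hM).ne', sub_eq_zero, eq_comm]
    rwa [image_singleton, image_singleton, singleton_eq_singleton_iff, timeMap_one h1] at hzero
  · rw [himage (R := Ioi 1) (Ioi_subset_Ioi zero_le_one) fun M hM => ?_,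
      image_timeMap_Ioi h1.ne' zero_le_one, timeMap_one h1]
    rw [mem_Iio, bernoulliOfMax_eq_mul_one_sub_abs h0.ne' hP hM,
      ← neg_pos, ← mul_neg, mul_pos_iff_of_pos_left (hcoeff M hM), neg_sub, sub_pos, mem_Ioi]

lemma exists_lifespan_of_lt_one (hlam : 1 / 2 < lam) (h1 : lam < 1) (hP : 0 < P) :
    ∃ T : ℝ → ℝ, IsLifeSpanFunction lam P (Ioi 0) T ∧ T '' Ioi 0 = Ioo 0 π := by
  have h0 : 0 < lam := by linarith
  have hP' : 0 ≤ P * (1 - lam) := mul_nonneg hP.le (by linarith)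
  have hmax : ∀ B ∈ Ioi (0 : ℝ), ∃ M, 0 < M ∧ bernoulliOfMax lam P M = B := fun B hB =>
    exists_bernoulliOfMax_eq h0 hP'
      ((tendsto_bernoulliOfMax_of_lt_one h0 h1).eventually_le_const hB).frequently
  obtain ⟨T, hT, hTM⟩ := exists_isLifeSpanFunction hlam hP' hmax
  refine ⟨T, hT, ?_⟩
  rw [image_lifespan_eq_image_timeMap (R := Ioi 0) h0.ne' hP.ne' hTM hmax subset_rfl
    fun M hM => ?_, image_timeMap_Ioi h1.ne le_rfl, timeMap_zero]
  exact iff_of_true (bernoulliOfMax_pos h0.ne' hP.le hM)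
    (abs_pos.2 (pressureRatio_ne_zero h0.ne' hP.ne' hM.ne'))

lemma IsLocalSolution.bernoulli_pos (hP : 0 < P) {ψ : ℝ → ℝ} {a b B : ℝ}
    (H : IsLocalSolution lam P ψ a b) (HB : HasBernoulli lam P B ψ a b) : 0 < B := by
  obtain ⟨θ, hθ⟩ := nonempty_Ioo.2 H.1
  rw [← (HB θ hθ).2]
  have := abs_pos.2 (H.2.2.2.1 θ hθ)
  positivity

end LifespanFunction

end HomEuler

theorem mainTheorem9 :
    -- hyperbolic solutions, 1/2 < λ < 1
    (∀ lam : ℝ, 1 / 2 < lam → lam < 1 →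
      (∀ P : ℝ, 0 < P → HomEuler.InfinitelyManyHyperbolic lam P) ∧
      (∀ P : ℝ, P < 0 → ∀ ψ : ℝ → ℝ, ¬ HomEuler.IsHyperbolic lam P ψ)) ∧
    -- hyperbolic solutions, 0 < λ ≤ 1/2
    (∀ lam : ℝ, 0 < lam → lam ≤ 1 / 2 →
      ∀ (P : ℝ) (ψ : ℝ → ℝ), ¬ HomEuler.IsHyperbolic lam P ψ) ∧
    -- hyperbolic solutions, λ > 1
    (∀ lam : ℝ, 1 < lam →
      (∀ P : ℝ, P < 0 → HomEuler.InfinitelyManyHyperbolic lam P) ∧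
      (∀ P : ℝ, 0 < P → ∀ ψ : ℝ → ℝ, ¬ HomEuler.IsHyperbolic lam P ψ)) ∧
    -- every local solution has a Bernoulli constant
    (∀ (lam P : ℝ) (ψ : ℝ → ℝ) (a b : ℝ), 0 < lam → HomEuler.IsLocalSolution lam P ψ a b →
      ∃ B : ℝ, HomEuler.HasBernoulli lam P B ψ a b) ∧
    -- ranges of the life-span, λ > 1 and P < 0
    (∀ lam P : ℝ, 1 < lam → P < 0 →
      ∃ T : ℝ → ℝ, HomEuler.IsLifeSpanFunction lam P Set.univ T ∧
        T '' Set.Ioi 0 = Set.Ioo (Real.pi / lam) Real.pi ∧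
        T 0 = Real.pi / lam ∧
        T '' Set.Iio 0 = Set.Ioo 0 (Real.pi / lam)) ∧
    -- ranges of the life-span, 1/2 < λ < 1 and P > 0; all Bernoulli constants are positive
    (∀ lam P : ℝ, 1 / 2 < lam → lam < 1 → 0 < P →
      (∀ (ψ : ℝ → ℝ) (a b B : ℝ), HomEuler.IsLocalSolution lam P ψ a b →
        HomEuler.HasBernoulli lam P B ψ a b → 0 < B) ∧
      ∃ T : ℝ → ℝ, HomEuler.IsLifeSpanFunction lam P (Set.Ioi 0) T ∧
        T '' Set.Ioi 0 = Set.Ioo 0 Real.pi) ∧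
    -- 1/2 < λ < 1, P < 0 and B > 0: life-spans are too long to fit twice in the circle
    (∀ lam P B : ℝ, 1 / 2 < lam → lam < 1 → P < 0 → 0 < B →
      ∀ (ψ : ℝ → ℝ) (a b : ℝ), HomEuler.IsLocalSolution lam P ψ a b →
        HomEuler.HasBernoulli lam P B ψ a b → b - a ∈ Set.Ioo Real.pi (Real.pi / lam)) ∧
    -- 0 < λ ≤ 1/2 and B > 0: there are no local solutions
    (∀ lam P B : ℝ, 0 < lam → lam ≤ 1 / 2 → 0 < B →
      ∀ (ψ : ℝ → ℝ) (a b : ℝ), HomEuler.IsLocalSolution lam P ψ a b →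
        ¬ HomEuler.HasBernoulli lam P B ψ a b) ∧
    -- parabolic solutions
    (∀ (lam P : ℝ) (ψ : ℝ → ℝ), 0 < lam →
      (HomEuler.IsParabolic lam P ψ ↔
        lam = 1 / 2 ∧ ∃ γ ε θ₀ : ℝ, 0 < γ ∧ (ε = 1 ∨ ε = -1) ∧ P = -γ / 4 ∧
          ∀ θ : ℝ, ψ θ = ε * Real.sqrt (γ + γ * Real.cos (θ - θ₀)))) := by
  refine ⟨fun lam h1 h2 => ⟨fun P hP => ?_, fun P hP ψ => ?_⟩, fun lam h0 h1 P ψ => ?_,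
    fun lam h1 => ⟨fun P hP => ?_, fun P hP ψ => ?_⟩, fun lam P ψ a b h0 H => ?_,
    fun lam P h1 hP => ?_, fun lam P h1 h2 hP => ⟨fun ψ a b B H HB => ?_, ?_⟩,
    fun lam P B h1 h2 hP hB ψ a b H HB => ?_, fun lam P B h0 h1 hB ψ a b H HB => ?_,
    fun lam P ψ h0 => HomEuler.isParabolic_iff h0⟩
  · exact HomEuler.infinitelyManyHyperbolic h1 (mul_pos hP (by linarith))
  · exact HomEuler.not_isHyperbolic_of_lt_one (by linarith) h2 hP
  · exact HomEuler.not_isHyperbolic_of_le_half h0 h1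
  · exact HomEuler.infinitelyManyHyperbolic (by linarith) (mul_pos_of_neg_of_neg hP (by linarith))
  · exact HomEuler.not_isHyperbolic_of_one_lt h1 hP
  · exact H.exists_hasBernoulli h0.ne'
  · exact HomEuler.exists_lifespan_of_one_lt h1 hP
  · exact H.bernoulli_pos hP HB
  · exact HomEuler.exists_lifespan_of_lt_one h1 h2 hP
  · obtain ⟨ψ', hprofile⟩ := H.exists_isProfile (by linarith) HB
    exact hprofile.lifespan_mem_Ioo (by linarith) h2 hP hB
  · obtain ⟨ψ', hprofile⟩ := H.exists_isProfile h0.ne' HB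
    exact hB.ne' (hprofile.bernoulli_eq_zero_of_le_half h0 h1)
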